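/- \textbf{Conventions.} Let $S$ be a finite semigroup generated by a finite set (or family) $A$ of generators, and let $(x_a)_{a\in A}$ be positive reals with $\sum_a x_a=1$. Write $S^{\mathbb 1}$ for $S$ with a new identity $\mathbb 1$ adjoined, $[u]_S$ for the value of a word $u$ over $A$, and $K(S)$ for the minimal ideal; $K(S)$ is \emph{left zero} if $xy=x$ for all $x,y\in K(S)$. On a left ideal $X\subseteq S$ the random walk moves from $s$ to $as$ with probability $x_a$; $\mathcal M(S,A)$ is the random walk on $K(S)$. A stationary distribution of a finite chain with column-stochastic transition matrix $\mathcal T$ is a vector $\Psi\ge 0$ with $\mathcal T\Psi=\Psi$ and $\sum_s\Psi_s=1$. \emph{Loop graphs.} A loop graph $G$ is an edge-labelled directed graph obtained from a straight line $\mathbb 1\to 1\to\cdots\to n$, $n\ge1$, by successively attaching directed loops, each of which touches exactly one existing vertex, different from $\mathbb 1$, and otherwise runs through new vertices. Its normal distribution is $\Psi_G=\sum_p\prod_{a\in p}x_a$, the sum over all paths $p$ in $G$ from $\mathbb 1$ to $n$, the product over the labels of $p$. \emph{Expansions.} The right Cayley graph has vertex set $S^{\mathbb 1}$ and edges $s\xrightarrow{a}sa$;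 an edge $s\to s'$ is a \emph{transition edge} if there is no path from $s'$ to $s$. The Karnofsky--Rhodes expansion $\mathsf{KR}(S,A)$ has as vertices the words over $A$ (the empty word, which is the root, included), two words being identified if the paths from $\mathbb 1$ that they label in the right Cayley graph have the same endpoint and the same set of transition edges; its edges are $u\xrightarrow{a}ua$. The McCammond expansion $\mathsf{Mc}\circ\mathsf{KR}(S,A)$ has as vertices the simple paths $p$ in $\mathsf{KR}(S,A)$ starting at the root; the edge labelled $a$ leads from $p$ to $pa$ if $pa$ is simple, and otherwise to the initial segment of $p$ that ends at the endpoint of $pa$. The edges of the first kind form its spanning tree $\mathsf T$. For a vertex $t$ write $[t]_S$ for the value of the word labelling the path $t$. Let $\Gamma(S,A)$ be $\mathsf{Mc}\circ\mathsf{KR}(S,A)$ without the edges that leave vertices $t$ with $[t]_S\in K(S)$ (if $K(S)$ is left zero, these are exactly the trivial loops at the vertices over $K(S)$). \emph{Pict.} For a rooted graph $\Gamma$ in which every vertex that can be reached from the root is the end of a unique simple path from the root, and a simple path $p$ from the root, $\mathsf{Pict}(\Gamma,p)$ is defined recursively. Start with the straight line $p$. For each edge $e=(v_0\to v_1)$ of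 $p$ and each other edge $e'=(v'\xrightarrow{b}v_1)$ of $\Gamma$ whose source can be reached from the root, let $\Gamma'$, with root $v_0$, arise from $\Gamma$ by deleting all edges at vertices of $p$ up to and including $v_0$ and all edges into $v_1$, except $e$ itself; let $p'$ be the simple path in $\Gamma'$ from $v_0$ via $e$ to $v'$; attach $\mathsf{Pict}(\Gamma',p')$ without its first edge $e$ at $v_1$, disjointly otherwise, and add an edge labelled $b$ from the end of its line back to $v_1$. For a vertex $t$ of $\mathsf T$ let $\mathsf{Pict}_{S,A}(t)=\mathsf{Pict}(\Gamma(S,A),p_t)$, where $p_t$ is the path in $\mathsf T$ from the root to $t$. \textbf{Theorem.} (1) Suppose that $K(S)$ is left zero. For all $t\in\mathsf T$ with $[t]_S\in K(S)$, $\mathsf{Pict}_{S,A}(t)$ is a loop graph and the series for its normal distribution converges; $\mathcal M(S,A)$ has a unique stationary distribution, and it is given by $$\Psi_w=\sum_{t\in\mathsf T,\ [t]_S=w}\Psi_{\mathsf{Pict}_{S,A}(t)}\qquad (w\in K(S)).$$ (2) Suppose that $K(S)$ is not left zero. Let $\square$ be a new zero element and let $\mathsf T$ be the spanning tree of $\mathsf{Mc}\circ\mathsf{KR}(S\cup\{\square\},A\cup\{\square\})$.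 For $w\in K(S)$ let $\mathsf T_w$ be the set of its vertices $t$ that are labelled by a word $u\square$ with $u$ a word over $A$ and $[u]_S=w$. For $t\in\mathsf T_w$, $\mathsf{Pict}_{S\cup\{\square\},A\cup\{\square\}}(t)$ is a loop graph, its normal distribution converges at all positive probability vectors on $A\cup\{\square\}$, and its limit as $x_\square\to0$ (that is, as positive probability vectors on $A\cup\{\square\}$ tend to $(x,0)$) exists. The vector $$\Psi_w=\sum_{t\in\mathsf T_w}\ \lim_{x_\square\to0}\Psi_{\mathsf{Pict}_{S\cup\{\square\},A\cup\{\square\}}(t)}\qquad(w\in K(S))$$ is a stationary distribution of $\mathcal M(S,A)$. For every minimal left ideal $L$ of $S$ the number $\Psi(L)=\sum_{v\in L}\Psi_v$ is positive and $(\Psi_w/\Psi(L))_{w\in L}$ is the unique stationary distribution of the random walk on $L$; in particular $\Psi$ is the unique stationary distribution of $\mathcal M(S,A)$ if $K(S)$ is a minimal left ideal. (3) Let $\mathcal T$ be the transition matrix of any Markov chain on a finite nonempty set $\Omega$. Then $\mathcal T$ has a random letter representation: there are $S,A,(x_a)$ as above and a left action of $S$ on $\Omega$ with $\mathcal T_{s',s}=\sum_{a\in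 A,\ a.s=s'}x_a$. For every such representation and every $\omega\in\Omega$, with $\Psi_w$ as in (1) or (2), $$\Psi^{\mathcal T}_s=\sum_{w\in K(S),\ w.\omega=s}\Psi_w\qquad(s\in\Omega)$$ is a stationary distribution of $\mathcal T$. If $\mathcal T$ is irreducible, every stationary distribution of $\mathcal T$ equals it. -/

import Mathlib

open Filter Topology
open scoped Classical

universe u v w

noncomputable section

/-! ### Edge-labelled directed graphs, paths, loop graphs and their normal distributions -/

/-- An edge-labelled directed graph, given by its set of edges `(v, a, v')`, read `v --a--> v'`. -/
abbrev LGraph (V α : Type*) := Set (V × α × V)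

/-- The endpoint `τ(p)` of a path. A path with start `u` is written as the list of its steps
`(a₁, v₁), (a₂, v₂), …`, standing for `u --a₁--> v₁ --a₂--> v₂ ⋯`. -/
def pathEnd {V α : Type*} : V → List (α × V) → V
  | u, [] => u
  | _, (_, v) :: p => pathEnd v p

/-- The vertices visited by a path, start included. -/
def pathVerts {V α : Type*} (u : V) (p : List (α × V)) : List V :=
  u :: p.map Prod.snd

/-- The set of edges of a path. -/
def pathEdges {V α : Type*} : V → List (α × V) → LGraph V α
  | _, [] => ∅
  | u, (a, v) :: p => insert (u, a, v) (pathEdges v p)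

/-- `p` is a path in `Γ` starting at `u`. -/
def IsPath {V α : Type*} (Γ : LGraph V α) (u : V) (p : List (α × V)) : Prop :=
  pathEdges u p ⊆ Γ

/-- A simple path visits no vertex twice; empty paths are simple. -/
def IsSimplePath {V α : Type*} (Γ : LGraph V α) (u : V) (p : List (α × V)) : Prop :=
  IsPath Γ u p ∧ (pathVerts u p).Nodup

/-- A labelled graph with a start vertex `𝟙` and a final vertex. -/
structure PointedGraph (W α : Type*) where
  edges : LGraph W α
  start : W
  final : W

/-- `LoopGraphOn V G`: the graph `G`, with vertex set `V`, arises from a straight line leading from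
`G.start` to `G.final` by repeatedly attaching a directed loop that passes through one existing
vertex `v ≠ G.start` and otherwise through new vertices only. -/
inductive LoopGraphOn {W α : Type*} : Set W → PointedGraph W α → Prop
  | line (u : W) (p : List (α × W)) (hne : p ≠ []) (hp : (pathVerts u p).Nodup) :
      LoopGraphOn {w | w ∈ pathVerts u p} ⟨pathEdges u p, u, pathEnd u p⟩
  | addLoop (V : Set W) (G : PointedGraph W α) (hG : LoopGraphOn V G)
      (v : W) (hv : v ∈ V) (hstart : v ≠ G.start)
      (c : List (α × W)) (hc : (c.map Prod.snd).Nodup) (hnew : ∀ w ∈ c.map Prod.snd, w ∉ V)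
      (a : α) :
      LoopGraphOn (V ∪ {w | w ∈ c.map Prod.snd})
        ⟨G.edges ∪ pathEdges v (c ++ [(a, v)]), G.start, G.final⟩

/-- Loop graphs. -/
def IsLoopGraph {W α : Type*} (G : PointedGraph W α) : Prop :=
  ∃ V : Set W, LoopGraphOn V G

/-- The set `𝒫_G` of all paths in `G` from the start vertex to the final vertex. -/
def fullPaths {W α : Type*} (G : PointedGraph W α) : Set (List (α × W)) :=
  {p | IsPath G.edges G.start p ∧ pathEnd G.start p = G.final}

/-- The weight `∏_{a ∈ p} x_a` of a path. -/
def pathWeight {W α : Type*} (x : α → ℝ) (p : List (α × W)) : ℝ :=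
  (p.map fun e => x e.1).prod

/-- The normal distribution `Ψ_G = ∑_{p ∈ 𝒫_G} ∏_{a ∈ p} x_a`. -/
def normalDist {W α : Type*} (G : PointedGraph W α) (x : α → ℝ) : ℝ :=
  ∑' p : fullPaths G, pathWeight x p.1

/-- The series defining `Ψ_G` converges at `x`. -/
def NormalSummable {W α : Type*} (G : PointedGraph W α) (x : α → ℝ) : Prop :=
  Summable fun p : fullPaths G => pathWeight x p.1

/-! ### The map `Pict` -/

/-- Vertices of the graph `Pict(Γ, p)`. The vertex `([], k)` is the `k`-th vertex of the straight
line `p`. A vertex `((k, v', b) :: l, m)` lies in the copy of the graph `P' = Pict(Γ', p')` that is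
attached at the `k`-th vertex of the line on account of an edge with source `v'` and label `b`
entering that vertex; inside `P'` it is the vertex `(l, m)`. -/
abbrev PictVertex (V α : Type*) := List (ℕ × V × α) × ℕ

/-- How `P'` is attached at the `k`-th vertex of the line: the vertex number one of the line
underlying `P'` is identified with it, all other vertices are new. -/
def attachVertex {V α : Type*} (k : ℕ) (f : V × α) : PictVertex V α → PictVertex V α
  | ([], 1) => ([], k)
  | (l, m) => ((k, f) :: l, m)

/-- The graph `Γ'` belonging to the edge `e = (v₀ --a--> v₁)`, where `q` is the path from `u`
to `v₀`: remove from `Γ` all edges at the vertices of `q` and all edges going into `v₁`,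
except `e` itself. Its root is `v₀`, the endpoint of `q`. -/
def cutGraph {V α : Type*} (Γ : LGraph V α) (u : V) (q : List (α × V)) (a : α) (v₁ : V) :
    LGraph V α :=
  {f | f ∈ Γ ∧ (f = (pathEnd u q, a, v₁) ∨
    (f.1 ∉ pathVerts u q ∧ f.2.2 ∉ pathVerts u q ∧ f.2.2 ≠ v₁))}

/-- The edges of `Pict(Γ, p)`, where `p` is a simple path starting at `u`. For every edge
`e = (v₀ --a--> v₁)` of `p` (where `p = q e r`) and every other edge `e' = (v' --b--> v₁)` of `Γ`
let `p'` be the simple path that starts in `v₀` with `e` and ends in `v'`, and attach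
`P' = Pict(Γ', p')` without its first edge `e` at `v₁`, together with the edge `e'` leading from
the end of the line of `P'` back to `v₁`. -/
inductive PictEdge {V α : Type*} : LGraph V α → V → List (α × V) →
    PictVertex V α → α → PictVertex V α → Prop
  | line (Γ : LGraph V α) (u : V) (q : List (α × V)) (a : α) (v₁ : V) (r : List (α × V)) :
      PictEdge Γ u (q ++ (a, v₁) :: r) ([], q.length) a ([], q.length + 1)
  | attach (Γ : LGraph V α) (u : V) (q : List (α × V)) (a : α) (v₁ : V) (r : List (α × V))
      (v' : V) (b : α) (he' : (v', b, v₁) ∈ Γ) (hne : (v', b) ≠ (pathEnd u q, a))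
      (c : List (α × V))
      (hsimple : IsSimplePath (cutGraph Γ u q a v₁) (pathEnd u q) ((a, v₁) :: c))
      (hend : pathEnd (pathEnd u q) ((a, v₁) :: c) = v')
      (y : PictVertex V α) (d : α) (z : PictVertex V α)
      (h : PictEdge (cutGraph Γ u q a v₁) (pathEnd u q) ((a, v₁) :: c) y d z)
      (hy : y ≠ ([], 0)) :
      PictEdge Γ u (q ++ (a, v₁) :: r)
        (attachVertex (q.length + 1) (v', b) y) d (attachVertex (q.length + 1) (v', b) z)
  | close (Γ : LGraph V α) (u : V) (q : List (α × V)) (a : α) (v₁ : V) (r : List (α × V))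
      (v' : V) (b : α) (he' : (v', b, v₁) ∈ Γ) (hne : (v', b) ≠ (pathEnd u q, a))
      (c : List (α × V))
      (hsimple : IsSimplePath (cutGraph Γ u q a v₁) (pathEnd u q) ((a, v₁) :: c))
      (hend : pathEnd (pathEnd u q) ((a, v₁) :: c) = v') :
      PictEdge Γ u (q ++ (a, v₁) :: r)
        (attachVertex (q.length + 1) (v', b) ([], c.length + 1)) b ([], q.length + 1)

/-- The graph `Pict(Γ, p)`, for a simple path `p` in `Γ` starting at the root `u`. -/
def pict {V α : Type*} (Γ : LGraph V α) (u : V) (p : List (α × V)) :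
    PointedGraph (PictVertex V α) α where
  edges := {e | PictEdge Γ u p e.1 e.2.1 e.2.2}
  start := ([], 0)
  final := ([], p.length)

/-! ### The McCammond expansion -/

/-- The edges of the McCammond expansion of a graph `Γ` with root `r`. Its vertices are the simple
paths in `Γ` starting at `r`; the letter `a` leads from `p` to `pa` if this is a simple path, and
otherwise to the initial segment of `p` ending at `τ(pa)`. -/
def mcEdges {V α : Type*} (Γ : LGraph V α) (r : V) : LGraph (List (α × V)) α :=
  {e | IsSimplePath Γ r e.1 ∧ ∃ v : V, (pathEnd r e.1, e.2.1, v) ∈ Γ ∧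
    ((v ∉ pathVerts r e.1 ∧ e.2.2 = e.1 ++ [(e.2.1, v)]) ∨
      (v ∈ pathVerts r e.1 ∧ e.2.2 <+: e.1 ∧ pathEnd r e.2.2 = v))}

/-- The path in the spanning tree `T` of the McCammond expansion from the root, which is the empty
path `[]`, to the vertex `t`: it runs through the nonempty initial segments of `t`. -/
def treePath {V α : Type*} (t : List (α × V)) : List (α × List (α × V)) :=
  (t.map Prod.fst).zip t.inits.tail

/-! ### Semigroups, right Cayley graphs and the Karnofsky–Rhodes expansion -/

section Semigroups

variable {S : Type*} [Semigroup S] {α : Type*}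

/-- Two-sided ideals of a semigroup. -/
def IsSemigroupIdeal (I : Set S) : Prop :=
  ∀ x ∈ I, ∀ s : S, s * x ∈ I ∧ x * s ∈ I

/-- The minimal ideal `K(S)`: the intersection of all nonempty ideals. -/
def minimalIdeal (S : Type*) [Semigroup S] : Set S :=
  ⋂₀ {I | IsSemigroupIdeal I ∧ I.Nonempty}

/-- `X` is left zero: `xy = x` for all `x, y ∈ X`. -/
def IsLeftZero (X : Set S) : Prop :=
  ∀ x ∈ X, ∀ y ∈ X, x * y = x

/-- Nonempty left ideals. -/
def IsLeftIdeal (L : Set S) : Prop :=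
  L.Nonempty ∧ ∀ x ∈ L, ∀ s : S, s * x ∈ L

/-- Minimal left ideals. -/
def IsMinimalLeftIdeal (L : Set S) : Prop :=
  IsLeftIdeal L ∧ ∀ L' : Set S, IsLeftIdeal L' → L' ⊆ L → L' = L

/-- The value `[a₁ ⋯ a_ℓ]_S` of a word, in `S` with an adjoined identity. -/
def wordVal (g : α → S) (u : List α) : WithOne S :=
  (u.map fun a => (g a : WithOne S)).prod

/-- The right Cayley graph `RCay(S, A)`; its vertex set is `S` with an adjoined identity, which is
the root. The generators are given as a family `g : α → S`. -/
def rCay (g : α → S) : LGraph (WithOne S) α :=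
  {e | e.2.2 = e.1 * (g e.2.1 : WithOne S)}

/-- Transition edges: edges `s → s'` such that no path leads from `s'` back to `s`. -/
def IsTransitionEdge {V : Type*} (Γ : LGraph V α) (e : V × α × V) : Prop :=
  e ∈ Γ ∧ ¬ ∃ p : List (α × V), p ≠ [] ∧ IsPath Γ e.2.2 p ∧ pathEnd e.2.2 p = e.1

/-- The path in `RCay(S, A)` that starts at `s` and reads the given word. -/
def cayPath (g : α → S) : WithOne S → List α → List (α × WithOne S)
  | _, [] => []
  | s, a :: u => (a, s * (g a : WithOne S)) :: cayPath g (s * (g a : WithOne S)) u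

/-- The set of transition edges of the path in `RCay(S, A)` that starts at `𝟙` and reads `u`. -/
def transitionEdges (g : α → S) (u : List α) : Set (WithOne S × α × WithOne S) :=
  {e | e ∈ pathEdges 1 (cayPath g 1 u) ∧ IsTransitionEdge (rCay g) e}

/-- Two words (that is, paths from `𝟙` in `RCay(A⁺, A)`) are identified in the Karnofsky–Rhodes
expansion iff their paths in `RCay(S, A)` have the same endpoint and the same transition edges. -/
def krSetoid (g : α → S) : Setoid (List α) where
  r u u' := wordVal g u = wordVal g u' ∧ transitionEdges g u = transitionEdges g u'
  iseqv := ⟨fun _ => ⟨rfl, rfl⟩, fun h => ⟨h.1.symm, h.2.symm⟩,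
    fun h h' => ⟨h.1.trans h'.1, h.2.trans h'.2⟩⟩

/-- The vertices of the Karnofsky–Rhodes expansion. -/
abbrev KR (g : α → S) := Quotient (krSetoid g)

/-- The root of the Karnofsky–Rhodes expansion. -/
def krRoot (g : α → S) : KR g := Quotient.mk (krSetoid g) []

/-- The edges of the Karnofsky–Rhodes expansion `KR(S, A)`. -/
def krEdges (g : α → S) : LGraph (KR g) α :=
  {e | ∃ (u : List α) (a : α),
    e = (Quotient.mk (krSetoid g) u, a, Quotient.mk (krSetoid g) (u ++ [a]))}

/-- The value `[v]_S` of a vertex of `KR(S, A)`. -/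
def krVal (g : α → S) (v : KR g) : WithOne S :=
  Quotient.lift (s := krSetoid g) (wordVal g) (fun _ _ h => And.left h) v

/-- The vertices of `Mc ∘ KR(S, A)`, which are also the vertices of its spanning tree `T`. -/
def mcVerts (g : α → S) : Set (List (α × KR g)) :=
  {t | IsSimplePath (krEdges g) (krRoot g) t}

/-- The value `[t]_S` of a vertex of `Mc ∘ KR(S, A)`. -/
def mcVal (g : α → S) (t : List (α × KR g)) : WithOne S :=
  krVal g (pathEnd (krRoot g) t)

/-- The graph `Mc ∘ KR(S, A)` without the edges leaving the vertices `t` with `[t]_S ∈ K(S)`.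
If `K(S)` is left zero, then these edges are exactly the trivial loops, one for each letter, at
the vertices over `K(S)`; the paths from the root to a vertex over `K(S)` in the graph that is
left are the words in the semaphore code. -/
def mcKR (g : α → S) : LGraph (List (α × KR g)) α :=
  {e | e ∈ mcEdges (krEdges g) (krRoot g) ∧
    ¬ ∃ k ∈ minimalIdeal S, mcVal g e.1 = (k : WithOne S)}

/-- The loop graph `Pict(Mc ∘ KR(S, A), t)`. -/
def pictKR (g : α → S) (t : List (α × KR g)) :
    PointedGraph (PictVertex (List (α × KR g)) α) α :=
  pict (mcKR g) [] (treePath t)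

/-- The vertices `t` of `T` with `[t]_S = w`. -/
def treeOver (g : α → S) (w : S) : Set (List (α × KR g)) :=
  {t | t ∈ mcVerts g ∧ mcVal g t = (w : WithOne S)}

/-- `∑_{t ∈ T, [t]_S = w} Ψ_{Pict(Mc ∘ KR(S, A), t)}`, evaluated at `x`. -/
def normalSum (g : α → S) (x : α → ℝ) (w : S) : ℝ :=
  ∑ᶠ t ∈ treeOver g w, normalDist (pictKR g t) x

/-- The generators `A ∪ {□}` of `S ∪ {□}`, where `□` is a new zero. -/
def boxGen (g : α → S) : Option α → WithZero S
  | none => 0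
  | some a => (g a : WithZero S)

/-- The vertices `t` of the spanning tree of `Mc ∘ KR(S ∪ {□}, A ∪ {□})` with "`[t]_S = w □`":
the word labelling `t` is `u □` for a word `u` over `A` with `[u]_S = w`. -/
def boxTreeOver (g : α → S) (w : S) : Set (List (Option α × KR (boxGen g))) :=
  {t | t ∈ mcVerts (boxGen g) ∧
    ∃ u : List α, t.map Prod.fst = u.map some ++ [none] ∧ wordVal g u = (w : WithOne S)}

/-- The probability vectors with positive entries. -/
def openSimplex (β : Type*) [Fintype β] : Set (β → ℝ) :=
  {y | (∀ b, 0 < y b) ∧ ∑ b, y b = 1}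

/-- The limit `x_□ → 0`: the positive probability vectors on `A ∪ {□}` tend to the vector with
entry `0` at `□` and entries `x` on `A`. -/
def boxLimit [Fintype α] (x : α → ℝ) : Filter (Option α → ℝ) :=
  𝓝[openSimplex (Option α)] (fun o => o.elim 0 x)

/-- `lim_{x_□ → 0} Ψ_{Pict(Mc ∘ KR(S ∪ {□}, A ∪ {□}), t)}`. -/
def limitDist [Fintype α] (g : α → S) (x : α → ℝ) (t : List (Option α × KR (boxGen g))) : ℝ :=
  limUnder (boxLimit x) fun y => normalDist (pictKR (boxGen g) t) y

/-- The sum of these limits over all vertices `t` of the spanning tree with `[t]_S = w □`. -/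
def limitSum [Fintype α] (g : α → S) (x : α → ℝ) (w : S) : ℝ :=
  ∑ᶠ t ∈ boxTreeOver g w, limitDist g x t

/-- The transition matrix of the random walk by left multiplication on `X ⊆ S`: the chain moves
from `s` to `g a * s` with probability `x a`. Columns are indexed by the old state. -/
def walkMatrix [Fintype α] (g : α → S) (x : α → ℝ) (X : Set S) : Matrix X X ℝ :=
  fun s' s => ∑ a, if g a * (s : S) = s' then x a else 0

end Semigroups

/-! ### Markov chains -/

/-- `Ψ` is a stationary distribution of the (column-stochastic) transition matrix `T`. -/
def IsStationaryDist {Ω : Type*} [Fintype Ω] (T : Matrix Ω Ω ℝ) (Ψ : Ω → ℝ) : Prop :=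
  (∀ s, 0 ≤ Ψ s) ∧ ∑ s, Ψ s = 1 ∧ T.mulVec Ψ = Ψ

/-- Irreducibility: every state can be reached from every state. -/
def IsIrreducibleChain {Ω : Type*} [Fintype Ω] (T : Matrix Ω Ω ℝ) : Prop :=
  ∀ s s' : Ω, ∃ m : ℕ, 0 < (T ^ m) s' s

/-- A random letter representation of a Markov chain: a semigroup `S` with generators `gen` acting
from the left on the state space, and positive probabilities `x a` of the generators, such
that the chain moves from `s` to `a . s` with probability `x a`. -/
structure RandomLetterRep {Ω : Type*} (T : Matrix Ω Ω ℝ) (S : Type*) [Semigroup S]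
    (α : Type*) [Fintype α] where
  gen : α → S
  generates : Subsemigroup.closure (Set.range gen) = ⊤
  x : α → ℝ
  x_mem : x ∈ openSimplex α
  act : S → Ω → Ω
  act_mul : ∀ (s t : S) (ω : Ω), act (s * t) ω = act s (act t ω)
  transition : ∀ s' s : Ω, T s' s = ∑ a, if act (gen a) s = s' then x a else 0

/-- The sum of `f w` over all `w ∈ K(S)` that move the state `ω` to the state `s`. -/
def sumOverFibre {S Ω : Type*} [Semigroup S] [Fintype S] (act : S → Ω → Ω) (f : S → ℝ) (ω s : Ω) :
    ℝ :=
  ∑ w : minimalIdeal S, if act w ω = s then f w else 0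

end

/-! ### Paths -/

section Paths

variable {V α : Type*} {Γ : LGraph V α} {u v w : V} {p q : List (α × V)} {a : α}

/-! Everything reduces to weights of words, by way of three observations.

`Pict(Γ, p)` unfolds `Γ` against the arrows. It projects to `Γ`, and at every vertex except the
start vertex the projection is bijective on the incoming edges (those of `Γ` whose source is
reachable from the root). If no edge enters the root, each path of `Γ` from the root to the end of
`p` therefore lifts, from its last edge backwards, to exactly one path from the start vertex to the
final vertex. So the normal distribution of `Pict(Γ, p)` is the total weight of all these paths
(`normalDist_pict`). The projection is built in `exists_pictCover` by induction on the number of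
edges: at a vertex of the line every reachable incoming edge other than the line's own closes one
attached loop, and at the remaining vertices of a copy the cut graph has lost no relevant incoming
edge.

In `Γ(S, A)` the paths from the root to a vertex `t` over `K(S)` are words that lead to `t` and
enter `K(S)` with their last letter, that is, words of the semaphore code (`normalDist_pictKR`).
Summing over `t` yields the weight of all code words with a given value.

Draw letters from `A ∪ {□}` until `□` appears. The word before `□` has value `s` with probability
`x_□ ∑ weight(u)`, summed over `[u] = s`, and `wordMass` is the limit of this probability as `x_□ →
0`. Such limits exist for the states of every finite automaton (`exists_tendsto_wordSum_autoLang`):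
removing the last letter gives a linear system, solved by Cramer's rule after the transient and the
recurrent part have been separated. Removing the first letter instead shows that `wordMass` is
stationary for left multiplication (`wordMass_coe_eq`). It vanishes outside `K(S)` and has total
mass one.

Both formulas of the theorem equal `wordMass`. If `K(S)` is left zero, a word with value `w ∈ K(S)`
is a code word followed by an arbitrary tail; the tails have total weight `1 / x_□`, which cancels
(`normalSum_eq_wordMass`). In general, the code words over `S ∪ {□}` are the words `u □`, and
sorting them by the endpoint of `u` in the expansion splits the probability above into finitely many
convergent pieces (`limitSum_eq_wordMass`). On a minimal left ideal the walk is irreducible, which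
gives uniqueness; arbitrary chains are images of the walk on `K(S)` under `w ↦ w . ω`. -/

theorem pathEnd_append (u : V) (p q : List (α × V)) :
    pathEnd u (p ++ q) = pathEnd (pathEnd u p) q := by
  induction p generalizing u with
  | nil => rfl
  | cons e p ih => exact ih e.2

theorem pathVerts_append (u : V) (p q : List (α × V)) :
    pathVerts u (p ++ q) = pathVerts u p ++ q.map Prod.snd := by
  simp [pathVerts]

theorem pathEdges_append (u : V) (p q : List (α × V)) :
    pathEdges u (p ++ q) = pathEdges u p ∪ pathEdges (pathEnd u p) q := by
  induction p generalizing u with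
  | nil => simp [pathEdges, pathEnd]
  | cons e p ih => simp [pathEdges, pathEnd, ih, Set.insert_union]

theorem isPath_nil : IsPath Γ u [] := Set.empty_subset _

theorem isPath_cons : IsPath Γ u ((a, v) :: p) ↔ (u, a, v) ∈ Γ ∧ IsPath Γ v p :=
  Set.insert_subset_iff

theorem isPath_append :
    IsPath Γ u (p ++ q) ↔ IsPath Γ u p ∧ IsPath Γ (pathEnd u p) q := by
  simp [IsPath, pathEdges_append]

theorem isPath_concat :
    IsPath Γ u (p ++ [(a, v)]) ↔ IsPath Γ u p ∧ (pathEnd u p, a, v) ∈ Γ := by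
  rw [isPath_append, isPath_cons]
  simp [isPath_nil]

theorem IsPath.mono {Γ' : LGraph V α} (h : IsPath Γ u p) (hΓ : Γ ⊆ Γ') : IsPath Γ' u p :=
  h.trans hΓ

theorem pathEnd_concat : pathEnd u (p ++ [(a, v)]) = v := by
  rw [pathEnd_append]; rfl

theorem mem_pathVerts_iff :
    w ∈ pathVerts u p ↔ ∃ p₁ p₂, p = p₁ ++ p₂ ∧ pathEnd u p₁ = w := by
  constructor
  · intro h
    induction p generalizing u with
    | nil => exact ⟨[], [], rfl, by simpa [pathVerts, pathEnd, eq_comm] using h⟩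
    | cons e p ih =>
      rcases List.mem_cons.1 h with rfl | h
      · exact ⟨[], e :: p, rfl, rfl⟩
      · obtain ⟨p₁, p₂, rfl, h₂⟩ := ih (u := e.2) h
        exact ⟨e :: p₁, p₂, rfl, h₂⟩
  · rintro ⟨p₁, p₂, rfl, rfl⟩
    rw [pathVerts_append, List.mem_append]
    left
    clear p₂
    induction p₁ generalizing u with
    | nil => simp [pathVerts, pathEnd]
    | cons e p ih => exact List.mem_cons_of_mem _ (ih (u := e.2))

theorem pathEnd_mem_pathVerts (u : V) (p : List (α × V)) : pathEnd u p ∈ pathVerts u p :=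
  mem_pathVerts_iff.2 ⟨p, [], by simp, rfl⟩

theorem start_mem_pathVerts (u : V) (p : List (α × V)) : u ∈ pathVerts u p := by
  simp [pathVerts]

theorem mem_pathEdges_iff :
    (v, a, w) ∈ pathEdges u p ↔ ∃ q r, p = q ++ (a, w) :: r ∧ pathEnd u q = v := by
  induction p generalizing u with
  | nil => simp [pathEdges]
  | cons e p ih =>
    obtain ⟨b, x⟩ := e
    simp only [pathEdges, Set.mem_insert_iff, Prod.mk.injEq, ih]
    constructor
    · rintro (⟨rfl, rfl, rfl⟩ | ⟨q, r, rfl, h⟩)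
      · exact ⟨[], p, rfl, rfl⟩
      · exact ⟨(b, x) :: q, r, rfl, h⟩
    · rintro ⟨q, r, h, h'⟩
      cases q with
      | nil =>
        simp only [List.nil_append, List.cons.injEq, Prod.mk.injEq] at h
        obtain ⟨⟨rfl, rfl⟩, rfl⟩ := h
        exact .inl ⟨h'.symm, rfl, rfl⟩
      | cons e q =>
        simp only [List.cons_append, List.cons.injEq] at h
        obtain ⟨rfl, rfl⟩ := h
        exact .inr ⟨q, r, rfl, h'⟩

theorem IsSimplePath.left (h : IsSimplePath Γ u (p ++ q)) : IsSimplePath Γ u p :=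
  ⟨(isPath_append.1 h.1).1, by
    have := h.2
    rw [pathVerts_append] at this
    exact this.of_append_left⟩

theorem IsSimplePath.nil : IsSimplePath Γ u [] := ⟨isPath_nil, by simp [pathVerts]⟩

theorem isSimplePath_concat :
    IsSimplePath Γ u (p ++ [(a, v)]) ↔
      IsSimplePath Γ u p ∧ (pathEnd u p, a, v) ∈ Γ ∧ v ∉ pathVerts u p := by
  simp only [IsSimplePath, isPath_concat, pathVerts_append, List.nodup_append]
  simp only [List.map_cons, List.map_nil, List.nodup_cons, List.not_mem_nil, not_false_eq_true,
    List.nodup_nil, and_self, List.mem_cons, or_false, true_and]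
  constructor
  · rintro ⟨⟨h₁, h₂⟩, h₃, h₄⟩
    exact ⟨⟨h₁, h₃⟩, h₂, fun h => h₄ v h v rfl rfl⟩
  · rintro ⟨⟨h₁, h₃⟩, h₂, h₄⟩
    exact ⟨⟨h₁, h₂⟩, h₃, fun x hx y hy h => h₄ (hy ▸ h ▸ hx)⟩

/-- Loop erasure: whenever the next vertex has already been visited, cut back to that visit. -/
theorem IsPath.exists_simple (h : IsPath Γ u p) :
    ∃ s, IsSimplePath Γ u s ∧ pathEnd u s = pathEnd u p := by
  induction p using List.reverseRecOn with
  | nil => exact ⟨[], .nil, rfl⟩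
  | append_singleton p e ih =>
    obtain ⟨a, v⟩ := e
    rw [isPath_concat] at h
    obtain ⟨s, hs, hse⟩ := ih h.1
    by_cases hv : v ∈ pathVerts u s
    · obtain ⟨s₁, s₂, rfl, hs₁⟩ := mem_pathVerts_iff.1 hv
      exact ⟨s₁, hs.left, by rw [hs₁, pathEnd_concat]⟩
    · exact ⟨s ++ [(a, v)], isSimplePath_concat.2 ⟨hs, hse ▸ h.2, hv⟩, by simp [pathEnd_concat]⟩

/-- Along a simple path, initial segments are determined by their endpoints. -/
theorem eq_of_pathEnd_eq_of_nodup (hp : (pathVerts u p).Nodup) {p₁ p₂ q₁ q₂ : List (α × V)}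
    (h₁ : p = p₁ ++ p₂) (h₂ : p = q₁ ++ q₂) (h : pathEnd u p₁ = pathEnd u q₁) : p₁ = q₁ := by
  have key : ∀ {s₁ s₂ : List (α × V)}, p = s₁ ++ s₂ →
      (pathVerts u p)[s₁.length]? = some (pathEnd u s₁) := by
    rintro s₁ s₂ rfl
    clear hp h₁ h₂ h
    induction s₁ generalizing u with
    | nil => simp [pathVerts, pathEnd]
    | cons e s ih => exact ih (u := e.2)
  have hl : p₁.length = q₁.length := by
    have e₁ := key h₁
    have e₂ := key h₂
    rw [h] at e₁
    obtain ⟨l₁, e₁⟩ := List.getElem?_eq_some_iff.1 e₁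
    obtain ⟨l₂, e₂⟩ := List.getElem?_eq_some_iff.1 e₂
    exact (hp.getElem_inj_iff (hi := l₁) (hj := l₂)).1 (e₁.trans e₂.symm)
  exact List.append_inj_left (h₁.symm.trans h₂) hl

theorem pathEdges_map {V' : Type*} (f : V → V') (u : V) (p : List (α × V)) :
    pathEdges (f u) (p.map (Prod.map id f)) =
      (fun e : V × α × V => (f e.1, e.2.1, f e.2.2)) '' pathEdges u p := by
  induction p generalizing u with
  | nil => simp [pathEdges]
  | cons e p ih => simp [pathEdges, ih, Set.image_insert_eq]

theorem pathEnd_map {V' : Type*} (f : V → V') (u : V) (p : List (α × V)) :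
    pathEnd (f u) (p.map (Prod.map id f)) = f (pathEnd u p) := by
  induction p generalizing u with
  | nil => rfl
  | cons e p ih => exact ih e.2

theorem mem_pathVerts_of_mem_pathEdges {e : V × α × V} (h : e ∈ pathEdges u p) :
    e.1 ∈ pathVerts u p ∧ e.2.2 ∈ p.map Prod.snd := by
  obtain ⟨v, a, w⟩ := e
  obtain ⟨q, r, rfl, rfl⟩ := mem_pathEdges_iff.1 h
  exact ⟨mem_pathVerts_iff.2 ⟨q, _, rfl, rfl⟩, by simp⟩

end Paths

/-! ### Loop graphs -/

section LoopGraphs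

variable {W α : Type*} {VS : Set W} {G : PointedGraph W α}

theorem LoopGraphOn.start_mem (h : LoopGraphOn VS G) : G.start ∈ VS := by
  induction h with
  | line u p => exact start_mem_pathVerts u p
  | addLoop V G hG v hv hs c hc hnew a ih => exact .inl ih

theorem LoopGraphOn.final_mem (h : LoopGraphOn VS G) : G.final ∈ VS := by
  induction h with
  | line u p => exact pathEnd_mem_pathVerts u p
  | addLoop V G hG v hv hs c hc hnew a ih => exact .inl ih

theorem LoopGraphOn.edge_mem (h : LoopGraphOn VS G) :
    ∀ e ∈ G.edges, e.1 ∈ VS ∧ e.2.2 ∈ VS := by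
  induction h with
  | line u p =>
    intro e he
    have := mem_pathVerts_of_mem_pathEdges he
    exact ⟨this.1, List.mem_cons_of_mem _ this.2⟩
  | addLoop V G hG v hv hs c hc hnew a ih =>
    rintro e (he | he)
    · exact ⟨.inl (ih e he).1, .inl (ih e he).2⟩
    · rw [pathEdges_append, Set.mem_union] at he
      rcases he with he | he
      · have := mem_pathVerts_of_mem_pathEdges he
        refine ⟨?_, .inr this.2⟩
        rcases List.mem_cons.1 this.1 with h | h
        · exact .inl (h ▸ hv)
        · exact .inr h
      · simp only [pathEdges, insert_empty_eq, Set.mem_singleton_iff] at he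
        subst he
        refine ⟨?_, .inl hv⟩
        change pathEnd v c ∈ _
        rcases List.mem_cons.1 (pathEnd_mem_pathVerts v c) with h | h
        · rw [h]
          exact .inl hv
        · exact .inr h

theorem exists_pathEdges_into {u w : W} {p : List (α × W)} (h : w ∈ p.map Prod.snd) :
    ∃ v a, (v, a, w) ∈ pathEdges u p := by
  obtain ⟨⟨a, w⟩, he, rfl⟩ := List.mem_map.1 h
  obtain ⟨q, r, rfl⟩ := List.append_of_mem he
  exact ⟨_, a, mem_pathEdges_iff.2 ⟨q, r, rfl, rfl⟩⟩

theorem LoopGraphOn.exists_edge_into (h : LoopGraphOn VS G) :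
    ∀ w ∈ VS, w ≠ G.start → ∃ v a, (v, a, w) ∈ G.edges := by
  induction h with
  | line u p =>
    intro w hw hne
    exact exists_pathEdges_into ((List.mem_cons.1 hw).resolve_left hne)
  | addLoop V G hG v hv hs c hc hnew a ih =>
    rintro w (hw | hw) hne
    · obtain ⟨v', b, h⟩ := ih w hw hne
      exact ⟨v', b, .inl h⟩
    · obtain ⟨v', b, h⟩ := exists_pathEdges_into (u := v) hw
      exact ⟨v', b, .inr (by rw [pathEdges_append]; exact .inl h)⟩

theorem LoopGraphOn.exists_first (h : LoopGraphOn VS G) :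
    ∃ a, ∃ w ∈ VS, w ≠ G.start ∧ (G.start, a, w) ∈ G.edges := by
  induction h with
  | line u p hne hp =>
    cases p with
    | nil => exact absurd rfl hne
    | cons e p =>
      refine ⟨e.1, e.2, by simp [pathVerts], ?_, by simp [pathEdges]⟩
      rintro rfl
      simp [pathVerts] at hp
  | addLoop V G hG v hv hs c hc hnew a ih =>
    obtain ⟨b, w, hw, h⟩ := ih
    exact ⟨b, w, .inl hw, h.1, .inl h.2⟩

/-- A loop graph `G'` without its first edge, closed up by an edge from its final vertex, can be
attached to a loop graph `G` at a vertex `v` that is not the start vertex. -/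
theorem LoopGraphOn.attach {W' : Type*} (hG : LoopGraphOn VS G) {VS' : Set W'}
    {G' : PointedGraph W' α} (hG' : LoopGraphOn VS' G') (f : W' → W) (w₁ : W') {v : W}
    (hv : v ∈ VS) (hvs : v ≠ G.start) (hw₁ : f w₁ = v)
    (hfirst : ∀ a w, (G'.start, a, w) ∈ G'.edges → w = w₁)
    (hinj : Set.InjOn f (VS' \ {G'.start}))
    (hnew : ∀ w ∈ VS', w ≠ G'.start → w ≠ w₁ → f w ∉ VS) (b : α) :
    LoopGraphOn (VS ∪ f '' (VS' \ {G'.start}))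
      ⟨G.edges ∪ ({e | ∃ y d z, (y, d, z) ∈ G'.edges ∧ y ≠ G'.start ∧ e = (f y, d, f z)} ∪
        {(f G'.final, b, v)}), G.start, G.final⟩ := by
  -- A line `G'` becomes a single loop through `v`, closed by the edge labelled `b`; each further
  -- loop of `G'` is attached afterwards at its image under `f`.
  induction hG' with
  | line u p hne hp =>
    obtain _ | ⟨⟨a, w'⟩, c⟩ := p
    · exact absurd rfl hne
    obtain rfl : w' = w₁ := hfirst a w' (by simp [pathEdges])
    simp only [pathVerts, List.map_cons, List.nodup_cons, List.mem_cons, not_or] at hp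
    dsimp only at hfirst hinj hnew ⊢
    have hu : ∀ x ∈ c.map Prod.snd, x ≠ u := fun x hx h => hp.1.2 (h ▸ hx)
    have hw' : ∀ x ∈ c.map Prod.snd, x ≠ w' := fun x hx h => hp.2.1 (h ▸ hx)
    have hmem : ∀ x ∈ c.map Prod.snd, x ∈ {w | w ∈ pathVerts u ((a, w') :: c)} :=
      fun x hx => by simp only [pathVerts, List.map_cons, Set.mem_ofPred_eq, List.mem_cons]; tauto
    have hcm : (c.map (Prod.map id f)).map Prod.snd = (c.map Prod.snd).map f := by
      simp
    have := LoopGraphOn.addLoop VS G hG v hv hvs (c.map (Prod.map id f))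
      (by
        rw [hcm]
        refine List.Nodup.map_on (fun x hx y hy h => hinj ⟨hmem x hx, hu x hx⟩ ⟨hmem y hy, hu y hy⟩ h)
          hp.2.2)
      (by
        rw [hcm]
        intro w hw
        obtain ⟨x, hx, rfl⟩ := List.mem_map.1 hw
        exact hnew x (hmem x hx) (hu x hx) (hw' x hx)) b
    convert this using 1
    · rw [hcm]
      ext y
      simp only [Set.mem_union, Set.mem_image, Set.mem_sdiff, Set.mem_ofPred_eq,
        Set.mem_singleton_iff, List.mem_map (f := f)]
      constructor
      · rintro (h | ⟨x, ⟨hx, hxu⟩, rfl⟩)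
        · exact .inl h
        · simp only [pathVerts, List.map_cons, List.mem_cons] at hx
          rcases hx with h | h | h
          · exact absurd h hxu
          · left; rw [h, hw₁]; exact hv
          · exact .inr ⟨x, h, rfl⟩
      · rintro (h | ⟨x, hx, rfl⟩)
        · exact .inl h
        · exact .inr ⟨x, ⟨hmem x hx, hu x hx⟩, rfl⟩
    · congr 1
      congr 1
      rw [pathEdges_append, ← hw₁, pathEnd_map, pathEdges_map]
      congr 1
      · ext e
        simp only [Set.mem_ofPred_eq, Set.mem_image, pathEdges, Set.mem_insert_iff]
        constructor
        · rintro ⟨y, d, z, h | h, hy, rfl⟩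
          · exact absurd (congrArg Prod.fst h) hy
          · exact ⟨_, h, rfl⟩
        · rintro ⟨⟨y, d, z⟩, h, rfl⟩
          refine ⟨y, d, z, .inr h, ?_, rfl⟩
          have := (mem_pathVerts_of_mem_pathEdges h).1
          rcases List.mem_cons.1 this with h' | h'
          · rw [show y = w' from h']; exact fun h => hp.1.1 h.symm
          · exact hu y h'
      · simp [pathEdges, pathEnd]
  | addLoop V' G'' hG'' v'' hv'' hs'' c hc hc_new a ih =>
    dsimp only at hfirst hinj hnew ⊢
    have hfirst' : ∀ a w, (G''.start, a, w) ∈ G''.edges → w = w₁ :=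
      fun a w h => hfirst a w (.inl h)
    have hw₁V : w₁ ∈ V' := by
      obtain ⟨a', w, hw, -, h⟩ := hG''.exists_first
      exact hfirst' a' w h ▸ hw
    have hcs : ∀ x ∈ c.map Prod.snd, x ≠ G''.start :=
      fun x hx h => hc_new x hx (h ▸ hG''.start_mem)
    have hw₁s : w₁ ≠ G''.start := by
      obtain ⟨a', w, hw, h', h⟩ := hG''.exists_first
      exact hfirst' a' w h ▸ h'
    have IH := ih hfirst' (hinj.mono (Set.sdiff_subset_sdiff_left Set.subset_union_left))
      (fun w hw => hnew w (.inl hw))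
    have hcm : (c.map (Prod.map id f)).map Prod.snd = (c.map Prod.snd).map f := by
      simp
    have := LoopGraphOn.addLoop _ _ IH (f v'') (.inr ⟨v'', ⟨hv'', hs''⟩, rfl⟩)
      (by
        -- `f` sends `w₁` to `v`, which is not the start vertex, and sends the other relevant
        -- vertices outside `VS`, which contains the start vertex.
        by_cases h : v'' = w₁
        · rw [h, hw₁]; exact hvs
        · exact fun h' => hnew v'' (.inl hv'') hs'' h (h' ▸ hG.start_mem))
      (c.map (Prod.map id f))
      (by
        rw [hcm]
        exact List.Nodup.map_on
          (fun x hx y hy h => hinj ⟨.inr hx, hcs x hx⟩ ⟨.inr hy, hcs y hy⟩ h) hc)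
      (by
        rw [hcm]
        intro w hw
        obtain ⟨x, hx, rfl⟩ := List.mem_map.1 hw
        rintro (h | ⟨y, ⟨hy, hys⟩, h⟩)
        · exact hnew x (.inr hx) (hcs x hx) (fun h' => hc_new x hx (h' ▸ hw₁V)) h
        · have := hinj ⟨.inl hy, hys⟩ ⟨.inr hx, hcs x hx⟩ h
          exact hc_new x hx (this ▸ hy)) a
    convert this using 1
    · rw [hcm, Set.union_assoc]
      congr 1
      ext y
      simp only [Set.mem_union, Set.mem_image, Set.mem_sdiff, Set.mem_ofPred_eq,
        Set.mem_singleton_iff, List.mem_map (f := f)]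
      constructor
      · rintro ⟨x, ⟨hx | hx, hxu⟩, rfl⟩
        · exact .inl ⟨x, ⟨hx, hxu⟩, rfl⟩
        · exact .inr ⟨x, hx, rfl⟩
      · rintro (⟨x, ⟨hx, hxu⟩, rfl⟩ | ⟨x, hx, rfl⟩)
        · exact ⟨x, ⟨.inl hx, hxu⟩, rfl⟩
        · exact ⟨x, ⟨.inr hx, hcs x hx⟩, rfl⟩
    · congr 1
      have : c.map (Prod.map id f) ++ [(a, f v'')] = (c ++ [(a, v'')]).map (Prod.map id f) := by
        simp
      rw [this, pathEdges_map]
      have hsrc : ∀ e ∈ pathEdges v'' (c ++ [(a, v'')]), e.1 ≠ G''.start := by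
        intro e he h
        rw [pathEdges_append, Set.mem_union] at he
        have hvc : ∀ x ∈ pathVerts v'' c, x ≠ G''.start := by
          intro x hx
          rcases List.mem_cons.1 hx with rfl | hx
          · exact hs''
          · exact hcs x hx
        rcases he with he | he
        · exact hvc _ (mem_pathVerts_of_mem_pathEdges he).1 h
        · simp only [pathEdges, insert_empty_eq, Set.mem_singleton_iff] at he
          subst he
          exact hvc _ (pathEnd_mem_pathVerts v'' c) h
      ext e
      simp only [Set.mem_union, Set.mem_ofPred_eq, Set.mem_image, Set.mem_singleton_iff]
      constructor
      · rintro (h | ⟨y, d, z, h | h, hy, rfl⟩ | h)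
        · exact .inl (.inl h)
        · exact .inl (.inr (.inl ⟨y, d, z, h, hy, rfl⟩))
        · exact .inr ⟨_, h, rfl⟩
        · exact .inl (.inr (.inr h))
      · rintro ((h | ⟨y, d, z, h, hy, rfl⟩ | h) | ⟨⟨y, d, z⟩, h, rfl⟩)
        · exact .inl h
        · exact .inr (.inl ⟨y, d, z, .inl h, hy, rfl⟩)
        · exact .inr (.inr h)
        · exact .inr (.inl ⟨y, d, z, .inr h, hsrc _ h, rfl⟩)

end LoopGraphs

/-! ### The vertices and edges of `Pict` -/

section Pict

variable {V α : Type*}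

/-- The graph `Γ` has unique simple paths from `u`. -/
def UniqueSimplePaths (Γ : LGraph V α) (u : V) : Prop :=
  ∀ p q, IsSimplePath Γ u p → IsSimplePath Γ u q → pathEnd u p = pathEnd u q → p = q

/-- No edge of `Γ` goes into `u`. -/
def NoEdgeInto (Γ : LGraph V α) (u : V) : Prop :=
  ∀ w a, (w, a, u) ∉ Γ

/-- There is a path from `u` to `w`. -/
def Reaches (Γ : LGraph V α) (u w : V) : Prop :=
  ∃ s, IsPath Γ u s ∧ pathEnd u s = w

theorem attachVertex_injective (k : ℕ) (f : V × α) : Function.Injective (attachVertex k f) := by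
  rintro ⟨l, m⟩ ⟨l', m'⟩ h
  unfold attachVertex at h
  split at h <;> split at h <;> simp_all

theorem attachVertex_one (k : ℕ) (f : V × α) : attachVertex k f ([], 1) = ([], k) := rfl

theorem attachVertex_of_ne (k : ℕ) (f : V × α) {y : PictVertex V α} (hy : y ≠ ([], 1)) :
    attachVertex k f y = ((k, f) :: y.1, y.2) := by
  unfold attachVertex
  split
  · exact absurd rfl hy
  · rfl

theorem attachVertex_eq_nil {k : ℕ} {f : V × α} {y : PictVertex V α} {m : ℕ}
    (h : attachVertex k f y = ([], m)) : y = ([], 1) ∧ m = k := by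
  by_cases hy : y = ([], 1)
  · subst hy
    rw [attachVertex_one] at h
    simp_all
  · rw [attachVertex_of_ne k f hy] at h
    simp at h

theorem attachVertex_eq_cons {k j : ℕ} {f f' : V × α} {y : PictVertex V α}
    {l : List (ℕ × V × α)} {m : ℕ}
    (h : attachVertex k f y = ((j, f') :: l, m)) : k = j ∧ f = f' ∧ y = (l, m) := by
  by_cases hy : y = ([], 1)
  · subst hy
    rw [attachVertex_one] at h
    simp at h
  · rw [attachVertex_of_ne k f hy] at h
    simp only [Prod.mk.injEq, List.cons.injEq] at h
    exact ⟨h.1.1.1, h.1.1.2, Prod.ext h.1.2 h.2⟩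

/-- The data of a loop that is attached in the construction of `Pict(Γ, p)`: a decomposition
`p = q e r` with `e = (v₀ --a--> v₁)`, an edge `v' --b--> v₁`, and the path `p' = e c`. -/
structure PictLoop (V α : Type*) where
  q : List (α × V)
  a : α
  v₁ : V
  r : List (α × V)
  v' : V
  b : α
  c : List (α × V)

namespace PictLoop

variable (i : PictLoop V α) (Γ : LGraph V α) (u : V) (p : List (α × V))

/-- The root of the graph `Γ'`. -/
abbrev root : V := pathEnd u i.q

/-- The graph `Γ'`. -/
abbrev graph : LGraph V α := cutGraph Γ u i.q i.a i.v₁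

/-- The path `p'`. -/
abbrev path : List (α × V) := (i.a, i.v₁) :: i.c

/-- The name under which the vertices of `Pict(Γ', p')` are known in `Pict(Γ, p)`. -/
abbrev key : ℕ × V × α := (i.q.length + 1, i.v', i.b)

/-- The embedding of the vertices of `Pict(Γ', p')` into `Pict(Γ, p)`. -/
abbrev emb : PictVertex V α → PictVertex V α := attachVertex (i.q.length + 1) (i.v', i.b)

/-- The loop `i` occurs in the construction of `Pict(Γ, p)`. -/
structure Valid : Prop where
  split : p = i.q ++ (i.a, i.v₁) :: i.r
  edge : (i.v', i.b, i.v₁) ∈ Γ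
  ne : (i.v', i.b) ≠ (i.root u, i.a)
  simple : IsSimplePath (i.graph Γ u) (i.root u) i.path
  pathEnd_eq : pathEnd (i.root u) i.path = i.v'

end PictLoop

/-- One unfolding of the recursion, with the data of a loop bundled. Later arguments recurse on the
shrinking graphs and use `PictEdge` only in this form. -/
theorem pictEdge_iff {Γ : LGraph V α} {u : V} {p : List (α × V)} {y z : PictVertex V α} {d : α} :
    PictEdge Γ u p y d z ↔
      (∃ q v r, p = q ++ (d, v) :: r ∧ y = ([], q.length) ∧ z = ([], q.length + 1)) ∨
      ∃ i : PictLoop V α, i.Valid Γ u p ∧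
        ((∃ y' z', PictEdge (i.graph Γ u) (i.root u) i.path y' d z' ∧ y' ≠ ([], 0) ∧
          y = i.emb y' ∧ z = i.emb z') ∨
        (y = i.emb ([], i.c.length + 1) ∧ d = i.b ∧ z = ([], i.q.length + 1))) := by
  constructor
  · intro h
    cases h with
    | line _ _ q _ v r => exact .inl ⟨q, v, r, rfl, rfl, rfl⟩
    | attach _ _ q a v₁ r v' b he' hne c hs he y _ z h hy =>
      exact .inr ⟨⟨q, a, v₁, r, v', b, c⟩, ⟨rfl, he', hne, hs, he⟩, .inl ⟨y, z, h, hy, rfl, rfl⟩⟩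
    | close _ _ q a v₁ r v' _ he' hne c hs he =>
      exact .inr ⟨⟨q, a, v₁, r, v', _, c⟩, ⟨rfl, he', hne, hs, he⟩, .inr ⟨rfl, rfl, rfl⟩⟩
  · rintro (⟨q, v, r, rfl, rfl, rfl⟩ | ⟨⟨q, a, v₁, r, v', b, c⟩, ⟨rfl, he', hne, hs, he⟩, h⟩)
    · exact .line Γ u q d v r
    · rcases h with ⟨y, z, h, hy, rfl, rfl⟩ | ⟨rfl, rfl, rfl⟩
      · exact .attach Γ u q a v₁ r v' b he' hne c hs he y d z h hy
      · exact .close Γ u q a v₁ r v' _ he' hne c hs he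

theorem PictEdge.eq_one_of_start {Γ : LGraph V α} {u : V} {p : List (α × V)}
    {z : PictVertex V α} {d : α} (h : PictEdge Γ u p ([], 0) d z) : z = ([], 1) := by
  rcases pictEdge_iff.1 h with ⟨q, v, r, -, hy, rfl⟩ | ⟨i, hi, ⟨y', z', -, -, h, -⟩ | ⟨h, -, -⟩⟩
  · have := congrArg Prod.snd hy
    simp only at this
    rw [← this]
  · exact absurd (attachVertex_eq_nil h.symm).2 (by simp)
  · exact absurd (attachVertex_eq_nil h.symm).2 (by simp)

/-! ### Cutting graphs -/

variable {Γ : LGraph V α} {u : V} {q r c : List (α × V)} {a : α} {v₁ : V}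

theorem cutGraph_subset : cutGraph Γ u q a v₁ ⊆ Γ := fun _ h => h.1

/-- A simple path in the graph `Γ'` extends the initial segment `q`. -/
theorem IsSimplePath.append_of_cutGraph (hq : IsSimplePath Γ u q)
    (hc : IsSimplePath (cutGraph Γ u q a v₁) (pathEnd u q) c)
    (hv₁ : v₁ ∉ pathVerts u q) : IsSimplePath Γ u (q ++ c) := by
  refine ⟨isPath_append.2 ⟨hq.1, hc.1.mono cutGraph_subset⟩, ?_⟩
  rw [pathVerts_append, List.nodup_append]
  refine ⟨hq.2, (List.nodup_cons.1 hc.2).2, ?_⟩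
  rintro x hx y hy rfl
  obtain ⟨v, b, h⟩ := exists_pathEdges_into (u := pathEnd u q) hy
  rcases (hc.1 h).2 with h | h
  · simp only [Prod.mk.injEq] at h
    exact hv₁ (h.2.2 ▸ hx)
  · exact h.2.1 hx

/-- The part of a simple path after `q` that begins with the edge `e` lies in `Γ'`. -/
theorem IsSimplePath.cutGraph_of_append (h : IsSimplePath Γ u (q ++ (a, v₁) :: c)) :
    IsSimplePath (cutGraph Γ u q a v₁) (pathEnd u q) ((a, v₁) :: c) := by
  have hnd := h.2
  rw [pathVerts_append, List.nodup_append] at hnd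
  obtain ⟨-, hnd, hdis⟩ := hnd
  have hp := isPath_cons.1 (isPath_append.1 h.1).2
  refine ⟨isPath_cons.2 ⟨⟨hp.1, .inl rfl⟩, ?_⟩, ?_⟩
  · intro f hf
    refine ⟨hp.2 hf, .inr ?_⟩
    have hf' := mem_pathVerts_of_mem_pathEdges hf
    have h₁ : f.1 ∈ List.map Prod.snd ((a, v₁) :: c) := hf'.1
    have h₂ : f.2.2 ∈ List.map Prod.snd ((a, v₁) :: c) := List.mem_cons_of_mem _ hf'.2
    refine ⟨fun h => hdis _ h _ h₁ rfl, fun h => hdis _ h _ h₂ rfl, ?_⟩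
    intro h
    exact (List.nodup_cons.1 hnd).1 (h ▸ hf'.2)
  · exact List.nodup_cons.2
      ⟨fun h => hdis _ (pathEnd_mem_pathVerts u q) _ h rfl, hnd⟩

theorem IsSimplePath.not_mem_pathVerts (h : IsSimplePath Γ u (q ++ (a, v₁) :: c)) :
    v₁ ∉ pathVerts u q := by
  have hnd := h.2
  rw [pathVerts_append, List.nodup_append] at hnd
  exact fun h => hnd.2.2 _ h v₁ (by simp) rfl

/-- Prefixing `q` turns simple paths of the cut graph into simple paths of `Γ` from `u`, so
uniqueness is inherited and the recursion can continue. -/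
theorem UniqueSimplePaths.cutGraph (hu : UniqueSimplePaths Γ u)
    (h : IsSimplePath Γ u (q ++ (a, v₁) :: r)) :
    UniqueSimplePaths (cutGraph Γ u q a v₁) (pathEnd u q) := by
  intro s s' hs hs' he
  refine List.append_cancel_left (hu _ _ (h.left.append_of_cutGraph hs h.not_mem_pathVerts)
    (h.left.append_of_cutGraph hs' h.not_mem_pathVerts) ?_)
  rw [pathEnd_append, pathEnd_append, he]

theorem noEdgeInto_cutGraph (h : IsSimplePath Γ u (q ++ (a, v₁) :: r)) :
    NoEdgeInto (cutGraph Γ u q a v₁) (pathEnd u q) := by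
  rintro w b ⟨-, hw | hw⟩
  · simp only [Prod.mk.injEq] at hw
    exact h.not_mem_pathVerts (hw.2.2 ▸ pathEnd_mem_pathVerts u q)
  · exact hw.2.1 (pathEnd_mem_pathVerts u q)

/-- A simple path that passes through `v₁` passes through `e`. -/
theorem UniqueSimplePaths.exists_eq_append (hu : UniqueSimplePaths Γ u)
    (h : IsSimplePath Γ u (q ++ (a, v₁) :: r)) {s : List (α × V)} (hs : IsSimplePath Γ u s)
    (hv : v₁ ∈ pathVerts u s) : ∃ s', s = q ++ (a, v₁) :: s' := by
  obtain ⟨s₁, s₂, rfl, h₁⟩ := mem_pathVerts_iff.1 hv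
  have h' : IsSimplePath Γ u (q ++ [(a, v₁)]) := by
    rw [show q ++ (a, v₁) :: r = (q ++ [(a, v₁)]) ++ r by simp] at h
    exact h.left
  obtain rfl := hu _ _ hs.left h' (by rw [h₁, pathEnd_concat])
  exact ⟨s₂, by simp⟩

/-- The source of an edge `e' ≠ e` into `v₁` can be reached in `Γ'`. -/
theorem UniqueSimplePaths.exists_loop (hu : UniqueSimplePaths Γ u)
    (h : IsSimplePath Γ u (q ++ (a, v₁) :: r)) {w : V} {d : α} (he : (w, d, v₁) ∈ Γ)
    (hne : (w, d) ≠ (pathEnd u q, a)) (hw : Reaches Γ u w) :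
    ∃ c, IsSimplePath (_root_.cutGraph Γ u q a v₁) (pathEnd u q) ((a, v₁) :: c) ∧
      pathEnd (pathEnd u q) ((a, v₁) :: c) = w := by
  obtain ⟨s, hs, rfl⟩ := hw
  obtain ⟨s, hs, hse⟩ := hs.exists_simple
  rw [← hse] at he hne ⊢
  by_cases hv : v₁ ∈ pathVerts u s
  · obtain ⟨c, rfl⟩ := hu.exists_eq_append h hs hv
    exact ⟨c, hs.cutGraph_of_append, by rw [pathEnd_append]⟩
  -- If the simple path to `w` avoided `v₁`, prolonging it by `e'` would give a simple path to `v₁`.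
  -- By uniqueness this is `q e`, so `e' = e`.
  · exfalso
    have h' : IsSimplePath Γ u (q ++ [(a, v₁)]) := by
      rw [show q ++ (a, v₁) :: r = (q ++ [(a, v₁)]) ++ r by simp] at h
      exact h.left
    have := hu _ _ (isSimplePath_concat.2 ⟨hs, he, hv⟩) h' (by simp [pathEnd_concat])
    obtain ⟨rfl, hda⟩ := List.append_inj' this rfl
    simp only [List.cons.injEq, Prod.mk.injEq, and_true] at hda
    exact hne (by rw [hda])

/-- An edge of `Γ` into a vertex of `Γ'` that can be reached by a nontrivial path from `v₁` belongs
to `Γ'`, and its source can be reached in `Γ'`. -/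
theorem UniqueSimplePaths.mem_cutGraph (hu : UniqueSimplePaths Γ u)
    (h : IsSimplePath Γ u (q ++ (a, v₁) :: r)) {w w' : V} {d : α} (he : (w', d, w) ∈ Γ)
    (hw' : Reaches Γ u w') (hw : Reaches (_root_.cutGraph Γ u q a v₁) (pathEnd u q) w)
    (hwq : w ∉ pathVerts u q) (hwv : w ≠ v₁) :
    (w', d, w) ∈ _root_.cutGraph Γ u q a v₁ ∧
      Reaches (_root_.cutGraph Γ u q a v₁) (pathEnd u q) w' := by
  obtain ⟨t, ht, rfl⟩ := hw
  obtain ⟨t, ht, hte⟩ := ht.exists_simple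
  rw [← hte] at he hwq hwv ⊢
  have ht' := h.left.append_of_cutGraph ht h.not_mem_pathVerts
  obtain ⟨t', rfl⟩ : ∃ t', t = (a, v₁) :: t' := by
    obtain _ | ⟨⟨b, x⟩, t'⟩ := t
    · exact absurd (pathEnd_mem_pathVerts u q) hwq
    · rcases (isPath_cons.1 ht.1).1.2 with h | h
      · have h' := congrArg Prod.snd h
        simp only at h'
        exact ⟨t', by rw [h']⟩
      · exact absurd (pathEnd_mem_pathVerts u q) h.1
  obtain ⟨s, hs, rfl⟩ := hw'
  obtain ⟨s, hs, hse⟩ := hs.exists_simple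
  rw [← hse] at he ⊢
  set w := pathEnd (pathEnd u q) ((a, v₁) :: t') with hwdef
  have hwend : pathEnd u (q ++ (a, v₁) :: t') = w := by rw [pathEnd_append]
  -- The simple path `s` to `w'` passes through `v₁`: either it already visits `w`, and then
  -- contains the unique simple path to `w`, or `s` followed by the edge `d` is that path.
  have hsv : v₁ ∈ pathVerts u s := by
    by_cases hws : w ∈ pathVerts u s
    · obtain ⟨s₁, s₂, rfl, h₁⟩ := mem_pathVerts_iff.1 hws
      obtain rfl := hu _ _ hs.left ht' (h₁.trans hwend.symm)
      simp [pathVerts]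
    · have := hu _ _ (isSimplePath_concat.2 ⟨hs, he, hws⟩) ht' (by rw [pathEnd_concat, hwend])
      have hmem : v₁ ∈ pathVerts u (s ++ [(d, w)]) := by rw [this]; simp [pathVerts]
      rw [pathVerts_append, List.mem_append] at hmem
      rcases hmem with h | h
      · exact h
      · simp only [List.map_cons, List.map_nil, List.mem_singleton] at h
        exact absurd h.symm hwv
  obtain ⟨s', rfl⟩ := hu.exists_eq_append h hs hsv
  have hs' := hs.cutGraph_of_append
  have hreach : pathEnd u (q ++ (a, v₁) :: s') = pathEnd (pathEnd u q) ((a, v₁) :: s') :=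
    pathEnd_append _ _ _
  refine ⟨⟨he, .inr ⟨?_, hwq, hwv⟩⟩, _, hs'.1, hreach.symm⟩
  have hnd := hs.2
  rw [pathVerts_append, List.nodup_append] at hnd
  refine fun hmem => hnd.2.2 _ hmem _ ?_ rfl
  rw [hreach]
  exact pathEnd_mem_pathVerts v₁ s'

end Pict

/-! ### The loop graph structure of `Pict` -/

section PictCover

variable {V α : Type*} {Γ : LGraph V α} {u : V} {p : List (α × V)}

/-- The straight line `p`, whose vertices are numbered from `k` on. -/
def pictLine (k : ℕ) : List (α × V) → List (α × PictVertex V α)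
  | [] => []
  | (a, _) :: p => (a, ([], k + 1)) :: pictLine (k + 1) p

theorem pathEnd_pictLine (k : ℕ) (p : List (α × V)) :
    pathEnd (([], k) : PictVertex V α) (pictLine k p) = ([], k + p.length) := by
  induction p generalizing k with
  | nil => rfl
  | cons e p ih =>
    refine (ih (k + 1)).trans ?_
    rw [List.length_cons, Nat.add_right_comm, Nat.add_assoc]

theorem mem_pathVerts_pictLine (k : ℕ) (p : List (α × V)) (y : PictVertex V α) :
    y ∈ pathVerts ([], k) (pictLine k p) ↔ ∃ m, k ≤ m ∧ m ≤ k + p.length ∧ y = ([], m) := by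
  induction p generalizing k with
  | nil =>
    simp only [pictLine, pathVerts, List.map_nil, List.mem_singleton, List.length_nil, add_zero]
    constructor
    · rintro rfl
      exact ⟨k, le_rfl, le_rfl, rfl⟩
    · rintro ⟨m, h₁, h₂, rfl⟩
      rw [le_antisymm h₁ h₂]
  | cons e p ih =>
    rw [pathVerts, List.mem_cons]
    change y = ([], k) ∨ y ∈ pathVerts ([], k + 1) (pictLine (k + 1) p) ↔ _
    rw [ih, List.length_cons]
    constructor
    · rintro (rfl | ⟨m, h₁, h₂, rfl⟩)
      · exact ⟨k, le_rfl, by omega, rfl⟩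
      · exact ⟨m, by omega, by omega, rfl⟩
    · rintro ⟨m, h₁, h₂, rfl⟩
      rcases h₁.eq_or_lt with rfl | h
      · exact .inl rfl
      · exact .inr ⟨m, by omega, by omega, rfl⟩

theorem nodup_pathVerts_pictLine (k : ℕ) (p : List (α × V)) :
    (pathVerts (([], k) : PictVertex V α) (pictLine k p)).Nodup := by
  induction p generalizing k with
  | nil => simp [pictLine, pathVerts]
  | cons e p ih =>
    refine List.nodup_cons.2 ⟨?_, ih (k + 1)⟩
    change _ ∉ pathVerts (([], k + 1) : PictVertex V α) (pictLine (k + 1) p)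
    rw [mem_pathVerts_pictLine]
    rintro ⟨m, h, -, h'⟩
    simp only [Prod.mk.injEq, true_and] at h'
    omega

theorem mem_pathEdges_pictLine (k : ℕ) (p : List (α × V)) (y z : PictVertex V α) (d : α) :
    (y, d, z) ∈ pathEdges ([], k) (pictLine k p) ↔
      ∃ q v r, p = q ++ (d, v) :: r ∧ y = ([], k + q.length) ∧ z = ([], k + q.length + 1) := by
  induction p generalizing k with
  | nil => simp [pictLine, pathEdges]
  | cons e p ih =>
    obtain ⟨a, v⟩ := e
    simp only [pictLine, pathEdges, Set.mem_insert_iff, ih, Prod.mk.injEq]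
    constructor
    · rintro (⟨rfl, rfl, rfl⟩ | ⟨q, w, r, rfl, rfl, rfl⟩)
      · exact ⟨[], v, p, rfl, rfl, rfl⟩
      · exact ⟨(a, v) :: q, w, r, rfl, by simp; omega, by simp; omega⟩
    · rintro ⟨q, w, r, h, rfl, rfl⟩
      cases q with
      | nil =>
        simp only [List.nil_append, List.cons.injEq, Prod.mk.injEq] at h
        obtain ⟨⟨rfl, rfl⟩, rfl⟩ := h
        exact .inl ⟨rfl, rfl, rfl⟩
      | cons e q =>
        simp only [List.cons_append, List.cons.injEq] at h
        obtain ⟨rfl, rfl⟩ := h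
        exact .inr ⟨q, w, r, rfl, by simp; omega, by simp; omega⟩

/-- The vertices of the straight line in `Pict(Γ, p)`. -/
def lineVerts (V : Type*) {α : Type*} (n : ℕ) : Set (PictVertex V α) :=
  {y | ∃ m ≤ n, y = ([], m)}

/-- The edges of the straight line in `Pict(Γ, p)`. -/
def lineEdges (p : List (α × V)) : LGraph (PictVertex V α) α :=
  pathEdges ([], 0) (pictLine 0 p)

theorem loopGraphOn_line (hp : p ≠ []) :
    LoopGraphOn (lineVerts V p.length)
      ⟨lineEdges p, (([], 0) : PictVertex V α), ([], p.length)⟩ := by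
  have := LoopGraphOn.line (([], 0) : PictVertex V α) (pictLine 0 p)
    (by cases p with
      | nil => exact absurd rfl hp
      | cons e p => simp [pictLine]) (nodup_pathVerts_pictLine 0 p)
  rw [pathEnd_pictLine, Nat.zero_add] at this
  convert this using 1
  · ext y
    simp [lineVerts, mem_pathVerts_pictLine]
  · rfl

/-- `Pict(Γ, p)` is a loop graph with vertex set `VS`, and `π` projects it to `Γ`, bijectively on the
edges that go into a given vertex. -/
structure PictCover (Γ : LGraph V α) (u : V) (p : List (α × V)) (VS : Set (PictVertex V α))
    (π : PictVertex V α → V) : Prop where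
  loop : LoopGraphOn VS (pict Γ u p)
  line : ∀ q r, p = q ++ r → π ([], q.length) = pathEnd u q
  edge : ∀ y d z, PictEdge Γ u p y d z → (π y, d, π z) ∈ Γ
  reach : ∀ y ∈ VS, Reaches Γ u (π y)
  lift : ∀ y ∈ VS, y ≠ ([], 0) → ∀ w d, (w, d, π y) ∈ Γ → Reaches Γ u w →
    ∃ z, PictEdge Γ u p z d y ∧ π z = w
  lift_unique : ∀ y d z z', PictEdge Γ u p z d y → PictEdge Γ u p z' d y → π z = π z' → z = z'

namespace PictCover

variable {VS : Set (PictVertex V α)} {π : PictVertex V α → V}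

theorem exists_edge_into (h : PictCover Γ u p VS π) {y : PictVertex V α} (hy : y ∈ VS)
    (hne : y ≠ ([], 0)) : ∃ z d, PictEdge Γ u p z d y :=
  h.loop.exists_edge_into y hy hne

theorem source_mem (h : PictCover Γ u p VS π) {y z : PictVertex V α} {d : α}
    (he : PictEdge Γ u p y d z) : y ∈ VS := (h.loop.edge_mem (y, d, z) he).1

theorem proj_start (h : PictCover Γ u p VS π) : π ([], 0) = u := h.line [] p rfl

/-- Any other vertex over `u` would have an incoming edge, whose projection would enter `u`. -/
theorem eq_start (h : PictCover Γ u p VS π) (hu : NoEdgeInto Γ u) {y : PictVertex V α}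
    (hy : y ∈ VS) (hπ : π y = u) : y = ([], 0) := by
  by_contra hne
  obtain ⟨z, d, hz⟩ := h.exists_edge_into hy hne
  exact hu _ _ (hπ ▸ h.edge _ _ _ hz)

end PictCover

/-- The position on the line fixes `q`, `e` and `r`; with the closing edge given, `c` is forced by
uniqueness of simple paths in the cut graph. Hence copies attached for different loops have
different keys and stay disjoint. -/
theorem PictLoop.Valid.ext {i j : PictLoop V α} (hu : UniqueSimplePaths Γ u)
    (hp : IsSimplePath Γ u p) (hi : i.Valid Γ u p) (hj : j.Valid Γ u p) (h : i.key = j.key) :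
    i = j := by
  obtain ⟨q, a, v₁, r, v', b, c⟩ := i
  obtain ⟨q', a', v₁', r', v'', b', c'⟩ := j
  obtain ⟨h₁, h₂, h₃, h₄, h₅⟩ := hi
  obtain ⟨h₁', h₂', h₃', h₄', h₅'⟩ := hj
  dsimp only at *
  simp only [Prod.mk.injEq, add_left_inj] at h
  obtain ⟨hl, rfl, rfl⟩ := h
  obtain ⟨rfl, h⟩ := List.append_inj (h₁.symm.trans h₁') hl
  simp only [List.cons.injEq, Prod.mk.injEq] at h
  obtain ⟨⟨rfl, rfl⟩, rfl⟩ := h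
  have := (hu.cutGraph (h₁ ▸ hp)) _ _ h₄ h₄' (h₅.trans h₅'.symm)
  simp only [List.cons.injEq, true_and] at this
  rw [this]

theorem finite_setOf_valid (hΓ : Γ.Finite) (hu : UniqueSimplePaths Γ u)
    (hp : IsSimplePath Γ u p) : {i : PictLoop V α | i.Valid Γ u p}.Finite := by
  refine Set.Finite.of_finite_image (f := PictLoop.key) ?_
    (fun i hi j hj h => PictLoop.Valid.ext hu hp hi hj h)
  refine ((Set.finite_Iic p.length).prod (hΓ.image fun e => (e.1, e.2.1))).subset ?_
  rintro _ ⟨i, hi, rfl⟩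
  refine ⟨?_, (i.v', i.b, i.v₁), hi.edge, rfl⟩
  have := congrArg List.length hi.split
  simp only [List.length_append, List.length_cons] at this
  simp only [Set.mem_Iic]
  omega

/-- The edges that are contributed to `Pict(Γ, p)` by a loop. -/
def PictLoop.edges (i : PictLoop V α) (Γ : LGraph V α) (u : V) : LGraph (PictVertex V α) α :=
  {e | ∃ y d z, PictEdge (i.graph Γ u) (i.root u) i.path y d z ∧ y ≠ ([], 0) ∧
    e = (i.emb y, d, i.emb z)} ∪ {(i.emb ([], i.c.length + 1), i.b, ([], i.q.length + 1))}

/-- The vertices that are contributed to `Pict(Γ, p)` by a loop. -/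
def PictLoop.verts (i : PictLoop V α) (VS : Set (PictVertex V α)) : Set (PictVertex V α) :=
  i.emb '' (VS \ {([], 0)})

theorem pict_edges_eq :
    (pict Γ u p).edges = lineEdges p ∪ ⋃ i ∈ {i : PictLoop V α | i.Valid Γ u p}, i.edges Γ u := by
  ext ⟨y, d, z⟩
  change PictEdge Γ u p y d z ↔ _
  rw [pictEdge_iff]
  refine or_congr ?_ ?_
  · rw [lineEdges, mem_pathEdges_pictLine]
    simp
  · simp only [Set.mem_iUnion, PictLoop.edges, Set.mem_union, Set.mem_ofPred_eq, exists_prop,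
      Set.mem_singleton_iff, Prod.mk.injEq]
    refine exists_congr fun i => and_congr_right fun hi => or_congr_left ?_
    constructor
    · rintro ⟨y', z', h, hy, rfl, rfl⟩
      exact ⟨y', d, z', h, hy, rfl, rfl, rfl⟩
    · rintro ⟨y', _, z', h, hy, rfl, rfl, rfl⟩
      exact ⟨y', z', h, hy, rfl, rfl⟩

/-- There are finitely many loops, and their copies can be attached to the line one at a time: new
vertices of a copy begin with the key of its loop, so they do not occur earlier. -/
theorem loopGraphOn_pict (hΓ : Γ.Finite) (hu : UniqueSimplePaths Γ u) (hp : IsSimplePath Γ u p)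
    (hne : p ≠ []) (VS : PictLoop V α → Set (PictVertex V α))
    (hVS : ∀ i : PictLoop V α, i.Valid Γ u p →
      LoopGraphOn (VS i) (pict (i.graph Γ u) (i.root u) i.path)) :
    LoopGraphOn (lineVerts V p.length ∪
      ⋃ i ∈ {i : PictLoop V α | i.Valid Γ u p}, i.verts (VS i)) (pict Γ u p) := by
  have key : ∀ F : Set (PictLoop V α), F.Finite → F ⊆ {i | i.Valid Γ u p} →
      LoopGraphOn (lineVerts V p.length ∪ ⋃ i ∈ F, i.verts (VS i))
        ⟨lineEdges p ∪ ⋃ i ∈ F, i.edges Γ u, ([], 0), ([], p.length)⟩ := by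
    intro F hF
    induction F, hF using Set.Finite.induction_on with
    | empty => intro _; simpa using loopGraphOn_line hne
    | @insert i F hi hF ih =>
      intro hsub
      have hv : i.Valid Γ u p := hsub (Set.mem_insert _ _)
      have IH := ih ((Set.subset_insert _ _).trans hsub)
      have hlen : i.q.length + 1 ≤ p.length := by
        have := congrArg List.length hv.split
        simp only [List.length_append, List.length_cons] at this
        omega
      have := IH.attach (hVS i hv) i.emb ([], 1) (v := ([], i.q.length + 1))
        (.inl ⟨_, hlen, rfl⟩) (by simp) rfl
        (fun a w h => PictEdge.eq_one_of_start h)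
        ((attachVertex_injective _ _).injOn)
        (by
          intro w hw hw₀ hw₁
          rw [PictLoop.emb, attachVertex_of_ne _ _ hw₁]
          rintro (⟨m, -, h⟩ | h)
          · simp at h
          · simp only [Set.mem_iUnion] at h
            obtain ⟨j, hj, y, hy, h⟩ := h
            have hkey := attachVertex_eq_cons h
            have : j = i := PictLoop.Valid.ext hu hp (hsub (.inr hj)) hv
              (Prod.ext hkey.1 hkey.2.1)
            exact hi (this ▸ hj)) i.b
      convert this using 1
      · rw [Set.biUnion_insert, Set.union_comm (i.verts _), ← Set.union_assoc]
        rfl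
      · rw [Set.biUnion_insert, Set.union_comm (i.edges _ _), ← Set.union_assoc]
        rfl
  have := key _ (finite_setOf_valid hΓ hu hp) subset_rfl
  rw [← pict_edges_eq] at this
  exact this

end PictCover

/-! ### The projection of `Pict` and the lifting of paths -/

section PictProjection

variable {V α : Type*} {Γ : LGraph V α} {u : V} {p : List (α × V)}

/-- The projection of `Pict(Γ, p)` to `Γ` that is put together from the projections of the attached
graphs. -/
noncomputable def glueProj (Γ : LGraph V α) (u : V) (p : List (α × V))
    (πs : PictLoop V α → PictVertex V α → V) : PictVertex V α → V
  | ([], m) => pathEnd u (p.take m)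
  | (k :: l, m) =>
    -- At most one valid loop has a given key when simple paths are unique, so the choice is
    -- harmless; `u` is a default value for keys that do not occur.
    if h : ∃ i : PictLoop V α, i.Valid Γ u p ∧ i.key = k then πs h.choose (l, m) else u

theorem glueProj_line (πs : PictLoop V α → PictVertex V α → V) {q r : List (α × V)}
    (h : p = q ++ r) : glueProj Γ u p πs ([], q.length) = pathEnd u q := by
  subst h
  simp [glueProj]

theorem glueProj_line_succ (πs : PictLoop V α → PictVertex V α → V) {q r : List (α × V)} {a : α}
    {v : V} (h : p = q ++ (a, v) :: r) : glueProj Γ u p πs ([], q.length + 1) = v := by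
  have := glueProj_line (Γ := Γ) (u := u) πs (q := q ++ [(a, v)]) (r := r) (p := p) (by simp [h])
  rw [List.length_append, pathEnd_concat] at this
  exact this

theorem PictCover.proj_one {VS : Set (PictVertex V α)} {π : PictVertex V α → V}
    {a : α} {v₁ : V} {c : List (α × V)} (h : PictCover Γ u ((a, v₁) :: c) VS π) :
    π ([], 1) = v₁ := h.line [(a, v₁)] c rfl

theorem PictCover.proj_final {VS : Set (PictVertex V α)} {π : PictVertex V α → V}
    (h : PictCover Γ u p VS π) : π ([], p.length) = pathEnd u p := h.line p [] (by simp)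

/-- Apart from the start vertex, no vertex has an edge to the first vertex of the line. -/
theorem PictCover.source_eq_start {q : List (α × V)} {a : α} {v₁ : V} {r c : List (α × V)}
    {VS : Set (PictVertex V α)} {π : PictVertex V α → V}
    (h : PictCover (cutGraph Γ u q a v₁) (pathEnd u q) ((a, v₁) :: c) VS π)
    (hp : IsSimplePath Γ u (q ++ (a, v₁) :: r))
    {y : PictVertex V α} {d : α}
    (he : PictEdge (cutGraph Γ u q a v₁) (pathEnd u q) ((a, v₁) :: c) y d ([], 1)) :
    y = ([], 0) := by
  have := h.edge _ _ _ he
  rw [h.proj_one] at this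
  rcases this.2 with h' | h'
  · refine h.eq_start (noEdgeInto_cutGraph hp) (h.source_mem he) ?_
    exact congrArg Prod.fst h'
  · exact absurd rfl h'.2.2

/-- The incoming edges are compared in two cases. At a vertex `v₁` of the line, `e` lifts to the
edge of the line and every other edge with reachable source lifts to the closing edge of its loop.
At another vertex of an attached copy, an edge of `Γ` with reachable source already lies in the cut
graph by `UniqueSimplePaths.mem_cutGraph`, and it lifts inside the copy. -/
theorem pictCover_glue (hΓ : Γ.Finite) (hu : UniqueSimplePaths Γ u)
    (hp : IsSimplePath Γ u p) (hne : p ≠ []) (VS : PictLoop V α → Set (PictVertex V α))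
    (πs : PictLoop V α → PictVertex V α → V)
    (IH : ∀ i : PictLoop V α, i.Valid Γ u p →
      PictCover (i.graph Γ u) (i.root u) i.path (VS i) (πs i)) :
    PictCover Γ u p (lineVerts V p.length ∪
      ⋃ i ∈ {i : PictLoop V α | i.Valid Γ u p}, i.verts (VS i)) (glueProj Γ u p πs) := by
  have hemb : ∀ i : PictLoop V α, i.Valid Γ u p → ∀ y,
      glueProj Γ u p πs (i.emb y) = πs i y := by
    intro i hi y
    by_cases hy : y = ([], 1)
    · rw [hy, PictLoop.emb, attachVertex_one, glueProj_line_succ πs hi.split, (IH i hi).proj_one]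
    · have hex : ∃ j : PictLoop V α, j.Valid Γ u p ∧ j.key = i.key := ⟨i, hi, rfl⟩
      have : hex.choose = i :=
        PictLoop.Valid.ext hu hp hex.choose_spec.1 hi hex.choose_spec.2
      rw [PictLoop.emb, attachVertex_of_ne _ _ hy]
      change (if h : ∃ j : PictLoop V α, j.Valid Γ u p ∧ j.key = i.key then _ else _) = _
      rw [dif_pos hex, this]
  have hclose : ∀ i : PictLoop V α, i.Valid Γ u p →
      glueProj Γ u p πs (i.emb ([], i.c.length + 1)) = i.v' := by
    intro i hi
    rw [hemb i hi, ← hi.pathEnd_eq]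
    exact (IH i hi).proj_final
  have hsplit : ∀ i : PictLoop V α, i.Valid Γ u p →
      IsSimplePath Γ u (i.q ++ (i.a, i.v₁) :: i.r) := fun i hi => hi.split ▸ hp
  have hlift_line : ∀ m ≤ p.length, m ≠ 0 → ∀ w d,
      (w, d, glueProj Γ u p πs ([], m)) ∈ Γ → Reaches Γ u w →
      ∃ z, PictEdge Γ u p z d ([], m) ∧ glueProj Γ u p πs z = w := by
    intro m hm hm₀ w d he hw
    obtain ⟨n, rfl⟩ := Nat.exists_eq_succ_of_ne_zero hm₀
    obtain ⟨q, a, v₁, r, hpq, rfl⟩ : ∃ q a v₁ r, p = q ++ (a, v₁) :: r ∧ q.length = n := by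
      refine ⟨p.take n, p[n].1, p[n].2, p.drop (n + 1), ?_, by simp; omega⟩
      simp
    rw [Nat.succ_eq_add_one] at he ⊢
    rw [glueProj_line_succ πs hpq] at he
    by_cases hwd : (w, d) = (pathEnd u q, a)
    · simp only [Prod.mk.injEq] at hwd
      obtain ⟨rfl, rfl⟩ := hwd
      exact ⟨([], q.length), pictEdge_iff.2 (.inl ⟨q, v₁, r, hpq, rfl, rfl⟩),
        glueProj_line πs hpq⟩
    · obtain ⟨c, hc, hce⟩ := hu.exists_loop (hpq ▸ hp) he hwd hw
      have hi : (PictLoop.mk q a v₁ r w d c).Valid Γ u p := ⟨hpq, he, hwd, hc, hce⟩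
      exact ⟨_, pictEdge_iff.2 (.inr ⟨_, hi, .inr ⟨rfl, rfl, rfl⟩⟩), hclose _ hi⟩
  constructor
  · exact loopGraphOn_pict hΓ hu hp hne VS fun i hi => (IH i hi).loop
  · exact fun q r h => glueProj_line πs h
  · intro y d z he
    rcases pictEdge_iff.1 he with ⟨q, v, r, hpq, rfl, rfl⟩ |
      ⟨i, hi, ⟨y', z', h, -, rfl, rfl⟩ | ⟨rfl, rfl, rfl⟩⟩
    · rw [glueProj_line πs hpq, glueProj_line_succ πs hpq]
      have := hp.1
      rw [hpq, isPath_append, isPath_cons] at this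
      exact this.2.1
    · rw [hemb i hi, hemb i hi]
      exact cutGraph_subset ((IH i hi).edge _ _ _ h)
    · rw [hclose i hi, glueProj_line_succ πs hi.split]
      exact hi.edge
  · rintro y (⟨m, hm, rfl⟩ | hy)
    · refine ⟨p.take m, ?_, rfl⟩
      have := hp.1
      rw [← List.take_append_drop m p, isPath_append] at this
      exact this.1
    · simp only [Set.mem_iUnion] at hy
      obtain ⟨i, hi, y, hy, rfl⟩ := hy
      obtain ⟨s, hs, hse⟩ := (IH i hi).reach y hy.1
      rw [hemb i hi]
      exact ⟨i.q ++ s, isPath_append.2 ⟨(hsplit i hi).left.1, hs.mono cutGraph_subset⟩,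
        by rw [pathEnd_append, hse]⟩
  · rintro y (⟨m, hm, rfl⟩ | hy) hy₀ w d he hw
    · exact hlift_line m hm (by rintro rfl; exact hy₀ rfl) w d he hw
    · simp only [Set.mem_iUnion] at hy
      obtain ⟨i, hi, y, ⟨hy, hy'⟩, rfl⟩ := hy
      have hi' := IH i hi
      by_cases hy₁ : y = ([], 1)
      · subst hy₁
        refine hlift_line _ ?_ (by simp) w d he hw
        have := congrArg List.length hi.split
        simp only [List.length_append, List.length_cons] at this
        omega
      · rw [hemb i hi] at he
        -- Some edge enters `y` inside the copy and does not come from its start, so it lies over an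
        -- edge of the cut graph other than `e`. Therefore `π y` is off `q` and different from `v₁`.
        obtain ⟨z, d', hz⟩ := hi'.exists_edge_into hy hy'
        have hz₀ : z ≠ ([], 0) := by
          rintro rfl
          exact hy₁ hz.eq_one_of_start
        have hz' : πs i y ∉ pathVerts u i.q ∧ πs i y ≠ i.v₁ := by
          rcases (hi'.edge _ _ _ hz).2 with h | h
          · exact absurd (hi'.eq_start (noEdgeInto_cutGraph (hsplit i hi)) (hi'.source_mem hz)
              (congrArg Prod.fst h)) hz₀
          · exact h.2
        obtain ⟨he', hw'⟩ := hu.mem_cutGraph (hsplit i hi) he hw (hi'.reach y hy) hz'.1 hz'.2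
        obtain ⟨x, hx, hxw⟩ := hi'.lift y hy hy' w d he' hw'
        refine ⟨i.emb x, pictEdge_iff.2 (.inr ⟨i, hi, .inl ⟨x, y, hx, ?_, rfl, rfl⟩⟩),
          by rw [hemb i hi, hxw]⟩
        rintro rfl
        exact hy₁ hx.eq_one_of_start
  -- Edges taken over from a copy never end on the line: in the copy, only the deleted first edge
  -- enters the vertex number one.
  · have hatt : ∀ (i : PictLoop V α) (_ : i.Valid Γ u p) (y : PictVertex V α) (d : α)
        (n : ℕ) (z : PictVertex V α), PictEdge (i.graph Γ u) (i.root u) i.path y d z →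
        y ≠ ([], 0) → ([], n) ≠ i.emb z := by
      intro i hi y d n z h hy hz
      obtain ⟨rfl, -⟩ := attachVertex_eq_nil hz.symm
      exact hy ((IH i hi).source_eq_start (hsplit i hi) h)
    -- A closing edge never projects to the edge of the line with the same target, because `e' ≠ e`.
    have hlc : ∀ (q r : List (α × V)) (d : α) (v : V) (_ : p = q ++ (d, v) :: r)
        (i : PictLoop V α) (_ : i.Valid Γ u p), d = i.b → q.length = i.q.length →
        pathEnd u q = i.v' → False := by
      intro q r d v hpq i hi hd hl hv
      obtain ⟨hq, h⟩ := List.append_inj (hpq.symm.trans hi.split) hl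
      simp only [List.cons.injEq, Prod.mk.injEq] at h
      exact hi.ne (by rw [← hv, ← hd, h.1.1, hq])
    intro y d z z' he he' hπ
    rcases pictEdge_iff.1 he with ⟨q, v, r, hpq, rfl, rfl⟩ |
      ⟨i, hi, ⟨x, y, h, hx, rfl, rfl⟩ | ⟨rfl, hd, rfl⟩⟩ <;>
    rcases pictEdge_iff.1 he' with ⟨q', v', r', hpq', rfl, h'⟩ |
      ⟨j, hj, ⟨x', y', h', hx', rfl, hy⟩ | ⟨rfl, hd', hy⟩⟩
    · simp only [Prod.mk.injEq, true_and, add_left_inj] at h'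
      rw [h']
    · exact absurd hy (hatt j hj _ _ _ _ h' hx')
    · simp only [Prod.mk.injEq, true_and, add_left_inj] at hy
      rw [glueProj_line πs hpq, hclose j hj] at hπ
      exact (hlc q r d v hpq j hj hd' hy hπ).elim
    · exact absurd h'.symm (hatt i hi _ _ _ _ h hx)
    · by_cases hy₁ : y = ([], 1)
      · subst hy₁
        exact absurd hy (hatt j hj _ _ _ _ h' hx')
      · rw [PictLoop.emb, attachVertex_of_ne _ _ hy₁] at hy
        obtain ⟨h₁, h₂, h₃⟩ := attachVertex_eq_cons hy.symm
        obtain rfl := PictLoop.Valid.ext hu hp hj hi (Prod.ext h₁ h₂)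
        rw [hemb j hi, hemb j hi] at hπ
        rw [h₃] at h'
        rw [(IH j hi).lift_unique y d x x' h h' hπ]
    · exact absurd hy.symm (hatt i hi _ _ _ _ h hx)
    · simp only [Prod.mk.injEq, true_and, add_left_inj] at h'
      rw [glueProj_line πs hpq', hclose i hi] at hπ
      exact (hlc q' r' d v' hpq' i hi hd h'.symm hπ.symm).elim
    · exact absurd hy (hatt j hj _ _ _ _ h' hx')
    · simp only [Prod.mk.injEq, true_and, add_left_inj] at hy
      rw [hclose i hi, hclose j hj] at hπ
      rw [PictLoop.Valid.ext hu hp hi hj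
        (Prod.ext (congrArg (· + 1) hy) (Prod.ext hπ (hd.symm.trans hd')))]

/-- `Pict(Γ, p)` is a loop graph, and it projects to `Γ`. -/
theorem exists_pictCover (hΓ : Γ.Finite) (hu : UniqueSimplePaths Γ u)
    (hp : IsSimplePath Γ u p) (hne : p ≠ []) : ∃ VS π, PictCover Γ u p VS π := by
  -- The recursion terminates because the cut graph lacks the edge `e'` that gave rise to the loop.
  induction hn : Γ.ncard using Nat.strong_induction_on generalizing Γ u p with
  | _ n ih =>
    have : ∀ i : PictLoop V α, ∃ VS π, i.Valid Γ u p →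
        PictCover (i.graph Γ u) (i.root u) i.path VS π := by
      intro i
      by_cases hi : i.Valid Γ u p
      · have hlt : (i.graph Γ u).ncard < n := by
          rw [← hn]
          refine Set.ncard_lt_ncard ⟨cutGraph_subset, fun h => ?_⟩ hΓ
          rcases (h hi.edge).2 with h' | h'
          · simp only [Prod.mk.injEq] at h'
            exact hi.ne (Prod.ext h'.1 h'.2.1)
          · exact h'.2.2 rfl
        obtain ⟨VS, π, h⟩ := ih _ hlt (hΓ.subset cutGraph_subset)
          (hu.cutGraph (hi.split ▸ hp)) hi.simple (by simp) rfl
        exact ⟨VS, π, fun _ => h⟩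
      · exact ⟨∅, fun _ => u, fun h => absurd h hi⟩
    choose VS πs h using this
    exact ⟨_, _, pictCover_glue hΓ hu hp hne VS πs h⟩

/-! ### Paths in `Pict` -/

namespace PictCover

variable {VS : Set (PictVertex V α)} {π : PictVertex V α → V}

theorem isPath_map (h : PictCover Γ u p VS π) {y : PictVertex V α}
    {s : List (α × PictVertex V α)} (hs : IsPath (pict Γ u p).edges y s) :
    IsPath Γ (π y) (s.map (Prod.map id π)) := by
  rw [IsPath, pathEdges_map]
  rintro _ ⟨⟨y, d, z⟩, he, rfl⟩
  exact h.edge _ _ _ (hs he)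

/-- Only incoming edges lift, so the lift is constructed from the end of the path backwards. It ends
up at the start vertex because no other vertex lies over `u`. -/
theorem exists_lift_path (h : PictCover Γ u p VS π) (hu : NoEdgeInto Γ u)
    {s : List (α × V)} (hs : IsPath Γ u s) {y : PictVertex V α} (hy : y ∈ VS)
    (hse : pathEnd u s = π y) :
    ∃ s', IsPath (pict Γ u p).edges ([], 0) s' ∧ pathEnd ([], 0) s' = y ∧
      s'.map (Prod.map id π) = s := by
  induction s using List.reverseRecOn generalizing y with
  | nil => exact ⟨[], isPath_nil, (h.eq_start hu hy hse.symm).symm, rfl⟩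
  | append_singleton s e ih =>
    obtain ⟨d, v⟩ := e
    rw [pathEnd_concat] at hse
    subst hse
    rw [isPath_concat] at hs
    have hy₀ : y ≠ ([], 0) := by
      rintro rfl
      rw [h.proj_start] at hs
      exact hu _ _ hs.2
    obtain ⟨z, hz, hzw⟩ := h.lift y hy hy₀ _ d hs.2 ⟨s, hs.1, rfl⟩
    obtain ⟨s', hs', hs'e, hs'm⟩ := ih hs.1 (h.source_mem hz) hzw.symm
    exact ⟨s' ++ [(d, y)], isPath_concat.2 ⟨hs', hs'e ▸ hz⟩, pathEnd_concat, by simp [hs'm]⟩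

theorem lift_path_unique (h : PictCover Γ u p VS π)
    {s s' : List (α × PictVertex V α)} (hs : IsPath (pict Γ u p).edges ([], 0) s)
    (hs' : IsPath (pict Γ u p).edges ([], 0) s')
    (he : pathEnd ([], 0) s = pathEnd ([], 0) s')
    (hm : s.map (Prod.map id π) = s'.map (Prod.map id π)) : s = s' := by
  induction s using List.reverseRecOn generalizing s' with
  | nil => exact (List.map_eq_nil_iff.1 hm.symm).symm
  | append_singleton s e ih =>
    obtain ⟨d, y⟩ := e
    rcases List.eq_nil_or_concat' s' with rfl | ⟨s', ⟨d', y'⟩, rfl⟩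
    · simp at hm
    · rw [pathEnd_concat, pathEnd_concat] at he
      subst he
      rw [isPath_concat] at hs hs'
      rw [List.map_append, List.map_append] at hm
      obtain ⟨hm', hd⟩ := List.append_inj' hm rfl
      simp only [List.map_cons, List.map_nil, Prod.map_apply, id_eq, List.cons.injEq,
        Prod.mk.injEq, and_true] at hd
      subst hd
      have := h.lift_unique _ _ _ _ hs.2 hs'.2
        (by rw [← pathEnd_map π, ← pathEnd_map π, hm'])
      rw [ih hs.1 hs'.1 this hm']

/-- The paths in `Pict(Γ, p)` from the start vertex to the final vertex correspond to the paths in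
`Γ` from the root to the end of `p`. -/
noncomputable def fullPathsEquiv (h : PictCover Γ u p VS π) (hu : NoEdgeInto Γ u) :
    fullPaths (pict Γ u p) ≃ {s | IsPath Γ u s ∧ pathEnd u s = pathEnd u p} :=
  Equiv.ofBijective
    (fun s => ⟨s.1.map (Prod.map id π), by
      have := h.isPath_map s.2.1
      rw [show (pict Γ u p).start = ([], 0) from rfl, h.proj_start] at this
      exact this, by
      have := pathEnd_map π ([], 0) s.1
      rw [h.proj_start] at this
      rw [this, ← h.proj_final]
      exact congrArg π s.2.2⟩)
    ⟨fun s s' he => Subtype.ext (h.lift_path_unique s.2.1 s'.2.1 (s.2.2.trans s'.2.2.symm)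
      (congrArg Subtype.val he)), fun s => by
      obtain ⟨s', h₁, h₂, h₃⟩ := h.exists_lift_path hu s.2.1 h.loop.final_mem
        (s.2.2.trans h.proj_final.symm)
      exact ⟨⟨s', h₁, h₂⟩, Subtype.ext h₃⟩⟩

theorem pathWeight_fullPathsEquiv (h : PictCover Γ u p VS π) (hu : NoEdgeInto Γ u) (x : α → ℝ)
    (s : fullPaths (pict Γ u p)) :
    pathWeight x (h.fullPathsEquiv hu s).1 = pathWeight x s.1 := by
  change pathWeight x (s.1.map (Prod.map id π)) = _
  rw [pathWeight, List.map_map]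
  rfl

end PictCover

/-- The normal distribution of `Pict(Γ, p)` is the sum of the weights of all paths in `Γ` from the
root to the end of `p`. -/
theorem normalDist_pict (hΓ : Γ.Finite) (hu : UniqueSimplePaths Γ u) (hn : NoEdgeInto Γ u)
    (hp : IsSimplePath Γ u p) (hne : p ≠ []) (x : α → ℝ) :
    normalDist (pict Γ u p) x =
      ∑' s : {s | IsPath Γ u s ∧ pathEnd u s = pathEnd u p}, pathWeight x s.1 := by
  obtain ⟨VS, π, h⟩ := exists_pictCover hΓ hu hp hne
  rw [normalDist, ← (h.fullPathsEquiv hn).tsum_eq]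
  simp_rw [h.pathWeight_fullPathsEquiv hn x]

theorem normalSummable_pict_iff (hΓ : Γ.Finite) (hu : UniqueSimplePaths Γ u) (hn : NoEdgeInto Γ u)
    (hp : IsSimplePath Γ u p) (hne : p ≠ []) (x : α → ℝ) :
    NormalSummable (pict Γ u p) x ↔
      Summable fun s : {s | IsPath Γ u s ∧ pathEnd u s = pathEnd u p} => pathWeight x s.1 := by
  obtain ⟨VS, π, h⟩ := exists_pictCover hΓ hu hp hne
  rw [NormalSummable, ← (h.fullPathsEquiv hn).summable_iff]
  exact summable_congr fun s => (h.pathWeight_fullPathsEquiv hn x s).symm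

theorem isLoopGraph_pict (hΓ : Γ.Finite) (hu : UniqueSimplePaths Γ u)
    (hp : IsSimplePath Γ u p) (hne : p ≠ []) : IsLoopGraph (pict Γ u p) :=
  let ⟨VS, _, h⟩ := exists_pictCover hΓ hu hp hne
  ⟨VS, h.loop⟩

end PictProjection

/-! ### Words, automata and the minimal ideal -/

section Words

variable {α Q : Type*}

/-- The weight of a word. -/
def wordWeight (x : α → ℝ) (u : List α) : ℝ := (u.map x).prod

/-- The path that starts at the state `q` of the automaton `δ` and reads the word `u`. -/
def autoPath (δ : Q → α → Q) : Q → List α → List (α × Q)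
  | _, [] => []
  | q, a :: u => (a, δ q a) :: autoPath δ (δ q a) u

theorem pathEnd_autoPath (δ : Q → α → Q) (q : Q) (u : List α) :
    pathEnd q (autoPath δ q u) = u.foldl δ q := by
  induction u generalizing q with
  | nil => rfl
  | cons a u ih => exact ih (δ q a)

theorem map_fst_autoPath (δ : Q → α → Q) (q : Q) (u : List α) :
    (autoPath δ q u).map Prod.fst = u := by
  induction u generalizing q with
  | nil => rfl
  | cons a u ih => simp [autoPath, ih]

theorem autoPath_append (δ : Q → α → Q) (q : Q) (u v : List α) :
    autoPath δ q (u ++ v) = autoPath δ q u ++ autoPath δ (u.foldl δ q) v := by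
  induction u generalizing q with
  | nil => rfl
  | cons a u ih => simp [autoPath, ih]

theorem autoPath_concat (δ : Q → α → Q) (q : Q) (u : List α) (a : α) :
    autoPath δ q (u ++ [a]) = autoPath δ q u ++ [(a, δ (u.foldl δ q) a)] :=
  autoPath_append δ q u [a]

/-- In a deterministic graph a path is determined by its labels; this is what turns sums over paths
into sums over words. -/
theorem IsPath.eq_autoPath {Γ : LGraph Q α} {δ : Q → α → Q}
    (hδ : ∀ q a q', (q, a, q') ∈ Γ → q' = δ q a) {q : Q} {p : List (α × Q)}
    (hp : IsPath Γ q p) : p = autoPath δ q (p.map Prod.fst) := by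
  induction p generalizing q with
  | nil => rfl
  | cons e p ih =>
    obtain ⟨a, v⟩ := e
    rw [isPath_cons] at hp
    obtain rfl := hδ _ _ _ hp.1
    rw [List.map_cons, autoPath]
    exact congrArg _ (ih hp.2)

end Words

instance finite_withOne (S : Type*) [Finite S] : Finite (WithOne S) :=
  inferInstanceAs (Finite (Option S))

instance finite_withZero (S : Type*) [Finite S] : Finite (WithZero S) :=
  inferInstanceAs (Finite (Option S))

section MinimalIdeal

variable {S : Type*} [Semigroup S]

theorem isSemigroupIdeal_minimalIdeal : IsSemigroupIdeal (minimalIdeal S) :=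
  fun _ hx s => ⟨fun I hI => (hI.1 _ (hx I hI) s).1, fun I hI => (hI.1 _ (hx I hI) s).2⟩

/-- An inclusion-minimal nonempty ideal `I` is contained in every nonempty ideal `J`, since `I ∩ J`
is an ideal containing all products `xy` with `x ∈ I`, `y ∈ J`. -/
theorem minimalIdeal_nonempty [Finite S] [Nonempty S] : (minimalIdeal S).Nonempty := by
  have huniv : IsSemigroupIdeal (Set.univ : Set S) ∧ (Set.univ : Set S).Nonempty :=
    ⟨fun _ _ _ => ⟨trivial, trivial⟩, Set.univ_nonempty⟩
  obtain ⟨I, hI⟩ := (Set.toFinite {I : Set S | IsSemigroupIdeal I ∧ I.Nonempty}).exists_minimal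
    ⟨_, huniv⟩
  obtain ⟨x, hx⟩ := hI.1.2
  refine ⟨x, fun J hJ => ?_⟩
  have hIJ : IsSemigroupIdeal (I ∩ J) ∧ (I ∩ J).Nonempty := by
    obtain ⟨y, hy⟩ := hJ.2
    exact ⟨fun z hz s => ⟨⟨(hI.1.1 z hz.1 s).1, (hJ.1 z hz.2 s).1⟩,
      ⟨(hI.1.1 z hz.1 s).2, (hJ.1 z hz.2 s).2⟩⟩, x * y, (hI.1.1 x hx y).2, (hJ.1 y hy x).1⟩
  exact (hI.2 hIJ Set.inter_subset_left hx).2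

theorem IsLeftZero.mul_eq (h : IsLeftZero (minimalIdeal S)) {k : S} (hk : k ∈ minimalIdeal S)
    (s : S) : k * s = k := by
  have h₁ : k * s ∈ minimalIdeal S := (isSemigroupIdeal_minimalIdeal k hk s).2
  calc k * s = k * k * s := by rw [h k hk k hk]
    _ = k * (k * s) := mul_assoc _ _ _
    _ = k := h k hk _ h₁

theorem minimalIdeal_withZero : minimalIdeal (WithZero S) = {0} := by
  ext x
  constructor
  · intro hx
    exact hx {0} ⟨fun y hy s => by
      obtain rfl : y = 0 := hy
      exact ⟨mul_zero s, zero_mul s⟩, 0, rfl⟩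
  · rintro rfl I ⟨hI, y, hy⟩
    have := (hI y hy 0).1
    rwa [zero_mul] at this

theorem isLeftZero_withZero : IsLeftZero (minimalIdeal (WithZero S)) := by
  rw [minimalIdeal_withZero]
  rintro x rfl y rfl
  exact mul_zero 0

/-- The element `s` of `S` with an adjoined identity lies in `K(S)`. -/
def InK (s : WithOne S) : Prop := ∃ k ∈ minimalIdeal S, s = (k : WithOne S)

theorem inK_coe {s : S} : InK (s : WithOne S) ↔ s ∈ minimalIdeal S :=
  ⟨fun ⟨_, hk, h⟩ => WithOne.coe_inj.1 h ▸ hk, fun h => ⟨s, h, rfl⟩⟩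

theorem not_inK_one : ¬ InK (1 : WithOne S) := fun ⟨_, _, h⟩ => WithOne.coe_ne_one h.symm

theorem InK.mul_right {s : WithOne S} (h : InK s) (t : WithOne S) : InK (s * t) := by
  obtain ⟨k, hk, rfl⟩ := h
  induction t using WithOne.recOneCoe with
  | one => rw [mul_one]; exact ⟨k, hk, rfl⟩
  | coe t => exact ⟨k * t, (isSemigroupIdeal_minimalIdeal k hk t).2, (WithOne.coe_mul k t).symm⟩

theorem InK.mul_left {s : WithOne S} (h : InK s) (t : WithOne S) : InK (t * s) := by
  obtain ⟨k, hk, rfl⟩ := h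
  induction t using WithOne.recOneCoe with
  | one => rw [one_mul]; exact ⟨k, hk, rfl⟩
  | coe t => exact ⟨t * k, (isSemigroupIdeal_minimalIdeal k hk t).1, (WithOne.coe_mul t k).symm⟩

theorem IsLeftZero.inK_mul (h : IsLeftZero (minimalIdeal S)) {s : WithOne S} (hs : InK s)
    (t : WithOne S) : s * t = s := by
  obtain ⟨k, hk, rfl⟩ := hs
  induction t using WithOne.recOneCoe with
  | one => rw [mul_one]
  | coe t => rw [← WithOne.coe_mul, h.mul_eq hk]

end MinimalIdeal

/-! ### The Karnofsky–Rhodes expansion -/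

section KarnofskyRhodes

variable {S : Type*} [Semigroup S] {α : Type*} (g : α → S)

theorem wordVal_nil : wordVal g [] = 1 := rfl

theorem wordVal_append (u v : List α) : wordVal g (u ++ v) = wordVal g u * wordVal g v := by
  simp [wordVal]

theorem wordVal_singleton (a : α) : wordVal g [a] = (g a : WithOne S) := by
  simp [wordVal]

theorem wordVal_concat (u : List α) (a : α) :
    wordVal g (u ++ [a]) = wordVal g u * (g a : WithOne S) := by
  rw [wordVal_append, wordVal_singleton]

theorem wordVal_cons (a : α) (u : List α) :
    wordVal g (a :: u) = (g a : WithOne S) * wordVal g u := by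
  simp [wordVal]

theorem mul_coe_ne_one (s : WithOne S) (t : S) : s * (t : WithOne S) ≠ 1 := by
  induction s using WithOne.recOneCoe with
  | one => rw [one_mul]; exact WithOne.coe_ne_one
  | coe s => rw [← WithOne.coe_mul]; exact WithOne.coe_ne_one

theorem pathEnd_cayPath (s : WithOne S) (u : List α) :
    pathEnd s (cayPath g s u) = s * wordVal g u := by
  induction u generalizing s with
  | nil => simp [cayPath, pathEnd, wordVal]
  | cons a u ih =>
    rw [wordVal_cons, ← mul_assoc]
    exact ih _

theorem cayPath_append (s : WithOne S) (u v : List α) :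
    cayPath g s (u ++ v) = cayPath g s u ++ cayPath g (s * wordVal g u) v := by
  induction u generalizing s with
  | nil => simp [cayPath, wordVal]
  | cons a u ih => simp [cayPath, ih, wordVal_cons, mul_assoc]

theorem transitionEdges_concat (u : List α) (a : α) :
    transitionEdges g (u ++ [a]) = transitionEdges g u ∪
      {e | e = (wordVal g u, a, wordVal g u * (g a : WithOne S)) ∧
        IsTransitionEdge (rCay g) e} := by
  ext e
  simp only [transitionEdges, cayPath_append, pathEdges_append, pathEnd_cayPath, one_mul, cayPath,
    pathEdges, insert_empty_eq, Set.mem_union, Set.mem_singleton_iff, Set.mem_ofPred_eq]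
  exact or_and_right

/-- The vertex of the Karnofsky–Rhodes expansion to which the letter `a` leads. -/
def krStep (v : KR g) (a : α) : KR g :=
  Quotient.map' (s₁ := krSetoid g) (s₂ := krSetoid g) (fun u => u ++ [a]) (fun u u' h => by
    refine ⟨?_, ?_⟩
    · rw [wordVal_concat, wordVal_concat, h.1]
    · rw [transitionEdges_concat, transitionEdges_concat, h.1, h.2]) v

theorem mem_krEdges_iff {v v' : KR g} {a : α} : (v, a, v') ∈ krEdges g ↔ v' = krStep g v a := by
  constructor
  · rintro ⟨u, b, h⟩
    simp only [Prod.mk.injEq] at h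
    obtain ⟨rfl, rfl, rfl⟩ := h
    rfl
  · rintro rfl
    induction v using Quotient.inductionOn with
    | _ u => exact ⟨u, a, rfl⟩

theorem krVal_krStep (v : KR g) (a : α) :
    krVal g (krStep g v a) = krVal g v * (g a : WithOne S) := by
  induction v using Quotient.inductionOn with
  | _ u => exact wordVal_concat g u a

theorem krVal_root : krVal g (krRoot g) = 1 := rfl

theorem noEdgeInto_krEdges : NoEdgeInto (krEdges g) (krRoot g) := by
  intro w a h
  rw [mem_krEdges_iff] at h
  have := congrArg (krVal g) h
  rw [krVal_krStep, krVal_root] at this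
  exact mul_coe_ne_one _ _ this.symm

/-- A vertex is determined by an element of a finite set and a set of edges of a finite graph. -/
theorem finite_kr [Finite S] [Finite α] : Finite (KR g) := by
  refine Finite.of_injective (β := WithOne S × Set (WithOne S × α × WithOne S))
    (Quotient.lift (s := krSetoid g) (fun u => (wordVal g u, transitionEdges g u))
      (fun u v h => Prod.ext h.1 h.2)) ?_
  intro v v' h
  induction v using Quotient.inductionOn with
  | _ u =>
    induction v' using Quotient.inductionOn with
    | _ u' => exact Quotient.sound (s := krSetoid g) ⟨congrArg Prod.fst h, congrArg Prod.snd h⟩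

/-- If `K(S)` is left zero, then the edges at the vertices over `K(S)` are loops. -/
theorem krStep_of_inK (hK : IsLeftZero (minimalIdeal S)) {v : KR g} (hv : InK (krVal g v))
    (a : α) : krStep g v a = v := by
  induction v using Quotient.inductionOn with
  | _ u =>
    have hval : wordVal g u * (g a : WithOne S) = wordVal g u := hK.inK_mul hv _
    refine Quotient.sound (s := krSetoid g) ⟨(wordVal_concat g u a).trans hval, ?_⟩
    rw [transitionEdges_concat, Set.union_eq_left]
    rintro _ ⟨rfl, -, h⟩
    -- The edge is a loop, so it is itself a path back to its source and is no transition edge.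
    refine absurd ⟨[(a, wordVal g u)], by simp, ?_, rfl⟩ h
    rw [hval, isPath_cons]
    exact ⟨hval.symm, isPath_nil⟩

end KarnofskyRhodes

/-! ### The McCammond expansion -/

section McCammond

variable {V α : Type*} {Γ : LGraph V α} {r : V}

theorem treePath_concat (t : List (α × V)) (e : α × V) :
    treePath (t ++ [e]) = treePath t ++ [(e.1, t ++ [e])] := by
  have htail : (t ++ [e]).inits.tail = t.inits.tail ++ [t ++ [e]] := by
    rw [List.inits_append]
    cases t <;> simp
  rw [treePath, htail, List.map_append, List.zip_append (by simp)]
  rfl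

theorem pathEnd_treePath (t : List (α × V)) : pathEnd [] (treePath t) = t := by
  rcases List.eq_nil_or_concat' t with rfl | ⟨t, e, rfl⟩
  · rfl
  · rw [treePath_concat, pathEnd_concat]

theorem mem_pathVerts_treePath {t s : List (α × V)} :
    s ∈ pathVerts [] (treePath t) ↔ s <+: t := by
  induction t using List.reverseRecOn with
  | nil => simp [treePath, pathVerts]
  | append_singleton t e ih =>
    rw [treePath_concat, pathVerts_append, List.mem_append, ih, List.prefix_concat_iff]
    simp [or_comm]

/-- Simple paths in the McCammond expansion that start at the root run in the spanning tree. -/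
theorem eq_treePath_of_isSimplePath {p : List (α × List (α × V))}
    (hp : IsSimplePath (mcEdges Γ r) [] p) : p = treePath (pathEnd [] p) := by
  induction p using List.reverseRecOn with
  | nil => rfl
  | append_singleton p e ih =>
    obtain ⟨a, t⟩ := e
    rw [isSimplePath_concat] at hp
    obtain ⟨hp, ⟨-, v, -, h | h⟩, hv⟩ := hp
    · have h' : t = pathEnd [] p ++ [(a, v)] := h.2
      rw [pathEnd_concat, h', treePath_concat, ← ih hp]
    -- An edge of the second kind leads to an initial segment of the current vertex, and the tree
    -- path has visited all of these.
    · rw [ih hp, mem_pathVerts_treePath] at hv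
      exact absurd h.2.1 hv

theorem uniqueSimplePaths_mcEdges : UniqueSimplePaths (mcEdges Γ r) [] := by
  intro p q hp hq h
  rw [eq_treePath_of_isSimplePath hp, eq_treePath_of_isSimplePath hq, h]

theorem UniqueSimplePaths.mono {Γ' : LGraph V α} (h : UniqueSimplePaths Γ r) (hΓ : Γ' ⊆ Γ) :
    UniqueSimplePaths Γ' r :=
  fun p q hp hq => h p q ⟨hp.1.mono hΓ, hp.2⟩ ⟨hq.1.mono hΓ, hq.2⟩

theorem noEdgeInto_mcEdges (hr : NoEdgeInto Γ r) : NoEdgeInto (mcEdges Γ r) [] := by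
  rintro t a ⟨-, v, hv, h | h⟩
  · simp at h
  · obtain rfl : r = v := h.2.2
    exact hr _ _ hv

theorem nodup_pathVerts_treePath (t : List (α × V)) : (pathVerts [] (treePath t)).Nodup := by
  induction t using List.reverseRecOn with
  | nil => simp [treePath, pathVerts]
  | append_singleton t e ih =>
    rw [treePath_concat, pathVerts_append, List.nodup_append]
    refine ⟨ih, by simp, ?_⟩
    rintro s hs _ h rfl
    rw [mem_pathVerts_treePath] at hs
    have := hs.length_le
    simp only [List.map_cons, List.map_nil, List.mem_singleton] at h
    rw [h] at this
    simp at this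

theorem finite_isSimplePath [Finite V] [Finite α] :
    {t : List (α × V) | IsSimplePath Γ r t}.Finite := by
  cases nonempty_fintype V
  refine (List.finite_length_le (α × V) (Fintype.card V)).subset fun t ht => ?_
  have := ht.2.length_le_card
  simp only [pathVerts, List.length_cons, List.length_map] at this
  exact (Nat.le_succ _).trans this

theorem isSimplePath_of_prefix {s t : List (α × V)} (h : s <+: t) (ht : IsSimplePath Γ r t) :
    IsSimplePath Γ r s := by
  obtain ⟨s', rfl⟩ := h
  exact ht.left

theorem mcEdges_target {s t : List (α × V)} {a : α} (h : (s, a, t) ∈ mcEdges Γ r) :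
    IsSimplePath Γ r t := by
  obtain ⟨hs, v, hv, ⟨hn, ht⟩ | ⟨-, ht, -⟩⟩ := h
  · have ht' : t = s ++ [(a, v)] := ht
    rw [ht']
    exact isSimplePath_concat.2 ⟨hs, hv, hn⟩
  · exact isSimplePath_of_prefix ht hs

theorem finite_mcEdges [Finite V] [Finite α] : (mcEdges Γ r).Finite := by
  have := finite_isSimplePath (Γ := Γ) (r := r)
  refine (this.prod (Set.finite_univ.prod this)).subset ?_
  rintro ⟨s, a, t⟩ h
  exact ⟨h.1, trivial, mcEdges_target h⟩

end McCammond

/-! ### Words read in the McCammond expansion -/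

section WordSums

variable {α : Type*}

/-- The total weight of the words in a language. -/
noncomputable def wordSum (L : Set (List α)) (x : α → ℝ) : ℝ := ∑' u : L, wordWeight x u.1

/-- The total weight of the words in a language converges. -/
def WordSummable (L : Set (List α)) (x : α → ℝ) : Prop :=
  Summable fun u : L => wordWeight x u.1

theorem wordWeight_append (x : α → ℝ) (u v : List α) :
    wordWeight x (u ++ v) = wordWeight x u * wordWeight x v := by
  simp [wordWeight]

theorem wordWeight_cons (x : α → ℝ) (a : α) (u : List α) :
    wordWeight x (a :: u) = x a * wordWeight x u := by
  simp [wordWeight]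

theorem wordWeight_concat (x : α → ℝ) (u : List α) (a : α) :
    wordWeight x (u ++ [a]) = wordWeight x u * x a := by
  simp [wordWeight]

theorem wordWeight_nonneg {x : α → ℝ} (hx : ∀ a, 0 ≤ x a) (u : List α) : 0 ≤ wordWeight x u :=
  List.prod_nonneg (by simpa using fun a _ => hx a)

theorem wordWeight_pos {x : α → ℝ} (hx : ∀ a, 0 < x a) (u : List α) : 0 < wordWeight x u :=
  List.prod_pos (by simpa using fun a _ => hx a)

theorem wordSum_nonneg {z : α → ℝ} (hz : ∀ a, 0 ≤ z a) (L : Set (List α)) : 0 ≤ wordSum L z :=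
  tsum_nonneg fun _ => wordWeight_nonneg hz _

theorem wordSum_eq_tsum_indicator (L : Set (List α)) (x : α → ℝ) :
    wordSum L x = ∑' u, L.indicator (wordWeight x) u :=
  tsum_subtype L (wordWeight x)

theorem wordSummable_iff_indicator {L : Set (List α)} {x : α → ℝ} :
    WordSummable L x ↔ Summable (L.indicator (wordWeight x)) :=
  summable_subtype_iff_indicator (f := wordWeight x)

theorem WordSummable.mono {L L' : Set (List α)} {x : α → ℝ}
    (h : WordSummable L x) (hL : L' ⊆ L) : WordSummable L' x := by
  rw [wordSummable_iff_indicator] at h ⊢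
  have := h.indicator L'
  rwa [Set.indicator_indicator, Set.inter_eq_left.2 hL] at this

/-- The total weight of a language is the sum over the fibres of a map with finitely many values. -/
theorem finsum_wordSum_fibre {T : Type*} {F : Set T} (hF : F.Finite) (f : List α → T)
    {L : Set (List α)} {x : α → ℝ} (h : WordSummable {u | u ∈ L ∧ f u ∈ F} x) :
    ∑ᶠ t ∈ F, wordSum {u | u ∈ L ∧ f u = t} x = wordSum {u | u ∈ L ∧ f u ∈ F} x := by
  rw [finsum_mem_eq_finite_toFinset_sum _ hF]
  simp_rw [wordSum_eq_tsum_indicator]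
  rw [← Summable.tsum_finsetSum]
  · refine tsum_congr fun u => ?_
    by_cases hu : u ∈ L ∧ f u ∈ F
    · rw [Set.indicator_of_mem (by exact hu), Finset.sum_eq_single (f u)]
      · rw [Set.indicator_of_mem (by exact ⟨hu.1, rfl⟩)]
      · intro t _ ht
        exact Set.indicator_of_notMem (fun h => ht h.2.symm) _
      · intro h
        exact absurd (hF.mem_toFinset.2 hu.2) h
    · rw [Set.indicator_of_notMem (by exact hu)]
      refine Finset.sum_eq_zero fun t ht => Set.indicator_of_notMem (fun h => hu ⟨h.1, ?_⟩) _
      rw [h.2]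
      exact hF.mem_toFinset.1 ht
  · intro t ht
    rw [← wordSummable_iff_indicator]
    refine h.mono ?_
    rintro u ⟨h₁, rfl⟩
    exact ⟨h₁, hF.mem_toFinset.1 ht⟩

end WordSums

/-! ### The McCammond expansion as a deterministic automaton -/

section McRun

variable {S : Type*} [Semigroup S] {α : Type*} (g : α → S)

/-- The vertex of the McCammond expansion to which the letter `a` leads. -/
noncomputable def mcStep (t : List (α × KR g)) (a : α) : List (α × KR g) :=
  if h : krStep g (pathEnd (krRoot g) t) a ∈ pathVerts (krRoot g) t then
    (mem_pathVerts_iff.1 h).choose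
  else t ++ [(a, krStep g (pathEnd (krRoot g) t) a)]

variable {g}

theorem mcStep_of_notMem {t : List (α × KR g)} {a : α}
    (h : krStep g (pathEnd (krRoot g) t) a ∉ pathVerts (krRoot g) t) :
    mcStep g t a = t ++ [(a, krStep g (pathEnd (krRoot g) t) a)] := dif_neg h

theorem mcStep_of_mem {t : List (α × KR g)} {a : α}
    (h : krStep g (pathEnd (krRoot g) t) a ∈ pathVerts (krRoot g) t) :
    mcStep g t a <+: t ∧
      pathEnd (krRoot g) (mcStep g t a) = krStep g (pathEnd (krRoot g) t) a := by
  obtain ⟨s, h₁, h₂⟩ := (mem_pathVerts_iff.1 h).choose_spec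
  rw [mcStep, dif_pos h]
  exact ⟨⟨s, h₁.symm⟩, h₂⟩

theorem pathEnd_mcStep (t : List (α × KR g)) (a : α) :
    pathEnd (krRoot g) (mcStep g t a) = krStep g (pathEnd (krRoot g) t) a := by
  by_cases h : krStep g (pathEnd (krRoot g) t) a ∈ pathVerts (krRoot g) t
  · exact (mcStep_of_mem h).2
  · rw [mcStep_of_notMem h, pathEnd_concat]

/-- Determinism: on a simple path there is only one initial segment with a prescribed endpoint. -/
theorem mem_mcEdges_krEdges_iff {t t' : List (α × KR g)} (ht : t ∈ mcVerts g) {a : α} :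
    (t, a, t') ∈ mcEdges (krEdges g) (krRoot g) ↔ t' = mcStep g t a := by
  constructor
  · rintro ⟨-, v, hv, ⟨h₁, h₂⟩ | ⟨h₁, ⟨s, h₂⟩, h₃⟩⟩ <;> rw [mem_krEdges_iff] at hv <;>
      dsimp only at *
    · rw [hv] at h₁ h₂
      rw [mcStep_of_notMem h₁, h₂]
    · rw [hv] at h₁ h₃
      obtain ⟨⟨s', h₄⟩, h₅⟩ := mcStep_of_mem h₁
      exact eq_of_pathEnd_eq_of_nodup ht.2 h₂.symm h₄.symm (h₃.trans h₅.symm)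
  · rintro rfl
    refine ⟨ht, _, (mem_krEdges_iff g).2 rfl, ?_⟩
    by_cases h : krStep g (pathEnd (krRoot g) t) a ∈ pathVerts (krRoot g) t
    · exact .inr ⟨h, mcStep_of_mem h⟩
    · exact .inl ⟨h, mcStep_of_notMem h⟩

theorem nil_mem_mcVerts : [] ∈ mcVerts g := IsSimplePath.nil

theorem mcStep_mem {t : List (α × KR g)} (ht : t ∈ mcVerts g) (a : α) :
    mcStep g t a ∈ mcVerts g :=
  mcEdges_target ((mem_mcEdges_krEdges_iff ht (a := a)).2 rfl)

theorem mcVal_mcStep (t : List (α × KR g)) (a : α) :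
    mcVal g (mcStep g t a) = mcVal g t * (g a : WithOne S) := by
  rw [mcVal, pathEnd_mcStep, krVal_krStep, mcVal]

variable (g) in
/-- The vertex of the McCammond expansion to which a word leads. -/
noncomputable def mcRun (u : List α) : List (α × KR g) := u.foldl (mcStep g) []

theorem mcRun_concat (u : List α) (a : α) : mcRun g (u ++ [a]) = mcStep g (mcRun g u) a := by
  simp [mcRun]

theorem mcRun_mem (u : List α) : mcRun g u ∈ mcVerts g := by
  induction u using List.reverseRecOn with
  | nil => exact nil_mem_mcVerts
  | append_singleton u a ih => rw [mcRun_concat]; exact mcStep_mem ih a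

theorem mcVal_mcRun (u : List α) : mcVal g (mcRun g u) = wordVal g u := by
  induction u using List.reverseRecOn with
  | nil => rfl
  | append_singleton u a ih => rw [mcRun_concat, mcVal_mcStep, ih, wordVal_concat]

theorem mcRun_map_fst {t : List (α × KR g)} (ht : t ∈ mcVerts g) :
    mcRun g (t.map Prod.fst) = t := by
  induction t using List.reverseRecOn with
  | nil => rfl
  | append_singleton t e ih =>
    obtain ⟨a, v⟩ := e
    obtain ⟨ht, he, hv⟩ := isSimplePath_concat.1 ht
    rw [mem_krEdges_iff] at he
    rw [List.map_append, List.map_cons, List.map_nil, mcRun_concat, ih ht,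
      mcStep_of_notMem (he ▸ hv), he]

theorem wordVal_map_fst {t : List (α × KR g)} (ht : t ∈ mcVerts g) :
    wordVal g (t.map Prod.fst) = mcVal g t := by
  rw [← mcVal_mcRun, mcRun_map_fst ht]

theorem inK_of_prefix {s t : List (α × KR g)} (ht : t ∈ mcVerts g) (h : s <+: t)
    (hs : InK (mcVal g s)) : InK (mcVal g t) := by
  have hs' : s ∈ mcVerts g := isSimplePath_of_prefix h ht
  obtain ⟨r, rfl⟩ := h
  rw [← wordVal_map_fst ht, List.map_append, wordVal_append, wordVal_map_fst hs']
  exact hs.mul_right _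

variable (g) in
/-- The words with value in `K(S)` that have no proper initial segment with value in `K(S)`. -/
def semaphoreCode : Set (List α) :=
  {u | ∃ u' a, u = u' ++ [a] ∧ ¬ InK (wordVal g u') ∧ InK (wordVal g u)}

theorem mem_mcKR_iff {t t' : List (α × KR g)} (ht : t ∈ mcVerts g) {a : α} :
    (t, a, t') ∈ mcKR g ↔ t' = mcStep g t a ∧ ¬ InK (mcVal g t) :=
  and_congr_left' (mem_mcEdges_krEdges_iff ht)

theorem mcKR_subset : mcKR g ⊆ mcEdges (krEdges g) (krRoot g) := fun _ h => h.1

theorem isPath_autoPath_of_not_inK {u : List α} (hu : ¬ InK (wordVal g u)) :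
    IsPath (mcKR g) [] (autoPath (mcStep g) [] u) := by
  induction u using List.reverseRecOn with
  | nil => exact isPath_nil
  | append_singleton u a ih =>
    have hu' : ¬ InK (wordVal g u) := fun h => hu (by
      rw [wordVal_concat]; exact h.mul_right _)
    rw [autoPath_concat, isPath_concat, pathEnd_autoPath]
    refine ⟨ih hu', (mem_mcKR_iff (mcRun_mem u)).2 ⟨rfl, ?_⟩⟩
    rwa [mcVal_mcRun]

/-- Only the sources of edges are restricted in `Γ(S, A)`, so the last letter may enter `K(S)`. As
`K(S)` is an ideal, a word outside it has no initial segment inside it. -/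
theorem isPath_autoPath_concat_iff {u : List α} {a : α} :
    IsPath (mcKR g) [] (autoPath (mcStep g) [] (u ++ [a])) ↔ ¬ InK (wordVal g u) := by
  constructor
  · intro h
    rw [autoPath_concat, isPath_concat, pathEnd_autoPath] at h
    have := ((mem_mcKR_iff (mcRun_mem u)).1 h.2).2
    rwa [mcVal_mcRun] at this
  · intro h
    rw [autoPath_concat, isPath_concat, pathEnd_autoPath]
    refine ⟨isPath_autoPath_of_not_inK h, (mem_mcKR_iff (mcRun_mem u)).2 ⟨rfl, ?_⟩⟩
    rwa [mcVal_mcRun]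

theorem IsPath.eq_autoPath_mcStep {p : List (α × List (α × KR g))} (hp : IsPath (mcKR g) [] p) :
    p = autoPath (mcStep g) [] (p.map Prod.fst) :=
  hp.eq_autoPath fun q _ _ h => (mem_mcEdges_krEdges_iff (t := q) h.1.1).1 h.1

/-- The paths in the graph `Γ(S, A)` from the root to a vertex over `K(S)` correspond to words. -/
noncomputable def pathsEquivWords {t : List (α × KR g)} (ht : InK (mcVal g t)) :
    {p | IsPath (mcKR g) [] p ∧ pathEnd [] p = t} ≃
      {u | u ∈ semaphoreCode g ∧ mcRun g u = t} where
  toFun p := ⟨p.1.map Prod.fst, by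
    obtain ⟨p, hp, he⟩ := p
    have hpe := hp.eq_autoPath_mcStep
    have hrun : mcRun g (p.map Prod.fst) = t := by
      rw [mcRun, ← pathEnd_autoPath, ← hpe, he]
    refine ⟨?_, hrun⟩
    have hval : wordVal g (p.map Prod.fst) = mcVal g t := by rw [← mcVal_mcRun, hrun]
    rcases List.eq_nil_or_concat' (p.map Prod.fst) with h | ⟨u, a, h⟩
    · rw [h] at hval
      rw [← hval] at ht
      exact absurd ht not_inK_one
    · refine ⟨u, a, h, ?_, hval ▸ ht⟩
      rw [hpe, h] at hp
      exact isPath_autoPath_concat_iff.1 hp⟩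
  invFun u := ⟨autoPath (mcStep g) [] u.1, by
    obtain ⟨_, ⟨u, a, rfl, hu, -⟩, hr⟩ := u
    exact ⟨isPath_autoPath_concat_iff.2 hu, (pathEnd_autoPath _ _ _).trans hr⟩⟩
  left_inv p := Subtype.ext p.2.1.eq_autoPath_mcStep.symm
  right_inv u := Subtype.ext (map_fst_autoPath _ _ _)

theorem pathWeight_eq_wordWeight {W : Type*} (x : α → ℝ) (p : List (α × W)) :
    pathWeight x p = wordWeight x (p.map Prod.fst) := by
  simp [pathWeight, wordWeight, Function.comp_def]

theorem finite_mcVerts [Finite S] [Finite α] : (mcVerts g).Finite :=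
  have := finite_kr g
  finite_isSimplePath

theorem finite_mcKR [Finite S] [Finite α] : (mcKR g).Finite :=
  have := finite_kr g
  finite_mcEdges.subset mcKR_subset

theorem uniqueSimplePaths_mcKR : UniqueSimplePaths (mcKR g) [] :=
  uniqueSimplePaths_mcEdges.mono mcKR_subset

theorem noEdgeInto_mcKR : NoEdgeInto (mcKR g) [] :=
  fun w a h => noEdgeInto_mcEdges (noEdgeInto_krEdges g) w a (mcKR_subset h)

/-- The tree path could only fail at a proper initial segment over `K(S)`. There all letters act as
loops when `K(S)` is left zero, so the next vertex of `t` would be a repetition. -/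
theorem isSimplePath_treePath (hK : IsLeftZero (minimalIdeal S)) {t : List (α × KR g)}
    (ht : t ∈ mcVerts g) : IsSimplePath (mcKR g) [] (treePath t) := by
  refine ⟨?_, nodup_pathVerts_treePath t⟩
  induction t using List.reverseRecOn with
  | nil => exact isPath_nil
  | append_singleton t e ih =>
    obtain ⟨a, v⟩ := e
    obtain ⟨ht, he, hv⟩ := isSimplePath_concat.1 ht
    rw [mem_krEdges_iff] at he
    rw [treePath_concat, isPath_concat, pathEnd_treePath]
    refine ⟨ih ht, (mem_mcKR_iff ht).2 ⟨?_, fun h => hv ?_⟩⟩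
    · rw [mcStep_of_notMem (he ▸ hv), he]
    · rw [he, krStep_of_inK g hK h]
      exact pathEnd_mem_pathVerts _ _

theorem treePath_ne_nil {t : List (α × KR g)} (h : InK (mcVal g t)) : treePath t ≠ [] := by
  rcases List.eq_nil_or_concat' t with rfl | ⟨t, e, rfl⟩
  · exact absurd h not_inK_one
  · simp [treePath_concat]

variable [Finite S] [Finite α]

theorem isLoopGraph_pictKR (hK : IsLeftZero (minimalIdeal S)) {t : List (α × KR g)}
    (ht : t ∈ mcVerts g) (hv : InK (mcVal g t)) : IsLoopGraph (pictKR g t) :=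
  isLoopGraph_pict finite_mcKR uniqueSimplePaths_mcKR (isSimplePath_treePath hK ht)
    (treePath_ne_nil hv)

theorem normalDist_pictKR (hK : IsLeftZero (minimalIdeal S)) {t : List (α × KR g)}
    (ht : t ∈ mcVerts g) (hv : InK (mcVal g t)) (x : α → ℝ) :
    normalDist (pictKR g t) x = wordSum {u | u ∈ semaphoreCode g ∧ mcRun g u = t} x := by
  rw [pictKR, normalDist_pict finite_mcKR uniqueSimplePaths_mcKR noEdgeInto_mcKR
    (isSimplePath_treePath hK ht) (treePath_ne_nil hv), pathEnd_treePath, wordSum,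
    ← (pathsEquivWords hv).tsum_eq]
  exact tsum_congr fun p => pathWeight_eq_wordWeight x p.1

theorem normalSummable_pictKR_iff (hK : IsLeftZero (minimalIdeal S)) {t : List (α × KR g)}
    (ht : t ∈ mcVerts g) (hv : InK (mcVal g t)) (x : α → ℝ) :
    NormalSummable (pictKR g t) x ↔
      WordSummable {u | u ∈ semaphoreCode g ∧ mcRun g u = t} x := by
  rw [pictKR, normalSummable_pict_iff finite_mcKR uniqueSimplePaths_mcKR noEdgeInto_mcKR
    (isSimplePath_treePath hK ht) (treePath_ne_nil hv), pathEnd_treePath, WordSummable,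
    ← (pathsEquivWords hv).summable_iff]
  exact summable_congr fun p => pathWeight_eq_wordWeight x p.1

end McRun

/-! ### Adjoining a zero -/

section Box

variable {S : Type*}

/-- The embedding of `S` with an adjoined identity into `S ∪ {□}` with an adjoined identity. -/
def boxEmb : WithOne S → WithOne (WithZero S) :=
  WithOne.recOneCoe 1 fun s => WithOne.coe (WithZero.coe s)

theorem boxEmb_injective : Function.Injective (boxEmb (S := S)) := by
  intro s t h
  induction s using WithOne.recOneCoe with
  | one =>
    induction t using WithOne.recOneCoe with
    | one => rfl
    | coe t => exact absurd h.symm WithOne.coe_ne_one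
  | coe s =>
    induction t using WithOne.recOneCoe with
    | one => exact absurd h WithOne.coe_ne_one
    | coe t => exact congrArg _ (WithZero.coe_inj.1 (WithOne.coe_inj.1 h))

variable [Semigroup S] {α : Type*} (g : α → S)

theorem not_inK_boxEmb (s : WithOne S) : ¬ InK (boxEmb s) := by
  induction s using WithOne.recOneCoe with
  | one => exact not_inK_one
  | coe s =>
    intro h
    have := inK_coe.1 h
    rw [minimalIdeal_withZero] at this
    exact WithZero.coe_ne_zero this

theorem boxEmb_mul_coe (s : WithOne S) (t : S) :
    boxEmb (s * (t : WithOne S)) = boxEmb s * WithOne.coe (WithZero.coe t) := by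
  induction s using WithOne.recOneCoe with
  | one => rw [one_mul]; exact (one_mul _).symm
  | coe s => rfl

theorem wordVal_boxGen_map (u : List α) : wordVal (boxGen g) (u.map some) = boxEmb (wordVal g u) := by
  induction u using List.reverseRecOn with
  | nil => rfl
  | append_singleton u a ih =>
    rw [List.map_append, List.map_cons, List.map_nil, wordVal_concat, ih, wordVal_concat,
      boxEmb_mul_coe]
    rfl

theorem inK_coe_zero : InK (WithOne.coe (0 : WithZero S)) :=
  inK_coe.2 (by rw [minimalIdeal_withZero]; rfl)

theorem inK_wordVal_boxGen_concat (u : List (Option α)) :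
    InK (wordVal (boxGen g) (u ++ [none])) := by
  rw [wordVal_concat]
  exact inK_coe_zero.mul_left _

variable {g}

theorem exists_map_some_of_not_inK {u : List (Option α)} (h : ¬ InK (wordVal (boxGen g) u)) :
    ∃ U : List α, u = U.map some := by
  induction u using List.reverseRecOn with
  | nil => exact ⟨[], rfl⟩
  | append_singleton u o ih =>
    obtain ⟨U, rfl⟩ := ih fun h' => h (by rw [wordVal_concat]; exact h'.mul_right _)
    cases o with
    | none => exact absurd (inK_wordVal_boxGen_concat g _) h
    | some a => exact ⟨U ++ [a], by simp⟩

/-- The minimal ideal of `S ∪ {□}` is `{□}`, and a word enters it with its first letter `□`. -/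
theorem mem_semaphoreCode_boxGen {u : List (Option α)} :
    u ∈ semaphoreCode (boxGen g) ↔ ∃ U : List α, u = U.map some ++ [none] := by
  constructor
  · rintro ⟨u, o, rfl, h, h'⟩
    obtain ⟨U, rfl⟩ := exists_map_some_of_not_inK h
    cases o with
    | none => exact ⟨U, rfl⟩
    | some a =>
      have : U.map some ++ [some a] = (U ++ [a]).map some := by simp
      rw [this, wordVal_boxGen_map] at h'
      exact absurd h' (not_inK_boxEmb _)
  · rintro ⟨U, rfl⟩
    refine ⟨U.map some, none, rfl, ?_, inK_wordVal_boxGen_concat g _⟩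
    rw [wordVal_boxGen_map]
    exact not_inK_boxEmb _

/-- The letter `□` leads to the value zero, which no initial segment of `t` has; so it always opens
a new vertex of the tree. -/
theorem mcStep_none {t : List (Option α × KR (boxGen g))} (ht : t ∈ mcVerts (boxGen g))
    (h : ¬ InK (mcVal (boxGen g) t)) :
    mcStep (boxGen g) t none = t ++ [(none, krStep (boxGen g) (pathEnd (krRoot _) t) none)] := by
  refine mcStep_of_notMem fun hmem => h ?_
  obtain ⟨s, r, hs, he⟩ := mem_pathVerts_iff.1 hmem
  refine inK_of_prefix ht ⟨r, hs.symm⟩ ?_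
  rw [mcVal, he, krVal_krStep]
  exact inK_coe_zero.mul_left _

theorem mcRun_box (U : List α) :
    ∃ v, mcRun (boxGen g) (U.map some ++ [none]) =
      mcRun (boxGen g) (U.map some) ++ [(none, v)] := by
  rw [mcRun_concat, mcStep_none (mcRun_mem _)]
  · exact ⟨_, rfl⟩
  · rw [mcVal_mcRun, wordVal_boxGen_map]
    exact not_inK_boxEmb _

theorem wordVal_eq_of_mcRun_eq {U U' : List α}
    (h : mcRun (boxGen g) (U.map some) = mcRun (boxGen g) (U'.map some)) :
    wordVal g U = wordVal g U' := by
  have := congrArg (mcVal (boxGen g)) h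
  rw [mcVal_mcRun, mcVal_mcRun, wordVal_boxGen_map, wordVal_boxGen_map] at this
  exact boxEmb_injective this

theorem inK_of_mem_boxTreeOver {w : S} {t : List (Option α × KR (boxGen g))}
    (ht : t ∈ boxTreeOver g w) : InK (mcVal (boxGen g) t) := by
  obtain ⟨ht, u, hu, -⟩ := ht
  rw [← wordVal_map_fst ht, hu]
  exact inK_wordVal_boxGen_concat g _

/-- The vertices in `boxTreeOver g w` are the endpoints of the words `U □` with `[U]_S = w`. -/
theorem mem_boxTreeOver_iff {w : S} {t : List (Option α × KR (boxGen g))} :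
    t ∈ boxTreeOver g w ↔ ∃ U : List α, wordVal g U = (w : WithOne S) ∧
      t = mcRun (boxGen g) (U.map some ++ [none]) := by
  constructor
  · rintro ⟨ht, U, hU, hw⟩
    exact ⟨U, hw, by rw [← hU, mcRun_map_fst ht]⟩
  · rintro ⟨U, hw, rfl⟩
    refine ⟨mcRun_mem _, ?_⟩
    obtain ⟨v, hv⟩ := mcRun_box (g := g) U
    have hval : wordVal (boxGen g) ((mcRun (boxGen g) (U.map some)).map Prod.fst) =
        boxEmb (w : WithOne S) := by
      rw [wordVal_map_fst (mcRun_mem _), mcVal_mcRun, wordVal_boxGen_map, hw]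
    obtain ⟨U', hU'⟩ := exists_map_some_of_not_inK (hval ▸ not_inK_boxEmb _)
    refine ⟨U', by rw [hv, List.map_append, hU']; rfl, ?_⟩
    rw [hU', wordVal_boxGen_map] at hval
    exact boxEmb_injective hval

/-- In `S ∪ {□}` the letter `□` erases the value of `U`, but in the expansion removing the last edge
recovers the vertex that `U` leads to, and with it `[U]_S`. -/
theorem mcRun_box_mem_boxTreeOver_iff {w : S} {U : List α} :
    mcRun (boxGen g) (U.map some ++ [none]) ∈ boxTreeOver g w ↔
      wordVal g U = (w : WithOne S) := by
  rw [mem_boxTreeOver_iff]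
  constructor
  · rintro ⟨U', hU', h⟩
    obtain ⟨v, hv⟩ := mcRun_box (g := g) U
    obtain ⟨v', hv'⟩ := mcRun_box (g := g) U'
    rw [hv, hv'] at h
    rw [← hU']
    exact wordVal_eq_of_mcRun_eq (List.append_inj_left' h rfl)
  · exact fun h => ⟨U, h, rfl⟩

theorem mcRun_box_eq_iff {U U' : List α} :
    mcRun (boxGen g) (U.map some ++ [none]) = mcRun (boxGen g) (U'.map some ++ [none]) ↔
      mcRun (boxGen g) (U.map some) = mcRun (boxGen g) (U'.map some) := by
  constructor
  · intro h
    obtain ⟨v, hv⟩ := mcRun_box (g := g) U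
    obtain ⟨v', hv'⟩ := mcRun_box (g := g) U'
    rw [hv, hv'] at h
    exact List.append_inj_left' h rfl
  · intro h
    rw [mcRun_concat, mcRun_concat, h]

/-- Words that end in `□`. -/
theorem wordSum_box (P : List (Option α) → Prop) (y : Option α → ℝ) :
    wordSum {u | u ∈ semaphoreCode (boxGen g) ∧ P u} y =
      y none * wordSum {U | P (U.map some ++ [none])} (fun a => y (some a)) := by
  let e : {U : List α | P (U.map some ++ [none])} ≃
      {u | u ∈ semaphoreCode (boxGen g) ∧ P u} :=
    Equiv.ofBijective (fun U => ⟨U.1.map some ++ [none], mem_semaphoreCode_boxGen.2 ⟨U.1, rfl⟩, U.2⟩)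
      ⟨fun U U' h => Subtype.ext (List.map_injective_iff.2 (Option.some_injective α)
        (List.append_inj_left' (congrArg Subtype.val h) rfl)), by
      rintro ⟨u, hu, hP⟩
      obtain ⟨U, rfl⟩ := mem_semaphoreCode_boxGen.1 hu
      exact ⟨⟨U, hP⟩, rfl⟩⟩
  rw [wordSum, wordSum, ← tsum_mul_left, ← e.tsum_eq]
  refine tsum_congr fun U => ?_
  change wordWeight y (U.1.map some ++ [none]) = _
  rw [wordWeight_concat, mul_comm, wordWeight, List.map_map]
  rfl

end Box

/-! ### Sums over words -/

section WordSeries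

variable {α : Type*} [Fintype α]

/-- The words of length `n` have total weight `(∑ z a) ^ n`; sum the geometric series. -/
theorem hasSum_wordWeight {z : α → ℝ} (hz : ∀ a, 0 ≤ z a) (h1 : ∑ a, z a < 1) :
    HasSum (wordWeight z) (1 - ∑ a, z a)⁻¹ := by
  have key : ∀ n, HasSum (fun f : Fin n → α => wordWeight z (List.ofFn f)) ((∑ a, z a) ^ n) := by
    intro n
    have : (∑ a, z a) ^ n = ∑ f : Fin n → α, wordWeight z (List.ofFn f) := by
      rw [Fintype.sum_pow]
      refine Finset.sum_congr rfl fun f _ => ?_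
      rw [wordWeight, List.map_ofFn, List.prod_ofFn]
      rfl
    rw [this]
    exact hasSum_fintype _
  have hs : 0 ≤ ∑ a, z a := Finset.sum_nonneg fun a _ => hz a
  have hsum : Summable fun i : Σ n, Fin n → α => wordWeight z (List.ofFn i.2) := by
    rw [summable_sigma_of_nonneg fun i => wordWeight_nonneg hz _]
    refine ⟨fun n => (key n).summable, ?_⟩
    simp_rw [fun n => (key n).tsum_eq]
    exact summable_geometric_of_lt_one hs h1
  have h2 : HasSum (fun i : Σ n, Fin n → α => wordWeight z (List.ofFn i.2))
      (1 - ∑ a, z a)⁻¹ := by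
    have h3 := hsum.hasSum
    rwa [(h3.sigma key).unique (hasSum_geometric_of_lt_one hs h1)] at h3
  exact (List.equivSigmaTuple.symm.hasSum_iff (f := wordWeight z)).1 h2

theorem wordSummable_of_sum_lt_one {z : α → ℝ} (hz : ∀ a, 0 ≤ z a) (h1 : ∑ a, z a < 1)
    (L : Set (List α)) : WordSummable L z :=
  (hasSum_wordWeight hz h1).summable.subtype L

theorem tsum_list_cons {f : List α → ℝ} (hf : Summable f) :
    ∑' u, f u = f [] + ∑ a, ∑' u, f (a :: u) := by
  let e : α × List α ≃ ({[]}ᶜ : Set (List α)) :=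
    Equiv.ofBijective (fun i => ⟨i.1 :: i.2, by simp⟩)
      ⟨fun i j h => by
        have := congrArg Subtype.val h
        simp only [List.cons.injEq] at this
        exact Prod.ext this.1 this.2, by
      rintro ⟨_ | ⟨a, u⟩, hu⟩
      · exact absurd rfl hu
      · exact ⟨(a, u), rfl⟩⟩
  have h2 : Summable fun i : α × List α => f (i.1 :: i.2) :=
    e.summable_iff.2 (hf.subtype ({[]}ᶜ : Set (List α)))
  rw [← hf.tsum_subtype_add_tsum_subtype_compl {[]}, tsum_singleton [] f, ← e.tsum_eq]
  congr 1
  exact h2.tsum_prod.trans (tsum_fintype _)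

theorem tsum_list_concat {f : List α → ℝ} (hf : Summable f) :
    ∑' u, f u = f [] + ∑ a, ∑' u, f (u ++ [a]) := by
  let e : List α ≃ List α := ⟨List.reverse, List.reverse, List.reverse_reverse, List.reverse_reverse⟩
  have h1 : Summable fun u => f (e u) := e.summable_iff.2 hf
  rw [← e.tsum_eq, tsum_list_cons h1]
  congr 1
  refine Finset.sum_congr rfl fun a _ => ?_
  rw [← e.tsum_eq fun u => f (u ++ [a])]
  refine tsum_congr fun u => ?_
  simp [e]

/-- Removing the last letter gives the linear equations of an automaton; the counterpart
`wordSum_cons`, for the first letter, gives the stationarity equation of the left walk. -/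
theorem wordSum_concat {z : α → ℝ} {L : Set (List α)} (h : WordSummable L z) :
    wordSum L z = (if [] ∈ L then 1 else 0) + ∑ a, z a * wordSum {u | u ++ [a] ∈ L} z := by
  rw [wordSum_eq_tsum_indicator, tsum_list_concat (wordSummable_iff_indicator.1 h)]
  congr 1
  refine Finset.sum_congr rfl fun a _ => ?_
  rw [wordSum_eq_tsum_indicator, ← tsum_mul_left]
  refine tsum_congr fun u => ?_
  simp only [Set.indicator, Set.mem_ofPred_eq, wordWeight_concat, mul_ite, mul_zero, mul_comm]

theorem wordSum_cons {z : α → ℝ} {L : Set (List α)} (h : WordSummable L z) :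
    wordSum L z = (if [] ∈ L then 1 else 0) + ∑ a, z a * wordSum {u | a :: u ∈ L} z := by
  rw [wordSum_eq_tsum_indicator, tsum_list_cons (wordSummable_iff_indicator.1 h)]
  congr 1
  refine Finset.sum_congr rfl fun a _ => ?_
  rw [wordSum_eq_tsum_indicator, ← tsum_mul_left]
  refine tsum_congr fun u => ?_
  simp only [Set.indicator, Set.mem_ofPred_eq, wordWeight_cons, mul_ite, mul_zero]

end WordSeries

/-! ### Chains driven by automata -/

section Chains

variable {Ω : Type*}

/-- The transition matrix of the chain that moves from `q` to `δ q a` with weight `x a`. -/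
noncomputable def autoMatrix {α : Type*} [Fintype α] (δ : Ω → α → Ω) (x : α → ℝ) : Matrix Ω Ω ℝ :=
  fun q' q => ∑ a, if δ q a = q' then x a else 0

theorem autoMatrix_nonneg {α : Type*} [Fintype α] {δ : Ω → α → Ω} {x : α → ℝ}
    (hx : ∀ a, 0 ≤ x a) (q' q : Ω) : 0 ≤ autoMatrix δ x q' q :=
  Finset.sum_nonneg fun a _ => by split_ifs; exacts [hx a, le_rfl]

theorem autoMatrix_eq_zero {α : Type*} [Fintype α] {δ : Ω → α → Ω} {x : α → ℝ} {q' q : Ω}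
    (h : ∀ a, δ q a ≠ q') : autoMatrix δ x q' q = 0 :=
  Finset.sum_eq_zero fun a _ => if_neg (h a)

variable [Fintype Ω]

/-- A fixed vector of an irreducible chain is zero if its entries sum up to zero. -/
theorem eq_zero_of_mulVec_eq {T : Matrix Ω Ω ℝ} (h0 : ∀ i j, 0 ≤ T i j)
    (h1 : ∀ j, ∑ i, T i j = 1) (hT : IsIrreducibleChain T) {d : Ω → ℝ} (hd : T.mulVec d = d)
    (hs : ∑ i, d i = 0) : d = 0 := by
  have hsum : ∀ v : Ω → ℝ, ∑ i, T.mulVec v i = ∑ i, v i := by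
    intro v
    simp only [Matrix.mulVec, dotProduct]
    rw [Finset.sum_comm]
    refine Finset.sum_congr rfl fun j _ => ?_
    rw [← Finset.sum_mul, h1, one_mul]
  have hle : ∀ i, |d i| ≤ T.mulVec (fun j => |d j|) i := by
    intro i
    conv_lhs => rw [← hd]
    simp only [Matrix.mulVec, dotProduct]
    refine (Finset.abs_sum_le_sum_abs _ _).trans (Finset.sum_le_sum fun j _ => ?_)
    rw [abs_mul, abs_of_nonneg (h0 i j)]
  -- `|d| ≤ T|d|` entrywise and both sides have the same sum, so they agree.
  have habs : T.mulVec (fun j => |d j|) = fun j => |d j| := by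
    funext i
    exact ((Finset.sum_eq_sum_iff_of_le fun i _ => hle i).1 (hsum _).symm i
      (Finset.mem_univ i)).symm
  -- The fixed vector `|d| + d` is nonnegative and positive exactly where `d > 0`. If it is positive
  -- somewhere, irreducibility makes it positive everywhere, and then `d` cannot have sum zero.
  -- Hence `d ≤ 0`, and the zero sum forces `d = 0`.
  set e : Ω → ℝ := (fun j => |d j|) + d with he
  have hTe : T.mulVec e = e := by rw [he, Matrix.mulVec_add, habs, hd]
  have hTm : ∀ m : ℕ, (T ^ m).mulVec e = e := by
    intro m
    induction m with
    | zero => simp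
    | succ m ih => rw [pow_succ, ← Matrix.mulVec_mulVec, hTe, ih]
  have hTm0 : ∀ (m : ℕ) i j, 0 ≤ (T ^ m) i j := by
    intro m
    induction m with
    | zero =>
      intro i j
      rw [pow_zero, Matrix.one_apply]
      split_ifs <;> norm_num
    | succ m ih =>
      intro i j
      rw [pow_succ, Matrix.mul_apply]
      exact Finset.sum_nonneg fun k _ => mul_nonneg (ih i k) (h0 k j)
  have he0 : ∀ i, 0 ≤ e i := fun i => by
    have := neg_abs_le (d i)
    simp only [he, Pi.add_apply]
    linarith
  have hd0 : ∀ i, d i ≤ 0 := by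
    by_contra! hpos
    obtain ⟨i, hi⟩ := hpos
    have hei : 0 < e i := by
      simp only [he, Pi.add_apply]
      positivity
    have hall : ∀ j, 0 < d j := by
      intro j
      obtain ⟨m, hm⟩ := hT i j
      have hj : 0 < e j := by
        rw [← hTm m]
        exact (mul_pos hm hei).trans_le (Finset.single_le_sum (f := fun k => (T ^ m) j k * e k)
          (fun k _ => mul_nonneg (hTm0 m j k) (he0 k)) (Finset.mem_univ i))
      by_contra! hneg
      simp only [he, Pi.add_apply, abs_of_nonpos hneg] at hj
      linarith
    have : 0 < ∑ j, d j := Finset.sum_pos (fun j _ => hall j) ⟨i, Finset.mem_univ i⟩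
    linarith
  funext i
  exact (Finset.sum_eq_zero_iff_of_nonpos fun i _ => hd0 i).1 hs i (Finset.mem_univ i)

/-- An irreducible chain has at most one stationary distribution. -/
theorem IsStationaryDist.unique {T : Matrix Ω Ω ℝ} (h0 : ∀ i j, 0 ≤ T i j)
    (h1 : ∀ j, ∑ i, T i j = 1) (hT : IsIrreducibleChain T) {Φ Ψ : Ω → ℝ}
    (hΦ : IsStationaryDist T Φ) (hΨ : IsStationaryDist T Ψ) : Φ = Ψ := by
  refine sub_eq_zero.1 (eq_zero_of_mulVec_eq h0 h1 hT ?_ ?_)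
  · rw [Matrix.mulVec_sub, hΦ.2.2, hΨ.2.2]
  · simp only [Pi.sub_apply, Finset.sum_sub_distrib, hΦ.2.1, hΨ.2.1, sub_self]

variable {α : Type*} [Fintype α] {δ : Ω → α → Ω} {x : α → ℝ}

theorem sum_mul_autoMatrix (v : Ω → ℝ) (q : Ω) :
    ∑ q', v q' * autoMatrix δ x q' q = ∑ a, x a * v (δ q a) := by
  simp only [autoMatrix, Finset.mul_sum]
  rw [Finset.sum_comm]
  refine Finset.sum_congr rfl fun a _ => ?_
  simp [mul_comm]

theorem autoMatrix_col_sum (q : Ω) : ∑ q', autoMatrix δ x q' q = ∑ a, x a := by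
  simpa using sum_mul_autoMatrix (δ := δ) (x := x) 1 q

theorem autoMatrix_mulVec (v : Ω → ℝ) (q' : Ω) :
    (autoMatrix δ x).mulVec v q' = ∑ a, x a * ∑ q, if δ q a = q' then v q else 0 := by
  simp only [Matrix.mulVec, dotProduct, autoMatrix, Finset.sum_mul, Finset.mul_sum]
  rw [Finset.sum_comm]
  refine Finset.sum_congr rfl fun a _ => Finset.sum_congr rfl fun q _ => ?_
  split_ifs <;> simp

theorem autoMatrix_pow_pos (hx : ∀ a, 0 < x a) (u : List α) (q : Ω) :
    0 < (autoMatrix δ x ^ u.length) (u.foldl δ q) q := by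
  have hnn : ∀ (m : ℕ) i j, 0 ≤ (autoMatrix δ x ^ m) i j := by
    intro m
    induction m with
    | zero =>
      intro i j
      rw [pow_zero, Matrix.one_apply]
      split_ifs <;> norm_num
    | succ m ih =>
      intro i j
      rw [pow_succ, Matrix.mul_apply]
      exact Finset.sum_nonneg fun k _ =>
        mul_nonneg (ih i k) (autoMatrix_nonneg (fun a => (hx a).le) k j)
  induction u generalizing q with
  | nil => simp
  | cons a u ih =>
    rw [List.length_cons, pow_succ, Matrix.mul_apply, List.foldl_cons]
    refine (mul_pos (ih (δ q a)) ?_).trans_le (Finset.single_le_sum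
      (f := fun k => (autoMatrix δ x ^ u.length) (u.foldl δ (δ q a)) k * autoMatrix δ x k q)
      (fun k _ => mul_nonneg (hnn _ _ k) (autoMatrix_nonneg (fun a => (hx a).le) k q))
      (Finset.mem_univ (δ q a)))
    refine (hx a).trans_le ?_
    have := Finset.single_le_sum (f := fun b => if δ q b = δ q a then x b else 0)
      (fun b _ => by split_ifs; exacts [(hx b).le, le_rfl]) (Finset.mem_univ a)
    rw [if_pos rfl] at this
    exact this

theorem isIrreducibleChain_autoMatrix (hx : ∀ a, 0 < x a)
    (h : ∀ q q' : Ω, ∃ u : List α, u.foldl δ q = q') : IsIrreducibleChain (autoMatrix δ x) := by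
  intro q q'
  obtain ⟨u, rfl⟩ := h q q'
  exact ⟨u.length, autoMatrix_pow_pos hx u q⟩

/-- Cramer's rule: wherever the determinant is nonzero, the solution is a continuous function of the
matrix and the right-hand side. -/
theorem tendsto_of_mulVec_eq [DecidableEq Ω] {ι : Type*} {F : Filter ι} {A : ι → Matrix Ω Ω ℝ}
    {A₀ : Matrix Ω Ω ℝ} {b v : ι → Ω → ℝ} {b₀ : Ω → ℝ} (hA : Tendsto A F (𝓝 A₀))
    (hdet : A₀.det ≠ 0) (hb : Tendsto b F (𝓝 b₀)) (hv : ∀ᶠ i in F, (A i).mulVec (v i) = b i) :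
    Tendsto v F (𝓝 (A₀.det⁻¹ • A₀.adjugate.mulVec b₀)) := by
  have hd : Tendsto (fun i => (A i).det) F (𝓝 A₀.det) :=
    (Continuous.matrix_det (A := fun M : Matrix Ω Ω ℝ => M) continuous_id).continuousAt.tendsto.comp hA
  have hadj : Tendsto (fun i => (A i).adjugate) F (𝓝 A₀.adjugate) :=
    (Continuous.matrix_adjugate (A := fun M : Matrix Ω Ω ℝ => M)
      continuous_id).continuousAt.tendsto.comp hA
  have hmul : Tendsto (fun i => (A i).adjugate.mulVec (b i)) F (𝓝 (A₀.adjugate.mulVec b₀)) := by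
    rw [tendsto_pi_nhds] at hb ⊢
    intro q
    refine tendsto_finsetSum _ fun r _ => Tendsto.mul ?_ (hb r)
    exact (Continuous.matrix_elem (A := fun M : Matrix Ω Ω ℝ => M)
      continuous_id q r).continuousAt.tendsto.comp hadj
  refine ((hd.inv₀ hdet).smul hmul).congr' ?_
  filter_upwards [hv, hd.eventually_ne hdet] with i h1 h2
  rw [← h1, Matrix.mulVec_mulVec, Matrix.adjugate_mul, Matrix.smul_mulVec, Matrix.one_mulVec,
    smul_smul, inv_mul_cancel₀ h2, one_smul]

end Chains

/-! ### The states that can be reached from a state -/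

section Reach

variable {α Q : Type*}

/-- The states that can be reached from `q₁`. -/
def reachSet (δ : Q → α → Q) (q₁ : Q) : Set Q := {q | ∃ u : List α, u.foldl δ q₁ = q}

/-- The automaton restricted to the states that can be reached from `q₁`. -/
def reachStep (δ : Q → α → Q) (q₁ : Q) (q : reachSet δ q₁) (a : α) : reachSet δ q₁ :=
  ⟨δ q.1 a, by
    obtain ⟨u, hu⟩ := q.2
    exact ⟨u ++ [a], by simp [hu]⟩⟩

theorem foldl_reachStep (q₁ : Q) (u : List α) (q : reachSet δ q₁) :
    (u.foldl (reachStep δ q₁) q).1 = u.foldl δ q.1 := by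
  induction u generalizing q with
  | nil => rfl
  | cons a u ih => exact ih _

theorem autoMatrix_reachStep [Fintype α] (δ : Q → α → Q) (q₁ : Q) (z : α → ℝ) (q' q : reachSet δ q₁) :
    autoMatrix (reachStep δ q₁) z q' q = autoMatrix δ z q'.1 q.1 := by
  refine Finset.sum_congr rfl fun a _ => ?_
  by_cases h : δ q.1 a = q'.1
  · rw [if_pos h, if_pos (Subtype.ext h)]
  · rw [if_neg h, if_neg fun h' => h (congrArg Subtype.val h')]

end Reach

/-! ### Limits of word sums of automata -/

section AutomatonLimits

variable {α : Type*} [Fintype α]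

theorem openSimplex_some {y : Option α → ℝ} (hy : y ∈ openSimplex (Option α)) :
    (∀ a, 0 < y (some a)) ∧ ∑ a, y (some a) = 1 - y none := by
  refine ⟨fun _ => hy.1 _, ?_⟩
  have := hy.2
  rw [Fintype.sum_option] at this
  linarith

theorem openSimplex_some_lt {y : Option α → ℝ} (hy : y ∈ openSimplex (Option α)) :
    ∑ a, y (some a) < 1 := by
  rw [(openSimplex_some hy).2]
  have := hy.1 none
  linarith

theorem wordSummable_some {y : Option α → ℝ} (hy : y ∈ openSimplex (Option α))
    (L : Set (List α)) : WordSummable L fun a => y (some a) :=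
  wordSummable_of_sum_lt_one (fun _ => (hy.1 _).le) (openSimplex_some_lt hy) L

theorem eventually_mem_openSimplex (x : α → ℝ) :
    ∀ᶠ y in boxLimit x, y ∈ openSimplex (Option α) := self_mem_nhdsWithin

theorem tendsto_boxLimit (x : α → ℝ) (o : Option α) :
    Tendsto (fun y : Option α → ℝ => y o) (boxLimit x) (𝓝 (o.elim 0 x)) :=
  ((continuous_apply o).tendsto _).mono_left nhdsWithin_le_nhds

theorem tendsto_boxLimit_some (x : α → ℝ) :
    Tendsto (fun (y : Option α → ℝ) a => y (some a)) (boxLimit x) (𝓝 x) :=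
  tendsto_pi_nhds.2 fun a => tendsto_boxLimit x (some a)

/-- The point of the open simplex over `A ∪ {□}` with `x_□ = ε`, proportional to `x` on `A`. -/
def boxPoint (x : α → ℝ) (ε : ℝ) : Option α → ℝ := fun o => o.elim ε fun b => (1 - ε) * x b

theorem boxPoint_mem {x : α → ℝ} (hx : x ∈ openSimplex α) {ε : ℝ} (h0 : 0 < ε) (h1 : ε < 1) :
    boxPoint x ε ∈ openSimplex (Option α) := by
  refine ⟨fun o => ?_, ?_⟩
  · cases o with
    | none => exact h0
    | some a => exact mul_pos (by linarith) (hx.1 a)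
  · rw [Fintype.sum_option]
    simp only [boxPoint, Option.elim]
    rw [← Finset.mul_sum, hx.2]
    ring

theorem tendsto_boxPoint {x : α → ℝ} (hx : x ∈ openSimplex α) :
    Tendsto (boxPoint x) (𝓝[>] 0) (boxLimit x) := by
  refine tendsto_nhdsWithin_iff.2 ⟨?_, ?_⟩
  · refine tendsto_pi_nhds.2 fun o => ?_
    have : Continuous fun ε : ℝ => boxPoint x ε o := by
      cases o with
      | none => exact continuous_id
      | some a => exact (continuous_const.sub continuous_id).mul continuous_const
    have h := (this.tendsto 0).mono_left (nhdsWithin_le_nhds (s := Set.Ioi 0))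
    convert h using 2
    cases o <;> simp [boxPoint]
  · filter_upwards [Ioo_mem_nhdsGT (show (0 : ℝ) < 1 by norm_num)] with ε hε
    exact boxPoint_mem hx hε.1 hε.2

theorem neBot_boxLimit {x : α → ℝ} (hx : x ∈ openSimplex α) : (boxLimit x).NeBot :=
  (tendsto_boxPoint hx).neBot

theorem continuous_autoMatrix_apply {Q : Type*} {δ : Q → α → Q} (q' q : Q) :
    Continuous fun z : α → ℝ => autoMatrix δ z q' q := by
  unfold autoMatrix
  refine continuous_finsetSum _ fun a _ => ?_
  split_ifs
  · exact continuous_apply a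
  · exact continuous_const

variable {Q : Type*} (δ : Q → α → Q)

/-- The words that lead from `q₀` to `q`. -/
def autoLang (q₀ q : Q) : Set (List α) := {u | u.foldl δ q₀ = q}

variable [Fintype Q] {δ}

/-- Split off the last letter and sort the remaining words by the state they lead to. -/
theorem wordSum_autoLang {z : α → ℝ} (hz : ∀ a, 0 ≤ z a) (h1 : ∑ a, z a < 1) (q₀ q' : Q) :
    wordSum (autoLang δ q₀ q') z =
      (if q₀ = q' then 1 else 0) +
        ∑ q, autoMatrix δ z q' q * wordSum (autoLang δ q₀ q) z := by
  rw [wordSum_concat (wordSummable_of_sum_lt_one hz h1 _)]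
  congr 1
  have := autoMatrix_mulVec (δ := δ) (x := z) (fun q => wordSum (autoLang δ q₀ q) z) q'
  simp only [Matrix.mulVec, dotProduct] at this
  rw [this]
  refine Finset.sum_congr rfl fun a _ => ?_
  congr 1
  rw [← Finset.sum_filter]
  have hfib := finsum_wordSum_fibre (Set.toFinite {q | δ q a = q'}) (fun u => u.foldl δ q₀)
    (L := Set.univ) (x := z) (wordSummable_of_sum_lt_one hz h1 _)
  simp only [Set.mem_univ, true_and] at hfib
  have h2 : {u | u ++ [a] ∈ autoLang δ q₀ q'} = {u | u.foldl δ q₀ ∈ {q | δ q a = q'}} := by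
    ext u
    simp [autoLang]
  rw [h2, ← hfib, finsum_mem_eq_finite_toFinset_sum _ (Set.toFinite _)]
  refine Finset.sum_congr ?_ fun q _ => rfl
  ext q
  simp

/-- `X` is closed under predecessors, and from each of its states a word leads out of `X`. -/
structure IsTransient (δ : Q → α → Q) (X : Set Q) : Prop where
  back : ∀ q a, δ q a ∈ X → q ∈ X
  exit : ∀ q ∈ X, ∃ u : List α, u.foldl δ q ∉ X

/-- The transition matrix, restricted to the states in `X`. -/
noncomputable def maskMatrix (δ : Q → α → Q) (X : Set Q) (z : α → ℝ) : Matrix Q Q ℝ :=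
  fun q' q => if q' ∈ X ∧ q ∈ X then autoMatrix δ z q' q else 0

/-- Maximum principle. A left null vector `v` vanishes off `X` and is harmonic on `X`, so every
letter leads from a state where `|v|` is maximal to another such state. A word that leaves `X` then
forces the maximum to be zero. -/
theorem det_one_sub_maskMatrix_ne_zero {X : Set Q} (hX : IsTransient δ X) {x : α → ℝ}
    (hx : x ∈ openSimplex α) : (1 - maskMatrix δ X x).det ≠ 0 := by
  intro hdet
  obtain ⟨v, hv0, hv⟩ := Matrix.exists_vecMul_eq_zero_iff.2 hdet
  have hfix : ∀ q, v q = ∑ q', v q' * maskMatrix δ X x q' q := by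
    intro q
    have := congrFun hv q
    rw [Matrix.vecMul_sub, Matrix.vecMul_one] at this
    exact sub_eq_zero.1 this
  have hoff : ∀ q ∉ X, v q = 0 := by
    intro q hq
    rw [hfix]
    exact Finset.sum_eq_zero fun q' _ => by rw [maskMatrix, if_neg (fun h => hq h.2), mul_zero]
  have hon : ∀ q ∈ X, v q = ∑ a, x a * v (δ q a) := by
    intro q hq
    rw [hfix q, ← sum_mul_autoMatrix]
    refine Finset.sum_congr rfl fun q' _ => ?_
    by_cases hq' : q' ∈ X
    · rw [maskMatrix, if_pos ⟨hq', hq⟩]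
    · rw [hoff q' hq', zero_mul, zero_mul]
  obtain ⟨q₀, hq₀⟩ := Function.ne_iff.1 hv0
  obtain ⟨q, -, hmax⟩ := Finset.exists_max_image Finset.univ (fun q => |v q|) ⟨q₀, Finset.mem_univ _⟩
  have hpos : 0 < |v q| := (abs_pos.2 hq₀).trans_le (hmax q₀ (Finset.mem_univ _))
  have hmem : ∀ p, |v p| = |v q| → p ∈ X := by
    intro p hp
    by_contra h
    rw [hoff p h, abs_zero] at hp
    exact hpos.ne hp
  have hstep : ∀ p a, |v p| = |v q| → |v (δ p a)| = |v q| := by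
    intro p a hp
    have h1 : ∑ b, x b * |v q| ≤ ∑ b, x b * |v (δ p b)| := by
      rw [← Finset.sum_mul, hx.2, one_mul, ← hp, hon p (hmem p hp)]
      refine (Finset.abs_sum_le_sum_abs _ _).trans (Finset.sum_le_sum fun b _ => ?_)
      rw [abs_mul, abs_of_pos (hx.1 b)]
    have h2 : ∀ b ∈ Finset.univ, x b * |v (δ p b)| ≤ x b * |v q| := fun b _ =>
      mul_le_mul_of_nonneg_left (hmax _ (Finset.mem_univ _)) (hx.1 b).le
    have h3 := (Finset.sum_eq_sum_iff_of_le h2).1 (le_antisymm (Finset.sum_le_sum h2) h1) a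
      (Finset.mem_univ a)
    exact mul_left_cancel₀ (hx.1 a).ne' h3
  have hword : ∀ (u : List α) p, |v p| = |v q| → |v (u.foldl δ p)| = |v q| := by
    intro u
    induction u with
    | nil => exact fun p hp => hp
    | cons a u ih => exact fun p hp => ih _ (hstep p a hp)
  obtain ⟨u, hu⟩ := hX.exit q (hmem q rfl)
  exact hu (hmem _ (hword u q rfl))

/-- On transient states, the word sums converge. -/
theorem IsTransient.exists_tendsto {X : Set Q} (hX : IsTransient δ X) {x : α → ℝ}
    (hx : x ∈ openSimplex α) (q₀ : Q) {q : Q} (hq : q ∈ X) :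
    ∃ l, Tendsto (fun y : Option α → ℝ => wordSum (autoLang δ q₀ q) fun a => y (some a))
      (boxLimit x) (𝓝 l) := by
  have hA : Continuous fun z : α → ℝ => 1 - maskMatrix δ X z := by
    refine continuous_const.sub (continuous_matrix fun q' q => ?_)
    unfold maskMatrix
    split_ifs
    · exact continuous_autoMatrix_apply q' q
    · exact continuous_const
  -- As `X` is closed under predecessors, the equations for the word sums at states of `X` involve
  -- no other states.
  have key := tendsto_of_mulVec_eq
    (v := fun (y : Option α → ℝ) q => if q ∈ X then wordSum (autoLang δ q₀ q) fun a => y (some a) else 0)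
    (b := fun _ q' => if q' ∈ X then if q₀ = q' then 1 else 0 else 0)
    ((hA.tendsto x).comp (tendsto_boxLimit_some x)) (det_one_sub_maskMatrix_ne_zero hX hx)
    tendsto_const_nhds (by
      filter_upwards [eventually_mem_openSimplex x] with y hy
      funext q'
      change (1 - maskMatrix δ X fun a => y (some a)).mulVec _ q' = _
      rw [Matrix.sub_mulVec, Matrix.one_mulVec, Pi.sub_apply]
      simp only [Matrix.mulVec, dotProduct, maskMatrix]
      by_cases hq' : q' ∈ X
      · simp only [hq', if_true, true_and]
        rw [wordSum_autoLang (fun a => (hy.1 _).le) (openSimplex_some_lt hy), sub_eq_iff_eq_add]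
        congr 1
        refine Finset.sum_congr rfl fun p _ => ?_
        by_cases hp : p ∈ X
        · simp [hp]
        · have : autoMatrix δ (fun a => y (some a)) q' p = 0 := autoMatrix_eq_zero
            fun a h => hp (hX.back p a (h ▸ hq'))
          simp [this]
      · simp [hq'])
  refine ⟨_, (tendsto_pi_nhds.1 key q).congr fun y => ?_⟩
  exact if_pos hq

/-- A state from which one can return from everywhere. -/
def IsRecurrent (δ : Q → α → Q) (q₁ : Q) : Prop :=
  ∀ u : List α, ∃ v : List α, (u ++ v).foldl δ q₁ = q₁

/-- The states that lead to `q₁` form a transient set: from each of them one can pass through `q₁`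
to a state without return. -/
theorem exists_tendsto_of_not_isRecurrent {x : α → ℝ} (hx : x ∈ openSimplex α) (q₀ : Q) {q₁ : Q}
    (hq₁ : ¬ IsRecurrent δ q₁) :
    ∃ l, Tendsto (fun y : Option α → ℝ => wordSum (autoLang δ q₀ q₁) fun a => y (some a))
      (boxLimit x) (𝓝 l) := by
  have hX : IsTransient δ {q | ∃ u : List α, u.foldl δ q = q₁} := by
    refine ⟨fun q a ⟨u, hu⟩ => ⟨a :: u, hu⟩, ?_⟩
    rintro q ⟨u, hu⟩
    unfold IsRecurrent at hq₁
    push Not at hq₁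
    obtain ⟨u', hu'⟩ := hq₁
    refine ⟨u ++ u', ?_⟩
    rintro ⟨v, hv⟩
    refine hu' v ?_
    rwa [List.foldl_append, hu, ← List.foldl_append] at hv
  exact hX.exists_tendsto hx q₀ ⟨[], rfl⟩

theorem tendsto_zero_of_not_isRecurrent {x : α → ℝ} (hx : x ∈ openSimplex α) (q₀ : Q) {q₁ : Q}
    (hq₁ : ¬ IsRecurrent δ q₁) :
    Tendsto (fun y : Option α → ℝ => y none * wordSum (autoLang δ q₀ q₁) fun a => y (some a))
      (boxLimit x) (𝓝 0) := by
  obtain ⟨l, hl⟩ := exists_tendsto_of_not_isRecurrent hx q₀ hq₁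
  simpa using (tendsto_boxLimit x none).mul hl

/-- The states reachable from `q₁` form a closed irreducible class `C`, on which the word sums
satisfy `h = B + T h`, with `B` the inflow from transient states and the empty word. In the limit `1
- T` is singular. The missing equation is conservation of mass, `x_□ ∑ h = ∑ B`, as the columns of
`T` sum to `1 - x_□`. Adding it to the row of `q₁` (the matrix `E`) makes the system for `x_□ h`
nonsingular in the limit. -/
theorem exists_tendsto_of_isRecurrent {x : α → ℝ} (hx : x ∈ openSimplex α) (q₀ : Q) {q₁ : Q}
    (hq₁ : IsRecurrent δ q₁) :
    ∃ l, Tendsto (fun y : Option α → ℝ => y none * wordSum (autoLang δ q₀ q₁) fun a => y (some a))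
      (boxLimit x) (𝓝 l) := by
  set C : Set Q := reachSet δ q₁ with hC
  set δ' : C → α → C := reachStep δ q₁ with hδ'
  set X : Set Q := {q | q ∉ C ∧ ∃ u : List α, u.foldl δ q = q₁} with hXdef
  have hq₁C : q₁ ∈ C := ⟨[], rfl⟩
  have hCstep : ∀ q ∈ C, ∀ a, δ q a ∈ C := fun q hq a => (δ' ⟨q, hq⟩ a).2
  have hCback : ∀ q ∈ C, ∃ u : List α, u.foldl δ q = q₁ := by
    rintro _ ⟨u, rfl⟩
    obtain ⟨v, hv⟩ := hq₁ u
    exact ⟨v, by rw [← List.foldl_append, hv]⟩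
  have hX : IsTransient δ X := by
    refine ⟨fun q a ⟨h, u, hu⟩ => ⟨fun hq => h (hCstep q hq a), a :: u, hu⟩, ?_⟩
    rintro q ⟨-, u, hu⟩
    exact ⟨u, fun h => h.1 (hu ▸ hq₁C)⟩
  have hirr : IsIrreducibleChain (autoMatrix δ' x) := by
    refine isIrreducibleChain_autoMatrix hx.1 ?_
    rintro ⟨q, hq⟩ ⟨_, u, rfl⟩
    obtain ⟨v, hv⟩ := hCback q hq
    refine ⟨v ++ u, Subtype.ext ?_⟩
    rw [hδ', foldl_reachStep, List.foldl_append, hv]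
  -- the flow into `C`
  let B : (Option α → ℝ) → C → ℝ := fun y q' => (if q₀ = q'.1 then 1 else 0) +
    ∑ q, if q ∈ X then autoMatrix δ (fun a => y (some a)) q'.1 q *
      wordSum (autoLang δ q₀ q) (fun a => y (some a)) else 0
  have hB : ∃ B₀, Tendsto B (boxLimit x) (𝓝 B₀) := by
    have : ∀ q : Q, ∃ l, Tendsto (fun y : Option α → ℝ => if q ∈ X then
        wordSum (autoLang δ q₀ q) (fun a => y (some a)) else 0) (boxLimit x) (𝓝 l) := by
      intro q
      by_cases hq : q ∈ X
      · simp only [hq, if_true]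
        exact hX.exists_tendsto hx q₀ hq
      · simp only [hq, if_false]
        exact ⟨0, tendsto_const_nhds⟩
    choose l hl using this
    refine ⟨fun q' => (if q₀ = q'.1 then 1 else 0) + ∑ q, autoMatrix δ x q'.1 q * l q,
      tendsto_pi_nhds.2 fun q' => tendsto_const_nhds.add (tendsto_finsetSum _ fun q _ => ?_)⟩
    refine ((((continuous_autoMatrix_apply q'.1 q).tendsto x).comp
      (tendsto_boxLimit_some x)).mul (hl q)).congr fun y => ?_
    simp only [Function.comp_apply, mul_ite, mul_zero]
  obtain ⟨B₀, hB⟩ := hB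
  -- the equation for the restriction to `C`
  let h : (Option α → ℝ) → C → ℝ := fun y q => wordSum (autoLang δ q₀ q.1) fun a => y (some a)
  have hh : ∀ y ∈ openSimplex (Option α), ∀ q', h y q' =
      B y q' + (autoMatrix δ' fun a => y (some a)).mulVec (h y) q' := by
    intro y hy q'
    simp only [h, B]
    rw [wordSum_autoLang (fun a => (hy.1 _).le) (openSimplex_some_lt hy), add_assoc]
    congr 1
    have hC' : (autoMatrix δ' fun a => y (some a)).mulVec (h y) q' =
        ∑ q, if q ∈ C then autoMatrix δ (fun a => y (some a)) q'.1 q *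
          wordSum (autoLang δ q₀ q) (fun a => y (some a)) else 0 := by
      rw [← Finset.sum_filter, Finset.sum_subtype (p := fun q => q ∈ C) _ (by simp)]
      simp only [Matrix.mulVec, dotProduct]
      refine Finset.sum_congr rfl fun q _ => ?_
      rw [hδ', autoMatrix_reachStep]
    rw [hC', ← Finset.sum_add_distrib]
    refine Finset.sum_congr rfl fun q _ => ?_
    by_cases hqC : q ∈ C
    · have : q ∉ X := fun h => h.1 hqC
      simp [hqC, this]
    · by_cases hqX : q ∈ X
      · simp [hqC, hqX]
      -- A state outside `C` with an edge into `C` leads to `q₁`, hence belongs to `X`.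
      · have : autoMatrix δ (fun a => y (some a)) q'.1 q = 0 := autoMatrix_eq_zero
          fun a h => hqX ⟨hqC, by
            obtain ⟨u, hu⟩ := hCback _ q'.2
            exact ⟨a :: u, by rw [List.foldl_cons, h, hu]⟩⟩
        simp [this]
  -- the equation for the limit
  let E : Matrix C C ℝ := fun q' _ => if q' = ⟨q₁, hq₁C⟩ then 1 else 0
  have hE : ∀ v : C → ℝ, E.mulVec v = fun q' => if q' = ⟨q₁, hq₁C⟩ then ∑ q, v q else 0 := by
    intro v
    funext q'
    simp only [E, Matrix.mulVec, dotProduct]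
    split_ifs <;> simp
  have hcol : ∀ (z : α → ℝ) (v : C → ℝ),
      ∑ q', (autoMatrix δ' z).mulVec v q' = (∑ a, z a) * ∑ q, v q := by
    intro z v
    simp only [Matrix.mulVec, dotProduct]
    rw [Finset.sum_comm, Finset.mul_sum]
    refine Finset.sum_congr rfl fun q _ => ?_
    rw [← Finset.sum_mul, autoMatrix_col_sum]
  have hA : Continuous fun z : α → ℝ => 1 - autoMatrix δ' z + E :=
    (continuous_const.sub (continuous_matrix fun q' q => continuous_autoMatrix_apply q' q)).add
      continuous_const
  have hdet : (1 - autoMatrix δ' x + E).det ≠ 0 := by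
    intro hdet
    obtain ⟨v, hv0, hv⟩ := Matrix.exists_mulVec_eq_zero_iff.2 hdet
    rw [Matrix.add_mulVec, Matrix.sub_mulVec, Matrix.one_mulVec, hE] at hv
    -- Summing the entries cancels `v - T v` and leaves the sum of `v`. Hence the `E` term vanishes
    -- too, `v` is fixed by the irreducible matrix `T`, and `eq_zero_of_mulVec_eq` applies.
    have hs : ∑ q, v q = 0 := by
      have := congrArg (fun f : C → ℝ => ∑ q, f q) hv
      simp only [Pi.add_apply, Pi.sub_apply, Finset.sum_add_distrib, Finset.sum_sub_distrib, hcol,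
        hx.2, one_mul, sub_self, zero_add, Finset.sum_ite_eq', Finset.mem_univ, if_true,
        Pi.zero_apply, Finset.sum_const_zero] at this
      exact this
    refine hv0 (eq_zero_of_mulVec_eq (autoMatrix_nonneg fun a => (hx.1 a).le)
      (fun q => (autoMatrix_col_sum q).trans hx.2) hirr ?_ hs)
    simp only [hs, ite_self] at hv
    have h0 : v - (autoMatrix δ' x).mulVec v = 0 := by
      rw [← hv]
      funext q
      simp
    exact (sub_eq_zero.1 h0).symm
  have key := tendsto_of_mulVec_eq (v := fun y => y none • h y)
    (b := fun y q' => y none * B y q' + if q' = ⟨q₁, hq₁C⟩ then ∑ q, B y q else 0)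
    (b₀ := fun q' => 0 * B₀ q' + if q' = ⟨q₁, hq₁C⟩ then ∑ q, B₀ q else 0)
    ((hA.tendsto x).comp (tendsto_boxLimit_some x)) hdet
    (by
      refine tendsto_pi_nhds.2 fun q' =>
        ((tendsto_boxLimit x none).mul (tendsto_pi_nhds.1 hB q')).add ?_
      split_ifs
      · exact tendsto_finsetSum _ fun q _ => tendsto_pi_nhds.1 hB q
      · exact tendsto_const_nhds)
    (by
      filter_upwards [eventually_mem_openSimplex x] with y hy
      change (1 - (autoMatrix δ' fun a => y (some a)) + E).mulVec (y none • h y) = _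
      have hmass : y none * ∑ q, h y q = ∑ q, B y q := by
        have := Finset.sum_congr (rfl : (Finset.univ : Finset C) = _) fun q _ => hh y hy q
        rw [Finset.sum_add_distrib, hcol, (openSimplex_some hy).2] at this
        linarith
      rw [Matrix.mulVec_smul, Matrix.add_mulVec, Matrix.sub_mulVec, Matrix.one_mulVec, hE]
      funext q'
      have h1 := hh y hy q'
      simp only [Pi.smul_apply, Pi.add_apply, Pi.sub_apply, smul_eq_mul, mul_add, mul_ite, hmass,
        mul_zero]
      congr 1
      rw [sub_eq_of_eq_add h1])
  exact ⟨_, tendsto_pi_nhds.1 key ⟨q₁, hq₁C⟩⟩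

/-- For all states `q₁` of a finite automaton, the weight of the words that lead to `q₁`,
multiplied by `x_□`, has a limit as `x_□` tends to zero. -/
theorem exists_tendsto_wordSum_autoLang {x : α → ℝ} (hx : x ∈ openSimplex α) (q₀ q₁ : Q) :
    ∃ l, Tendsto (fun y : Option α → ℝ => y none * wordSum (autoLang δ q₀ q₁) fun a => y (some a))
      (boxLimit x) (𝓝 l) := by
  by_cases h : IsRecurrent δ q₁
  · exact exists_tendsto_of_isRecurrent hx q₀ h
  · exact ⟨0, tendsto_zero_of_not_isRecurrent hx q₀ h⟩

end AutomatonLimits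

/-! ### The limit of the distribution of the value of a word of geometric length -/

section WordMass

theorem tendsto_wordWeight {α : Type*} [Fintype α] (x : α → ℝ) (u : List α) :
    Tendsto (fun y : Option α → ℝ => wordWeight (fun a => y (some a)) u) (boxLimit x)
      (𝓝 (wordWeight x u)) := by
  induction u with
  | nil => exact tendsto_const_nhds
  | cons a u ih =>
    simp only [wordWeight_cons]
    exact (tendsto_boxLimit x (some a)).mul ih

variable {S : Type*} [Semigroup S] {α : Type*} (g : α → S)

/-- The words with value `s`. -/
def valLang (s : WithOne S) : Set (List α) := {u | wordVal g u = s}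

theorem foldl_mul_eq (s : WithOne S) (u : List α) :
    u.foldl (fun s a => s * (g a : WithOne S)) s = s * wordVal g u := by
  induction u generalizing s with
  | nil => rw [wordVal_nil, mul_one]; rfl
  | cons a u ih => rw [List.foldl_cons, ih, wordVal_cons, mul_assoc]

theorem valLang_eq_autoLang (s : WithOne S) :
    valLang g s = autoLang (fun s a => s * (g a : WithOne S)) 1 s := by
  ext u
  simp [valLang, autoLang, foldl_mul_eq]

theorem exists_wordVal_eq (hg : Subsemigroup.closure (Set.range g) = ⊤) (s : S) :
    ∃ u, wordVal g u = (s : WithOne S) := by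
  have hs : s ∈ Subsemigroup.closure (Set.range g) := hg ▸ Subsemigroup.mem_top s
  induction hs using Subsemigroup.closure_induction with
  | mem s hs =>
    obtain ⟨a, rfl⟩ := hs
    exact ⟨[a], wordVal_singleton g a⟩
  | mul s t _ _ hs ht =>
    obtain ⟨u, hu⟩ := hs
    obtain ⟨v, hv⟩ := ht
    exact ⟨u ++ v, by rw [wordVal_append, hu, hv, WithOne.coe_mul]⟩

variable {g} in
theorem sum_wordSum_valLang [Finite S] {z : α → ℝ} (h : WordSummable Set.univ z) (F : Set (WithOne S)) :
    ∑ᶠ s ∈ F, wordSum (valLang g s) z = wordSum {u | wordVal g u ∈ F} z := by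
  have := finsum_wordSum_fibre (Set.toFinite F) (wordVal g) (L := Set.univ) (x := z)
    (h.mono (Set.subset_univ _))
  simp only [Set.mem_univ, true_and] at this
  exact this

variable [Fintype α]

/-- The limit as `x_□ → 0` of `x_□` times the weight of the words with value `s`. -/
noncomputable def wordMass (x : α → ℝ) (s : WithOne S) : ℝ :=
  limUnder (boxLimit x) fun y => y none * wordSum (valLang g s) fun a => y (some a)

variable {g} [Finite S] {x : α → ℝ}

theorem tendsto_wordMass (hx : x ∈ openSimplex α) (s : WithOne S) :
    Tendsto (fun y : Option α → ℝ => y none * wordSum (valLang g s) fun a => y (some a))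
      (boxLimit x) (𝓝 (wordMass g x s)) := by
  have := Fintype.ofFinite (WithOne S)
  rw [wordMass, valLang_eq_autoLang]
  exact tendsto_nhds_limUnder (exists_tendsto_wordSum_autoLang hx 1 s)

theorem wordMass_nonneg (hx : x ∈ openSimplex α) (s : WithOne S) : 0 ≤ wordMass g x s := by
  have := neBot_boxLimit hx
  refine ge_of_tendsto (tendsto_wordMass hx s) ?_
  filter_upwards [eventually_mem_openSimplex x] with y hy
  exact mul_nonneg (hy.1 _).le (wordSum_nonneg (fun a => (hy.1 _).le) _)

/-- Only recurrent states of the right Cayley graph keep mass. A recurrent `s` can be multiplied by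
some `k ∈ K(S)` and then brought back to `s`, so it lies in the ideal `K(S)`. -/
theorem wordMass_eq_zero (hg : Subsemigroup.closure (Set.range g) = ⊤) (hx : x ∈ openSimplex α)
    {s : WithOne S} (hs : ¬ InK s) : wordMass g x s = 0 := by
  have := Fintype.ofFinite (WithOne S)
  have := neBot_boxLimit hx
  refine tendsto_nhds_unique (tendsto_wordMass hx s) ?_
  rw [valLang_eq_autoLang]
  refine tendsto_zero_of_not_isRecurrent hx 1 fun hrec => hs ?_
  have : Nonempty α := by
    by_contra h
    rw [not_nonempty_iff] at h
    simpa using hx.2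
  have : Nonempty S := ‹Nonempty α›.map g
  obtain ⟨k, hk⟩ := minimalIdeal_nonempty (S := S)
  obtain ⟨u, hu⟩ := exists_wordVal_eq g hg k
  obtain ⟨v, hv⟩ := hrec u
  rw [foldl_mul_eq, wordVal_append, hu] at hv
  rw [← hv]
  exact InK.mul_left (InK.mul_right ⟨k, hk, rfl⟩ _) _

theorem tendsto_finsum_wordMass (hx : x ∈ openSimplex α) (F : Set (WithOne S)) :
    Tendsto (fun y : Option α → ℝ => y none * wordSum {u | wordVal g u ∈ F} fun a => y (some a))
      (boxLimit x) (𝓝 (∑ᶠ s ∈ F, wordMass g x s)) := by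
  rw [finsum_mem_eq_finite_toFinset_sum _ (Set.toFinite F)]
  refine (tendsto_finsetSum _ fun s _ => tendsto_wordMass hx s).congr' ?_
  filter_upwards [eventually_mem_openSimplex x] with y hy
  rw [← sum_wordSum_valLang (wordSummable_some hy _), ← Finset.mul_sum,
    finsum_mem_eq_finite_toFinset_sum _ (Set.toFinite F)]

theorem wordSum_univ {y : Option α → ℝ} (hy : y ∈ openSimplex (Option α)) :
    wordSum Set.univ (fun a => y (some a)) = (y none)⁻¹ := by
  rw [wordSum_eq_tsum_indicator, Set.indicator_univ,
    (hasSum_wordWeight (fun a => (hy.1 _).le) (openSimplex_some_lt hy)).tsum_eq,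
    (openSimplex_some hy).2, sub_sub_cancel]

theorem finsum_wordMass (hx : x ∈ openSimplex α) :
    ∑ᶠ s ∈ (Set.univ : Set (WithOne S)), wordMass g x s = 1 := by
  have := neBot_boxLimit hx
  refine tendsto_nhds_unique (tendsto_finsum_wordMass hx Set.univ) ?_
  refine tendsto_const_nhds.congr' ?_
  filter_upwards [eventually_mem_openSimplex x] with y hy
  have : {u | wordVal g u ∈ (Set.univ : Set (WithOne S))} = Set.univ := by ext; simp
  rw [this, wordSum_univ hy, mul_inv_cancel₀ (hy.1 none).ne']

/-- Split off the first letter and let `x_□ → 0`. The empty word does not contribute, as its value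
is the adjoined identity. This is the stationarity equation of the left walk. -/
theorem wordMass_coe_eq (hx : x ∈ openSimplex α) (s : S) :
    wordMass g x s =
      ∑ a, x a * ∑ᶠ t ∈ {t : WithOne S | (g a : WithOne S) * t = (s : WithOne S)},
        wordMass g x t := by
  have := neBot_boxLimit hx
  refine tendsto_nhds_unique (tendsto_wordMass hx (s : WithOne S)) ?_
  refine (tendsto_finsetSum Finset.univ fun a _ => (tendsto_boxLimit x (some a)).mul
    (tendsto_finsum_wordMass (g := g) hx {t : WithOne S | (g a : WithOne S) * t = s})).congr' ?_
  filter_upwards [eventually_mem_openSimplex x] with y hy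
  rw [wordSum_cons (wordSummable_some hy _), if_neg, zero_add, Finset.mul_sum]
  · refine Finset.sum_congr rfl fun a _ => ?_
    rw [mul_left_comm]
    simp only [valLang, Set.mem_ofPred_eq, wordVal_cons]
  · exact fun h => WithOne.coe_ne_one (h : wordVal g [] = s).symm

/-- Sums over `S` with an adjoined identity reduce to sums over `K(S)`. -/
theorem finsum_wordMass_eq [Fintype S] (hg : Subsemigroup.closure (Set.range g) = ⊤)
    (hx : x ∈ openSimplex α) (F : Set (WithOne S)) :
    ∑ᶠ s ∈ F, wordMass g x s =
      ∑ w : minimalIdeal S, if ((w : S) : WithOne S) ∈ F then wordMass g x (w : S) else 0 := by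
  have := Fintype.ofFinite (WithOne S)
  rw [finsum_eq_sum_of_fintype]
  refine (Fintype.sum_of_injective (fun w : minimalIdeal S => ((w : S) : WithOne S))
    (fun v w h => Subtype.ext (WithOne.coe_inj.1 h)) _ _ ?_ ?_).symm
  · intro s hs
    rw [wordMass_eq_zero hg hx]
    · simp
    · rintro ⟨k, hk, rfl⟩
      exact hs ⟨⟨k, hk⟩, rfl⟩
  · intro w
    by_cases h : ((w : S) : WithOne S) ∈ F <;> simp [h]

end WordMass

/-! ### The left walk on the minimal ideal and on minimal left ideals -/

section LeftWalk

variable {S : Type*} [Semigroup S] {α : Type*} {g : α → S} {x : α → ℝ}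

/-- Left multiplication on a set of elements that is closed under it. -/
def leftStep (g : α → S) (X : Set S) (h : ∀ s ∈ X, ∀ a, g a * s ∈ X) (s : X) (a : α) : X :=
  ⟨g a * s, h s s.2 a⟩

theorem walkMatrix_eq_autoMatrix [Fintype α] {X : Set S} (h : ∀ s ∈ X, ∀ a, g a * s ∈ X) :
    walkMatrix g x X = autoMatrix (leftStep g X h) x := by
  funext s' s
  refine Finset.sum_congr rfl fun a _ => ?_
  by_cases h' : g a * (s : S) = s'
  · rw [if_pos h', if_pos (Subtype.ext h')]
  · rw [if_neg h', if_neg fun h'' => h' (congrArg Subtype.val h'')]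

theorem walkMatrix_mulVec [Fintype α] [Fintype S] {X : Set S} (v : X → ℝ) (w : X) :
    (walkMatrix g x X).mulVec v w = ∑ a, x a * ∑ s : X, if g a * (s : S) = w then v s else 0 := by
  simp only [Matrix.mulVec, dotProduct, walkMatrix, Finset.sum_mul, Finset.mul_sum]
  rw [Finset.sum_comm]
  refine Finset.sum_congr rfl fun a _ => Finset.sum_congr rfl fun q _ => ?_
  split_ifs <;> simp

/-- `K(S) ∩ L` is a nonempty left ideal contained in `L`, hence equal to `L`. -/
theorem IsMinimalLeftIdeal.subset [Finite S] {L : Set S} (hL : IsMinimalLeftIdeal L) :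
    L ⊆ minimalIdeal S := by
  have : Nonempty S := hL.1.1.to_subtype.map Subtype.val
  obtain ⟨k, hk⟩ := minimalIdeal_nonempty (S := S)
  obtain ⟨l, hl⟩ := hL.1.1
  have h : IsLeftIdeal (minimalIdeal S ∩ L) :=
    ⟨⟨k * l, (isSemigroupIdeal_minimalIdeal k hk l).2, hL.1.2 l hl k⟩, fun y hy s =>
      ⟨(isSemigroupIdeal_minimalIdeal y hy.1 s).1, hL.1.2 y hy.2 s⟩⟩
  rw [← hL.2 _ h Set.inter_subset_right]
  exact Set.inter_subset_left

theorem IsMinimalLeftIdeal.exists_mul_eq {L : Set S} (hL : IsMinimalLeftIdeal L) {v w : S}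
    (hv : v ∈ L) (hw : w ∈ L) : ∃ s : S, s * v = w := by
  have h : IsLeftIdeal (Set.range fun s : S => s * v) := by
    refine ⟨⟨v * v, v, rfl⟩, ?_⟩
    rintro _ ⟨t, rfl⟩ s
    exact ⟨s * t, mul_assoc _ _ _⟩
  have := hL.2 _ h (by rintro _ ⟨s, rfl⟩; exact hL.1.2 v hv s)
  rw [← this] at hw
  exact hw

theorem IsLeftZero.isMinimalLeftIdeal [Finite S] [Nonempty S]
    (hK : IsLeftZero (minimalIdeal S)) : IsMinimalLeftIdeal (minimalIdeal S) := by
  refine ⟨⟨minimalIdeal_nonempty, fun y hy s => (isSemigroupIdeal_minimalIdeal y hy s).1⟩,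
    fun L hL hLK => hLK.antisymm fun k hk => ?_⟩
  obtain ⟨l, hl⟩ := hL.1
  rw [← hK k hk l (hLK hl)]
  exact hL.2 l hl k

/-- The left walk prepends letters, so a word acts by being read from its last letter to its first.
-/
theorem foldl_leftStep {L : Set S} (h : ∀ s ∈ L, ∀ a, g a * s ∈ L) (u : List α) (v : L) :
    (((u.reverse.foldl (leftStep g L h) v : L) : S) : WithOne S) =
      wordVal g u * ((v : S) : WithOne S) := by
  induction u generalizing v with
  | nil => rw [wordVal_nil, one_mul]; rfl
  | cons a u ih =>
    rw [List.reverse_cons, List.foldl_append, wordVal_cons, mul_assoc, ← ih]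
    rfl

variable [Fintype α] [Fintype S]

theorem isStationaryDist_wordMass (hg : Subsemigroup.closure (Set.range g) = ⊤)
    (hx : x ∈ openSimplex α) :
    IsStationaryDist (walkMatrix g x (minimalIdeal S)) fun w => wordMass g x (w : S) := by
  refine ⟨fun w => wordMass_nonneg hx _, ?_, ?_⟩
  · rw [← finsum_wordMass (g := g) hx, finsum_wordMass_eq hg hx]
    simp
  · funext w
    rw [walkMatrix_mulVec, wordMass_coe_eq hx]
    refine Finset.sum_congr rfl fun a _ => ?_
    rw [finsum_wordMass_eq hg hx]
    congr 1
    refine Finset.sum_congr rfl fun s _ => if_congr ?_ rfl rfl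
    rw [Set.mem_ofPred_eq, ← WithOne.coe_mul, WithOne.coe_inj]

theorem isIrreducibleChain_walkMatrix (hg : Subsemigroup.closure (Set.range g) = ⊤)
    (hx : x ∈ openSimplex α) {L : Set S} (hL : IsMinimalLeftIdeal L) :
    IsIrreducibleChain (walkMatrix g x L) := by
  rw [walkMatrix_eq_autoMatrix fun s hs a => hL.1.2 s hs (g a)]
  refine isIrreducibleChain_autoMatrix hx.1 fun v w => ?_
  obtain ⟨s, hs⟩ := hL.exists_mul_eq v.2 w.2
  obtain ⟨u, hu⟩ := exists_wordVal_eq g hg s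
  refine ⟨u.reverse, Subtype.ext (WithOne.coe_inj.1 ?_)⟩
  rw [foldl_leftStep, hu, ← WithOne.coe_mul, hs]

/-- Fix a word `c` with value in `L`. All words `u c` have values in `L`, and their total weight
times `x_□` is the weight of `c`, a lower bound that survives the limit. -/
theorem sum_wordMass_pos (hg : Subsemigroup.closure (Set.range g) = ⊤)
    (hx : x ∈ openSimplex α) {L : Set S} (hL : IsMinimalLeftIdeal L) :
    0 < ∑ v : L, wordMass g x (v : S) := by
  have := neBot_boxLimit hx
  obtain ⟨l, hl⟩ := hL.1.1
  obtain ⟨c, hc⟩ := exists_wordVal_eq g hg l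
  have hsum : ∑ᶠ s ∈ (fun s : S => (s : WithOne S)) '' L, wordMass g x s =
      ∑ v : L, wordMass g x (v : S) := by
    rw [finsum_mem_image fun s _ t _ h => WithOne.coe_inj.1 h, finsum_mem_eq_finite_toFinset_sum _
      (Set.toFinite L), Finset.sum_subtype (p := fun s => s ∈ L) _ (by simp)]
  rw [← hsum]
  refine (wordWeight_pos hx.1 c).trans_le (le_of_tendsto_of_tendsto (tendsto_wordWeight x c)
    (tendsto_finsum_wordMass hx _) ?_)
  filter_upwards [eventually_mem_openSimplex x] with y hy
  have hnn : ∀ a, 0 ≤ y (some a) := fun a => (hy.1 _).le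
  have hle : wordSum Set.univ (fun a => y (some a)) * wordWeight (fun a => y (some a)) c ≤
      wordSum {u | wordVal g u ∈ (fun s : S => (s : WithOne S)) '' L} fun a => y (some a) := by
    rw [wordSum, wordSum, ← tsum_mul_right]
    refine Summable.tsum_le_tsum_of_inj (fun u => ⟨u.1 ++ c, ?_⟩) ?_ ?_ ?_ ?_ ?_
    · have h : wordVal g (u.1 ++ c) = wordVal g u.1 * (l : WithOne S) := by
        rw [wordVal_append, hc]
      rw [Set.mem_ofPred_eq, h]
      generalize wordVal g u.1 = s
      induction s using WithOne.recOneCoe with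
      | one => exact ⟨l, hl, (one_mul _).symm⟩
      | coe s => exact ⟨s * l, hL.1.2 l hl s, rfl⟩
    · intro u v h
      exact Subtype.ext (List.append_cancel_right (congrArg Subtype.val h))
    · exact fun _ _ => wordWeight_nonneg hnn _
    · exact fun u => (wordWeight_append _ _ _).ge
    · exact (wordSummable_some hy _).mul_right _
    · exact wordSummable_some hy _
  rw [wordSum_univ hy, inv_mul_le_iff₀ (hy.1 none)] at hle
  exact hle

theorem isStationaryDist_minimalLeftIdeal (hg : Subsemigroup.closure (Set.range g) = ⊤)
    (hx : x ∈ openSimplex α) {L : Set S} (hL : IsMinimalLeftIdeal L) :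
    IsStationaryDist (walkMatrix g x L)
      fun w => wordMass g x (w : S) / ∑ v : L, wordMass g x (v : S) := by
  have hpos := sum_wordMass_pos hg hx hL
  refine ⟨fun w => div_nonneg (wordMass_nonneg hx _) hpos.le, ?_, ?_⟩
  · rw [← Finset.sum_div, div_self hpos.ne']
  -- Dropping the states of `K(S)` outside `L` can only lose mass, so the walk on `L` maps the
  -- restricted vector to something no larger. It also preserves the total mass, so equality holds.
  · have hle : ∀ w : L, (walkMatrix g x L).mulVec (fun v => wordMass g x (v : S)) w ≤
        wordMass g x (w : S) := by
      intro w
      rw [walkMatrix_mulVec, wordMass_coe_eq hx]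
      refine Finset.sum_le_sum fun a _ => mul_le_mul_of_nonneg_left ?_ (hx.1 a).le
      rw [finsum_wordMass_eq hg hx]
      have e : ∀ s : L, (s : S) ∈ minimalIdeal S := fun s => hL.subset s.2
      have hnn : ∀ s : minimalIdeal S, 0 ≤
          (if ((s : S) : WithOne S) ∈ {t : WithOne S | (g a : WithOne S) * t = ((w : S) : WithOne S)}
            then wordMass g x (s : S) else 0) := fun s => by
        split_ifs
        exacts [wordMass_nonneg hx _, le_rfl]
      let ι : L ↪ minimalIdeal S := ⟨fun s => ⟨s, e s⟩, fun s t h => Subtype.ext (by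
        exact congrArg (fun k : minimalIdeal S => (k : S)) h)⟩
      refine le_trans (le_of_eq ?_) (Finset.sum_le_sum_of_subset_of_nonneg
        (Finset.subset_univ (Finset.univ.map ι)) fun s _ _ => hnn s)
      rw [Finset.sum_map]
      refine Finset.sum_congr rfl fun s _ => if_congr ?_ rfl rfl
      rw [Set.mem_ofPred_eq]
      change _ ↔ (g a : WithOne S) * ((s : S) : WithOne S) = _
      rw [← WithOne.coe_mul, WithOne.coe_inj]
    have hsum : ∑ w : L, (walkMatrix g x L).mulVec (fun v => wordMass g x (v : S)) w =
        ∑ w : L, wordMass g x (w : S) := by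
      rw [walkMatrix_eq_autoMatrix fun s hs a => hL.1.2 s hs (g a)]
      simp only [Matrix.mulVec, dotProduct]
      rw [Finset.sum_comm]
      refine Finset.sum_congr rfl fun v _ => ?_
      rw [← Finset.sum_mul, autoMatrix_col_sum, hx.2, one_mul]
    have heq := (Finset.sum_eq_sum_iff_of_le fun w _ => hle w).1 hsum
    have : (fun w : L => wordMass g x (w : S) / ∑ v : L, wordMass g x (v : S)) =
        (∑ v : L, wordMass g x (v : S))⁻¹ • fun w : L => wordMass g x (w : S) := by
      funext w
      simp [div_eq_inv_mul]
    rw [this, Matrix.mulVec_smul]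
    congr 1
    funext w
    exact heq w (Finset.mem_univ w)

theorem isStationaryDist_minimalLeftIdeal_iff (hg : Subsemigroup.closure (Set.range g) = ⊤)
    (hx : x ∈ openSimplex α) {L : Set S} (hL : IsMinimalLeftIdeal L) (Φ : L → ℝ) :
    IsStationaryDist (walkMatrix g x L) Φ ↔
      ∀ w : L, Φ w = wordMass g x (w : S) / ∑ v : L, wordMass g x (v : S) := by
  have hst := isStationaryDist_minimalLeftIdeal hg hx hL
  constructor
  · intro hΦ w
    have h0 : ∀ i j, 0 ≤ walkMatrix g x L i j := by
      rw [walkMatrix_eq_autoMatrix fun s hs a => hL.1.2 s hs (g a)]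
      exact autoMatrix_nonneg fun a => (hx.1 a).le
    have h1 : ∀ j, ∑ i, walkMatrix g x L i j = 1 := by
      rw [walkMatrix_eq_autoMatrix fun s hs a => hL.1.2 s hs (g a)]
      exact fun j => (autoMatrix_col_sum j).trans hx.2
    exact congrFun (hΦ.unique h0 h1 (isIrreducibleChain_walkMatrix hg hx hL) hst) w
  · intro h
    rw [show Φ = _ from funext h]
    exact hst

end LeftWalk

/-! ### Semaphore codes -/

section SemaphoreCode

variable {S : Type*} [Semigroup S] {α : Type*} (g : α → S)

/-- The words in the semaphore code with value `s`. -/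
def codeLang (s : WithOne S) : Set (List α) := {u | u ∈ semaphoreCode g ∧ wordVal g u = s}

variable {g}

/-- The semaphore code is a prefix code: a proper extension of a code word has a proper initial
segment with value in `K(S)`. -/
theorem eq_of_append_eq_of_mem_semaphoreCode {c c' v v' : List α} (hc : c ∈ semaphoreCode g)
    (hc' : c' ∈ semaphoreCode g) (h : c ++ v = c' ++ v') : c = c' := by
  have key : ∀ {c d : List α}, c ∈ semaphoreCode g → c ++ d ∈ semaphoreCode g → d = [] := by
    rintro c d ⟨-, -, -, -, hc⟩ ⟨u, a, hu, hnot, -⟩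
    rcases List.eq_nil_or_concat' d with h | ⟨d, b, rfl⟩
    · exact h
    · rw [← List.append_assoc] at hu
      rw [← List.append_inj_left' hu rfl, wordVal_append] at hnot
      exact absurd (hc.mul_right _) hnot
  rcases List.append_eq_append_iff.1 h with ⟨d, rfl, -⟩ | ⟨d, rfl, -⟩
  · rw [key hc hc', List.append_nil]
  · rw [key hc' hc, List.append_nil]

theorem exists_semaphoreCode_prefix {u : List α} (hu : InK (wordVal g u)) :
    ∃ c ∈ semaphoreCode g, ∃ v, u = c ++ v := by
  induction u using List.reverseRecOn with
  | nil => exact absurd hu not_inK_one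
  | append_singleton u a ih =>
    by_cases h : InK (wordVal g u)
    · obtain ⟨c, hc, v, rfl⟩ := ih h
      exact ⟨c, hc, v ++ [a], by simp⟩
    · exact ⟨u ++ [a], ⟨u, a, rfl, h, hu⟩, [], by simp⟩

/-- If `K(S)` is left zero, then the words with a given value in `K(S)` are the words in the
semaphore code with that value, followed by arbitrary words. -/
noncomputable def valLangEquiv (hK : IsLeftZero (minimalIdeal S)) {s : WithOne S} (hs : InK s) :
    codeLang g s × List α ≃ valLang g s :=
  Equiv.ofBijective
    (fun i => ⟨i.1.1 ++ i.2, by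
      have h : wordVal g i.1.1 = s := i.1.2.2
      change wordVal g _ = s
      rw [wordVal_append, h, hK.inK_mul hs]⟩)
    ⟨fun i j h => by
      have h' : i.1.1 ++ i.2 = j.1.1 ++ j.2 := congrArg Subtype.val h
      have h1 := eq_of_append_eq_of_mem_semaphoreCode i.1.2.1 j.1.2.1 h'
      rw [h1] at h'
      exact Prod.ext (Subtype.ext h1) (List.append_cancel_left h'), by
    rintro ⟨u, hu⟩
    have hu' : wordVal g u = s := hu
    obtain ⟨c, hc, v, rfl⟩ := exists_semaphoreCode_prefix (hu'.symm ▸ hs)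
    refine ⟨(⟨c, hc, ?_⟩, v), rfl⟩
    obtain ⟨-, -, -, -, hcK⟩ := id hc
    rw [wordVal_append, hK.inK_mul hcK] at hu'
    exact hu'⟩

variable [Fintype α]

/-- Code word and tail are chosen independently, and the tails contribute the factor `1 / x_□`. -/
theorem wordSum_valLang (hK : IsLeftZero (minimalIdeal S)) {s : WithOne S} (hs : InK s)
    {y : Option α → ℝ} (hy : y ∈ openSimplex (Option α)) :
    y none * wordSum (valLang g s) (fun a => y (some a)) =
      wordSum (codeLang g s) fun a => y (some a) := by
  have hnn : ∀ a, 0 ≤ y (some a) := fun a => (hy.1 _).le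
  have h1 : Summable fun u : codeLang g s => wordWeight (fun a => y (some a)) u.1 :=
    wordSummable_some hy _
  have h2 := hasSum_wordWeight hnn (openSimplex_some_lt hy)
  have h3 := h1.tsum_mul_tsum h2.summable (h1.mul_of_nonneg h2.summable
    (fun _ => wordWeight_nonneg hnn _) fun _ => wordWeight_nonneg hnn _)
  rw [h2.tsum_eq, (openSimplex_some hy).2, sub_sub_cancel] at h3
  rw [wordSum, ← (valLangEquiv hK hs).tsum_eq]
  have h4 : ∀ i : codeLang g s × List α, wordWeight (fun a => y (some a))
      (valLangEquiv hK hs i).1 =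
      wordWeight (fun a => y (some a)) i.1.1 * wordWeight (fun a => y (some a)) i.2 :=
    fun i => wordWeight_append _ _ _
  simp_rw [h4]
  rw [← h3, mul_comm, mul_assoc, inv_mul_cancel₀ (hy.1 none).ne', mul_one, wordSum]

theorem sum_codeLang_le_one (hK : IsLeftZero (minimalIdeal S)) {s : WithOne S} (hs : InK s)
    {y : Option α → ℝ} (hy : y ∈ openSimplex (Option α)) (F : Finset (codeLang g s)) :
    ∑ u ∈ F, wordWeight (fun a => y (some a)) u.1 ≤ 1 := by
  have hnn : ∀ a, 0 ≤ y (some a) := fun a => (hy.1 _).le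
  have h1 : Summable fun u : codeLang g s => wordWeight (fun a => y (some a)) u.1 :=
    wordSummable_some hy _
  refine (h1.sum_le_tsum F fun u _ => wordWeight_nonneg hnn _).trans ?_
  change wordSum (codeLang g s) _ ≤ 1
  rw [← wordSum_valLang hK hs hy]
  have h2 : wordSum (valLang g s) (fun a => y (some a)) ≤ (y none)⁻¹ := by
    rw [← wordSum_univ hy, wordSum_eq_tsum_indicator, wordSum_eq_tsum_indicator]
    refine Summable.tsum_le_tsum (fun u => ?_)
      (wordSummable_iff_indicator.1 (wordSummable_some hy _))
      (wordSummable_iff_indicator.1 (wordSummable_some hy _))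
    exact Set.indicator_le_indicator_of_subset (Set.subset_univ _)
      (fun u => wordWeight_nonneg hnn u) u
  calc y none * wordSum (valLang g s) (fun a => y (some a)) ≤ y none * (y none)⁻¹ :=
        mul_le_mul_of_nonneg_left h2 (hy.1 none).le
    _ = 1 := mul_inv_cancel₀ (hy.1 none).ne'

/-- At `x` the letter weights sum to one, so the geometric series gives nothing. Instead, finite
partial sums are at most one at the nearby points with `x_□ > 0`, and this bound passes to the
limit. -/
theorem wordSummable_codeLang (hK : IsLeftZero (minimalIdeal S)) {s : WithOne S} (hs : InK s)
    {x : α → ℝ} (hx : x ∈ openSimplex α) : WordSummable (codeLang g s) x := by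
  have := neBot_boxLimit hx
  refine summable_of_sum_le (c := 1) (fun u => wordWeight_nonneg (fun a => (hx.1 a).le) _) fun F => ?_
  refine le_of_tendsto (tendsto_finsetSum F fun u _ => tendsto_wordWeight x u.1) ?_
  filter_upwards [eventually_mem_openSimplex x] with y hy
  exact sum_codeLang_le_one hK hs hy F

theorem wordSummable_semaphoreCode_mcRun (hK : IsLeftZero (minimalIdeal S))
    {t : List (α × KR g)} (ht : InK (mcVal g t)) {x : α → ℝ} (hx : x ∈ openSimplex α) :
    WordSummable {u | u ∈ semaphoreCode g ∧ mcRun g u = t} x := by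
  refine (wordSummable_codeLang (g := g) hK ht hx).mono ?_
  rintro u ⟨hu, rfl⟩
  exact ⟨hu, (mcVal_mcRun u).symm⟩

/-- The weight of the words in the semaphore code with value `s`. -/
theorem wordMass_eq_wordSum_codeLang [Finite S] (hK : IsLeftZero (minimalIdeal S))
    {s : WithOne S} (hs : InK s) {x : α → ℝ} (hx : x ∈ openSimplex α) :
    wordMass g x s = wordSum (codeLang g s) x := by
  -- The limit may be computed along `boxPoint x ε`, where each letter of `A` weighs at most `x a`;
  -- the code sum at `x` then dominates.
  have h1 := (tendsto_wordMass (g := g) hx s).comp (tendsto_boxPoint hx)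
  have h2 : Tendsto (fun ε => wordSum (codeLang g s) fun a => boxPoint x ε (some a)) (𝓝[>] 0)
      (𝓝 (wordSum (codeLang g s) x)) := by
    refine tendsto_tsum_of_dominated_convergence (wordSummable_codeLang hK hs hx)
      (fun u => (tendsto_wordWeight x u.1).comp (tendsto_boxPoint hx)) ?_
    filter_upwards [Ioo_mem_nhdsGT (show (0 : ℝ) < 1 by norm_num)] with ε hε u
    have hy := boxPoint_mem hx hε.1 hε.2
    rw [Real.norm_of_nonneg (wordWeight_nonneg (fun a => (hy.1 _).le) _)]
    refine List.prod_map_le_prod_map₀ _ _ (fun a _ => (hy.1 _).le) fun a _ => ?_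
    change (1 - ε) * x a ≤ x a
    exact mul_le_of_le_one_left (hx.1 a).le (by linarith [hε.1])
  refine tendsto_nhds_unique h1 (h2.congr' ?_)
  filter_upwards [Ioo_mem_nhdsGT (show (0 : ℝ) < 1 by norm_num)] with ε hε
  exact (wordSum_valLang hK hs (boxPoint_mem hx hε.1 hε.2)).symm

/-- The code words with value `w` are sorted by the vertex of the expansion to which they lead. -/
theorem normalSum_eq_wordMass [Finite S] (hK : IsLeftZero (minimalIdeal S)) {w : S}
    (hw : w ∈ minimalIdeal S) {x : α → ℝ} (hx : x ∈ openSimplex α) :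
    normalSum g x w = wordMass g x (w : WithOne S) := by
  have hwK : InK (w : WithOne S) := inK_coe.2 hw
  have hset : {u | u ∈ semaphoreCode g ∧ mcRun g u ∈ treeOver g w} =
      codeLang g (w : WithOne S) := by
    ext u
    refine and_congr_right fun _ => ?_
    rw [← mcVal_mcRun]
    exact and_iff_right (mcRun_mem u)
  rw [wordMass_eq_wordSum_codeLang hK hwK hx, ← hset, ← finsum_wordSum_fibre
    (finite_mcVerts.subset fun t ht => ht.1) (mcRun g) (hset ▸ wordSummable_codeLang hK hwK hx),
    normalSum]
  exact finsum_mem_congr rfl fun t ht => normalDist_pictKR hK ht.1 (ht.2.symm ▸ hwK) x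

/-! ### Limits of normal distributions -/

theorem normalDist_pictKR_boxGen [Finite S] {U : List α} (y : Option α → ℝ) :
    normalDist (pictKR (boxGen g) (mcRun (boxGen g) (U.map some ++ [none]))) y =
      y none * wordSum {U' | mcRun (boxGen g) (U'.map some) = mcRun (boxGen g) (U.map some)}
        fun a => y (some a) := by
  rw [normalDist_pictKR isLeftZero_withZero (mcRun_mem _)
    (by rw [mcVal_mcRun]; exact inK_wordVal_boxGen_concat g _), wordSum_box]
  simp_rw [mcRun_box_eq_iff]

theorem exists_tendsto_normalDist [Finite S] {w : S} {t : List (Option α × KR (boxGen g))}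
    (ht : t ∈ boxTreeOver g w) {x : α → ℝ} (hx : x ∈ openSimplex α) :
    ∃ l, Tendsto (fun y => normalDist (pictKR (boxGen g) t) y) (boxLimit x) (𝓝 l) := by
  obtain ⟨U, -, rfl⟩ := mem_boxTreeOver_iff.1 ht
  have : Finite (mcVerts (boxGen g)) := finite_mcVerts
  have := Fintype.ofFinite (mcVerts (boxGen g))
  -- The letters of `A` act on the vertices of the expansion as a finite automaton, and the normal
  -- distribution is `x_□` times one of its word sums.
  let δ : mcVerts (boxGen g) → α → mcVerts (boxGen g) := fun t a =>
    ⟨mcStep (boxGen g) t.1 (some a), mcStep_mem t.2 _⟩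
  have hδ : ∀ (U : List α) (t : mcVerts (boxGen g)),
      (U.foldl δ t).1 = (U.map some).foldl (mcStep (boxGen g)) t.1 := by
    intro U
    induction U with
    | nil => exact fun t => rfl
    | cons a U ih => exact fun t => ih (δ t a)
  obtain ⟨l, hl⟩ := exists_tendsto_wordSum_autoLang (δ := δ) hx ⟨[], nil_mem_mcVerts⟩
    ⟨mcRun (boxGen g) (U.map some), mcRun_mem _⟩
  refine ⟨l, hl.congr fun y => ?_⟩
  rw [normalDist_pictKR_boxGen]
  congr 2
  ext U'
  simp only [autoLang, Set.mem_ofPred_eq, Subtype.ext_iff, hδ]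
  rfl

/-- Before the limit, the sum over `boxTreeOver g w` collects exactly the words `U □` with `[U]_S =
w`. The sum is finite, so it commutes with the limit, whether or not `K(S)` is left zero. -/
theorem limitSum_eq_wordMass [Finite S] (w : S) {x : α → ℝ} (hx : x ∈ openSimplex α) :
    limitSum g x w = wordMass g x (w : WithOne S) := by
  have := neBot_boxLimit hx
  have hfin : (boxTreeOver g w).Finite := finite_mcVerts.subset fun t ht => ht.1
  have hlim : ∀ t ∈ boxTreeOver g w,
      Tendsto (fun y => normalDist (pictKR (boxGen g) t) y) (boxLimit x) (𝓝 (limitDist g x t)) :=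
    fun t ht => tendsto_nhds_limUnder (exists_tendsto_normalDist ht hx)
  refine (tendsto_nhds_unique (tendsto_wordMass hx (w : WithOne S)) ?_).symm
  rw [limitSum, finsum_mem_eq_finite_toFinset_sum _ hfin]
  refine (tendsto_finsetSum _ fun t ht => hlim t (hfin.mem_toFinset.1 ht)).congr' ?_
  filter_upwards [eventually_mem_openSimplex x] with y hy
  have hset : {u | u ∈ semaphoreCode (boxGen g) ∧ mcRun (boxGen g) u ∈ boxTreeOver g w} ⊆
      codeLang (boxGen g) (WithOne.coe 0) := by
    rintro u ⟨hu, -⟩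
    refine ⟨hu, ?_⟩
    obtain ⟨-, -, -, -, k, hk, h⟩ := id hu
    rw [minimalIdeal_withZero] at hk
    rw [h, show k = 0 from hk]
  have h1 := finsum_wordSum_fibre hfin (mcRun (boxGen g)) (L := semaphoreCode (boxGen g))
    ((wordSummable_codeLang isLeftZero_withZero inK_coe_zero hy).mono hset)
  rw [wordSum_box (fun u => mcRun (boxGen g) u ∈ boxTreeOver g w)] at h1
  simp_rw [mcRun_box_mem_boxTreeOver_iff] at h1
  rw [valLang, ← h1, finsum_mem_eq_finite_toFinset_sum _ hfin]
  refine Finset.sum_congr rfl fun t ht => ?_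
  have ht' := hfin.mem_toFinset.1 ht
  exact normalDist_pictKR isLeftZero_withZero ht'.1 (inK_of_mem_boxTreeOver ht') y

end SemaphoreCode

/-! ### Random letter representations -/

section RandomLetter

variable {Ω : Type*} [Fintype Ω] {T : Matrix Ω Ω ℝ}

/-- The image of a stationary distribution of the walk on the minimal ideal under `w ↦ w . ω`. -/
theorem RandomLetterRep.isStationaryDist_sumOverFibre {S : Type*} [Semigroup S] [Fintype S]
    {α : Type*} [Fintype α] (R : RandomLetterRep T S α) (ω : Ω) {f : S → ℝ}
    (hf : IsStationaryDist (walkMatrix R.gen R.x (minimalIdeal S))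
      fun w : minimalIdeal S => f w) :
    IsStationaryDist T (sumOverFibre R.act f ω) := by
  refine ⟨fun s => Finset.sum_nonneg fun w _ => ?_, ?_, ?_⟩
  · split_ifs
    exacts [hf.1 w, le_rfl]
  · unfold sumOverFibre
    rw [Finset.sum_comm, ← hf.2.1]
    exact Finset.sum_congr rfl fun w _ => by simp
  -- The map `w ↦ w . ω` carries left multiplication by a generator to its action on states, so both
  -- sides become the same sum over pairs of a letter and an element of `K(S)`.
  · funext s'
    have h1 : T.mulVec (sumOverFibre R.act f ω) s' =
        ∑ w : minimalIdeal S, T s' (R.act w ω) * f w := by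
      simp only [Matrix.mulVec, dotProduct, sumOverFibre, Finset.mul_sum]
      rw [Finset.sum_comm]
      exact Finset.sum_congr rfl fun w _ => by simp
    have h2 : sumOverFibre R.act f ω s' = ∑ v : minimalIdeal S, if R.act v ω = s' then
        ∑ a, R.x a * ∑ w : minimalIdeal S, (if R.gen a * (w : S) = v then f w else 0) else 0 := by
      refine Finset.sum_congr rfl fun v _ => if_congr Iff.rfl ?_ rfl
      rw [← walkMatrix_mulVec (fun w : minimalIdeal S => f w) v]
      exact (congrFun hf.2.2 v).symm
    have h3 : ∀ v : minimalIdeal S, (if R.act v ω = s' then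
        ∑ a, R.x a * ∑ w : minimalIdeal S, (if R.gen a * (w : S) = v then f w else 0) else 0) =
        ∑ w : minimalIdeal S, ∑ a, if R.gen a * (w : S) = v then
          (if R.act v ω = s' then R.x a else 0) * f w else 0 := by
      intro v
      rw [Finset.sum_comm]
      split_ifs
      · refine Finset.sum_congr rfl fun a _ => ?_
        rw [Finset.mul_sum]
        exact Finset.sum_congr rfl fun w _ => by rw [mul_ite, mul_zero]
      · simp
    rw [h1, h2, Finset.sum_congr rfl fun v _ => h3 v, Finset.sum_comm]
    refine Finset.sum_congr rfl fun w _ => ?_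
    rw [R.transition, Finset.sum_mul, Finset.sum_comm]
    refine Finset.sum_congr rfl fun a _ => ?_
    have hmem : R.gen a * (w : S) ∈ minimalIdeal S :=
      inK_coe.1 ((inK_coe.2 w.2).mul_left (R.gen a : WithOne S))
    rw [Finset.sum_eq_single (⟨R.gen a * w, hmem⟩ : minimalIdeal S)]
    · simp [R.act_mul]
    · intro v _ hv
      exact if_neg fun h => hv (Subtype.ext h.symm)
    · exact fun h => absurd (Finset.mem_univ _) h

/-- The probability of the map `f` if the images of the states are chosen independently. -/
def mapProb (T : Matrix Ω Ω ℝ) (f : Ω → Ω) : ℝ :=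
  ∏ s, T (f s) s

theorem mapProb_nonneg (hT : T ∈ Matrix.colStochastic ℝ Ω) (f : Ω → Ω) :
    0 ≤ mapProb T f :=
  Finset.prod_nonneg fun _ _ => Matrix.nonneg_of_mem_colStochastic hT

theorem sum_mapProb (hT : T ∈ Matrix.colStochastic ℝ Ω) :
    ∑ f : Ω → Ω, mapProb T f = 1 := by
  have := Finset.prod_univ_sum (fun _ : Ω => (Finset.univ : Finset Ω)) fun s s' => T s' s
  rw [Fintype.piFinset_univ] at this
  exact this.symm.trans (Finset.prod_eq_one fun s _ => Matrix.sum_col_of_mem_colStochastic hT s)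

theorem sum_mapProb_fibre (hT : T ∈ Matrix.colStochastic ℝ Ω) (s' s : Ω) :
    ∑ f : Ω → Ω, (if f s = s' then mapProb T f else 0) = T s' s := by
  -- Expand the product of the column sums of `T` after erasing from column `s` all entries except
  -- the one in row `s'`; the other columns still sum to one.
  have := Finset.prod_univ_sum (fun _ : Ω => (Finset.univ : Finset Ω)) fun r r' =>
    if r = s ∧ r' ≠ s' then 0 else T r' r
  rw [Fintype.piFinset_univ, ← Finset.mul_prod_erase _ _ (Finset.mem_univ s),
    Finset.prod_eq_one (s := Finset.univ.erase s), mul_one] at this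
  · rw [Finset.sum_eq_single s'] at this
    · simp only [ne_eq, not_true_eq_false, and_false, if_false] at this
      rw [this]
      refine Finset.sum_congr rfl fun f _ => ?_
      split_ifs with h
      · refine Finset.prod_congr rfl fun r _ => (if_neg ?_).symm
        rintro ⟨rfl, h'⟩
        exact h' h
      · refine (Finset.prod_eq_zero (Finset.mem_univ s) ?_).symm
        exact if_pos ⟨rfl, h⟩
    · exact fun r _ hr => if_pos ⟨rfl, hr⟩
    · exact fun h => absurd (Finset.mem_univ _) h
  · intro r hr
    rw [← Matrix.sum_col_of_mem_colStochastic hT r]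
    exact Finset.sum_congr rfl fun r' _ => if_neg fun h => Finset.ne_of_mem_erase hr h.1

/-- The letters are the self-maps of `Ω` with positive probability when the images are drawn
independently from the columns of `T`; they generate a semigroup of maps, and the marginal of a
random map at `s` is column `s`. -/
theorem exists_randomLetterRep {Ω : Type w} [Fintype Ω] {T : Matrix Ω Ω ℝ}
    (hT : T ∈ Matrix.colStochastic ℝ Ω) :
    ∃ (S : Type w) (_ : Semigroup S) (_ : Fintype S) (α : Type w) (_ : Fintype α),
      Nonempty (RandomLetterRep T S α) := by
  let α : Type w := {f : Ω → Ω // 0 < mapProb T f}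
  let G : Set (Function.End Ω) := {f | 0 < mapProb T (f : Ω → Ω)}
  let S := Subsemigroup.closure G
  have : Finite (Function.End Ω) := inferInstanceAs (Finite (Ω → Ω))
  have hsub : ∀ h : (Ω → Ω) → ℝ, (∀ f, ¬ 0 < mapProb T f → h f = 0) →
      ∑ a : α, h a.1 = ∑ f : Ω → Ω, h f := by
    intro h hh
    rw [← Finset.sum_filter_of_ne (s := Finset.univ) (p := fun f : Ω → Ω => 0 < mapProb T f)
      fun f _ hf => by_contra fun h' => hf (hh f h')]
    exact (Finset.sum_subtype _ (fun f => by simp) h).symm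
  refine ⟨S, inferInstance, Fintype.ofFinite S, α, inferInstance, ⟨{
    gen := fun a => ⟨a.1, Subsemigroup.subset_closure a.2⟩
    generates := ?_
    x := fun a => mapProb T a.1
    x_mem := ⟨fun a => a.2, ?_⟩
    act := fun s ω => (s : Function.End Ω) ω
    act_mul := fun _ _ _ => rfl
    transition := fun s' s => ?_ }⟩⟩
  · rw [← Subsemigroup.closure_closure_coe_preimage (s := G)]
    congr 1
    ext s
    exact ⟨fun ⟨a, ha⟩ => ha ▸ a.2, fun hs => ⟨⟨s.1, hs⟩, rfl⟩⟩
  · rw [hsub (fun f => mapProb T f) fun f hf => le_antisymm (not_lt.1 hf) (mapProb_nonneg hT f)]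
    exact sum_mapProb hT
  · refine (sum_mapProb_fibre hT s' s).symm.trans (hsub _ fun f hf => ?_).symm
    rw [le_antisymm (not_lt.1 hf) (mapProb_nonneg hT f), ite_self]

end RandomLetter

/-! ### Assembling the three parts of the theorem -/

theorem mainTheorem1 :
    -- the random walk on the minimal ideal of a finite semigroup
    (∀ (S : Type u) [Semigroup S] [Fintype S] (α : Type v) [Fintype α] (g : α → S)
        (_ : Subsemigroup.closure (Set.range g) = ⊤) (x : α → ℝ) (_ : x ∈ openSimplex α),
      -- `K(S)` left zero
      (IsLeftZero (minimalIdeal S) →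
        (∀ w ∈ minimalIdeal S, ∀ t ∈ treeOver g w,
          IsLoopGraph (pictKR g t) ∧ NormalSummable (pictKR g t) x) ∧
        ∀ Ψ : minimalIdeal S → ℝ, IsStationaryDist (walkMatrix g x (minimalIdeal S)) Ψ ↔
          ∀ w : minimalIdeal S, Ψ w = normalSum g x w) ∧
      -- `K(S)` not left zero
      (¬ IsLeftZero (minimalIdeal S) →
        (∀ w ∈ minimalIdeal S, ∀ t ∈ boxTreeOver g w,
          IsLoopGraph (pictKR (boxGen g) t) ∧
          (∀ y ∈ openSimplex (Option α), NormalSummable (pictKR (boxGen g) t) y) ∧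
          ∃ l : ℝ, Tendsto (fun y => normalDist (pictKR (boxGen g) t) y) (boxLimit x) (𝓝 l)) ∧
        IsStationaryDist (walkMatrix g x (minimalIdeal S))
          (fun w : minimalIdeal S => limitSum g x w) ∧
        ∀ L : Set S, IsMinimalLeftIdeal L →
          0 < ∑ v : L, limitSum g x v ∧
          ∀ Φ : L → ℝ, IsStationaryDist (walkMatrix g x L) Φ ↔
            ∀ w : L, Φ w = limitSum g x w / ∑ v : L, limitSum g x v)) ∧
    -- arbitrary finite Markov chains
    (∀ (Ω : Type w) [Fintype Ω] [Nonempty Ω] (T : Matrix Ω Ω ℝ)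
        (_ : T ∈ Matrix.colStochastic ℝ Ω),
      (∃ (S : Type w) (_ : Semigroup S) (_ : Fintype S) (α : Type w) (_ : Fintype α),
        Nonempty (RandomLetterRep T S α)) ∧
      ∀ (S : Type u) [Semigroup S] [Fintype S] (α : Type v) [Fintype α]
        (R : RandomLetterRep T S α) (ω : Ω),
        (IsLeftZero (minimalIdeal S) →
          IsStationaryDist T (sumOverFibre R.act (normalSum R.gen R.x) ω) ∧
          (IsIrreducibleChain T → ∀ Ψ : Ω → ℝ, IsStationaryDist T Ψ →
            Ψ = sumOverFibre R.act (normalSum R.gen R.x) ω)) ∧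
        (¬ IsLeftZero (minimalIdeal S) →
          IsStationaryDist T (sumOverFibre R.act (limitSum R.gen R.x) ω) ∧
          (IsIrreducibleChain T → ∀ Ψ : Ω → ℝ, IsStationaryDist T Ψ →
            Ψ = sumOverFibre R.act (limitSum R.gen R.x) ω))) := by
  have left : ∀ (S : Type u) [Semigroup S] [Fintype S] (α : Type v) [Fintype α] (g : α → S),
      Subsemigroup.closure (Set.range g) = ⊤ → ∀ x ∈ openSimplex α,
      IsLeftZero (minimalIdeal S) → IsStationaryDist (walkMatrix g x (minimalIdeal S))
        fun w : minimalIdeal S => normalSum g x w := fun S _ _ α _ g hg x hx hK => by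
    rw [show (fun w : minimalIdeal S => normalSum g x w) = _ from
      funext fun w => normalSum_eq_wordMass hK w.2 hx]
    exact isStationaryDist_wordMass hg hx
  have box : ∀ (S : Type u) [Semigroup S] [Fintype S] (α : Type v) [Fintype α] (g : α → S),
      Subsemigroup.closure (Set.range g) = ⊤ → ∀ x ∈ openSimplex α,
      IsStationaryDist (walkMatrix g x (minimalIdeal S))
        fun w : minimalIdeal S => limitSum g x w := fun S _ _ α _ g hg x hx => by
    simp only [limitSum_eq_wordMass _ hx]
    exact isStationaryDist_wordMass hg hx
  refine ⟨fun S _ _ α _ g hg x hx => ⟨fun hK => ⟨?_, fun Ψ => ?_⟩,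
    fun _ => ⟨?_, box S α g hg x hx, fun L hL => ?_⟩⟩, fun Ω _ _ T hT =>
      ⟨exists_randomLetterRep hT, fun S _ _ α _ R ω => ⟨fun hK => ?_, fun _ => ?_⟩⟩⟩
  · rintro w hw t ⟨ht, htw⟩
    have hv : InK (mcVal g t) := htw ▸ inK_coe.2 hw
    exact ⟨isLoopGraph_pictKR hK ht hv,
      (normalSummable_pictKR_iff hK ht hv x).2 (wordSummable_semaphoreCode_mcRun hK hv hx)⟩
  · have : Nonempty α := by
      by_contra h
      rw [not_nonempty_iff] at h
      simpa using hx.2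
    have : Nonempty S := this.map g
    -- A left zero `K(S)` is itself a minimal left ideal, and its total mass is one, so the
    -- normalising denominator disappears.
    rw [isStationaryDist_minimalLeftIdeal_iff hg hx hK.isMinimalLeftIdeal,
      (isStationaryDist_wordMass hg hx).2.1]
    exact forall_congr' fun w => by rw [div_one, normalSum_eq_wordMass hK w.2 hx]
  · intro w _ t ht
    have hv := inK_of_mem_boxTreeOver ht
    exact ⟨isLoopGraph_pictKR isLeftZero_withZero ht.1 hv, fun y hy =>
      (normalSummable_pictKR_iff isLeftZero_withZero ht.1 hv y).2
        (wordSummable_semaphoreCode_mcRun isLeftZero_withZero hv hy),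
      exists_tendsto_normalDist ht hx⟩
  · simp only [limitSum_eq_wordMass _ hx]
    exact ⟨sum_wordMass_pos hg hx hL, isStationaryDist_minimalLeftIdeal_iff hg hx hL⟩
  · have h := R.isStationaryDist_sumOverFibre ω (left S α R.gen R.generates R.x R.x_mem hK)
    exact ⟨h, fun hirr Ψ hΨ => hΨ.unique (fun _ _ => Matrix.nonneg_of_mem_colStochastic hT)
      (Matrix.sum_col_of_mem_colStochastic hT) hirr h⟩
  · have h := R.isStationaryDist_sumOverFibre ω (box S α R.gen R.generates R.x R.x_mem)
    exact ⟨h, fun hirr Ψ hΨ => hΨ.unique (fun _ _ => Matrix.nonneg_of_mem_colStochastic hT)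
      (Matrix.sum_col_of_mem_colStochastic hT) hirr h⟩
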